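/- **Setup.** Let $\Phi$ be an irreducible reduced (crystallographic) root system spanning a Euclidean space $E$, with Weyl group $W$, base $\alpha_1,\dots,\alpha_r$, simple reflections $s_i$, coroots $\alpha^\vee=2\alpha/\|\alpha\|^2$, weight lattice $P$ and fundamental weights $\varpi_i$. Let $\mathbf Q:P\to\mathbb Q$ be a $W$-invariant quadratic form, integral on the root lattice, $\mathbf B(\lambda,\mu)=\mathbf Q(\lambda+\mu)-\mathbf Q(\lambda)-\mathbf Q(\mu)$, $n\in\mathbb Z_{>0}$, $m(\alpha)=n/\gcd(n,\mathbf Q(\alpha))$ and $\alpha^m=m(\alpha)\alpha$. Let $P^m\subseteq P$ be the weight lattice of the root system $\Phi^m=\{\alpha^m\}_{\alpha\in\Phi}$, whose coroots are $\alpha^{m\vee}=m(\alpha)^{-1}\alpha^\vee$. Let $\mathbb C(P^m)\subseteq\mathbb C(P)$ be the quotient fields of the group algebras $\mathbb C[P^m]\subseteq\mathbb C[P]$, with monomials $x^\lambda$; $W$ acts on $\mathbb C(P^m)$ by field automorphisms with $w(x^\nu)=x^{w\nu}$, and $W\ltimes\mathbb C(P^m)$ is the corresponding semidirect product algebra. Let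 $\mathbf k:\Phi\to\mathbb C^\times$ be $W$-invariant and $\mathbf k_i=\mathbf k_{\alpha_i}$. Write $\mathrm{size}(\alpha^m)=sh$ if $\Phi^m$ has a root strictly longer than $\alpha^m$, and $\mathrm{size}(\alpha^m)=lg$ otherwise. Let $g_j(y)\in\mathbb C^\times$ ($j\in\mathbb Z$, $y\in\{sh,lg\}$) be $n$-periodic in $j$, with $g_j(y)=-1$ for $j\in n\mathbb Z$, and $g_j(y)g_{n-j}(y)=\mathbf k_\alpha^{-2}$ whenever $j\notin n\mathbb Z$ and $y=\mathrm{size}(\alpha^m)$, $\alpha\in\Phi$. For $\lambda\in P$ put $\mathbf q(\lambda)=\lambda-\sum_i \mathbf r_{m(\alpha_i)}((\lambda,\alpha_i^\vee))\varpi_i$, where $\mathbf r_s(t)\in\{0,\dots,s-1\}$ is the remainder of $t$ modulo $s$. Let $\widetilde H^m(\mathbf k)$ be the extended affine Hecke algebra: the unital $\mathbb C$-algebra generated by $\mathbb C[P^m]$ and $T_1,\dots,T_r$, subject to $(T_i-\mathbf k_i)(T_i+\mathbf k_i^{-1})=0$, the braid relations of $W$, and $T_if-(s_if)T_i=(\mathbf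 k_i-\mathbf k_i^{-1})\frac{f-s_if}{1-x^{\alpha_i^m}}$ for $f\in\mathbb C[P^m]$. Let $\widetilde H^m_{\mathrm{loc}}(\mathbf k)$ be its Ore localization at $\mathbb C[P^m]\setminus\{0\}$. Put $c_i=\frac{1-\mathbf k_i^2x^{\alpha_i^m}}{1-x^{\alpha_i^m}}$, $\rho=\frac12\sum_{\alpha>0}\alpha$ and $\rho^m=\frac12\sum_{\alpha>0}\alpha^m$. **Theorem.** 1. The formulas $$\sigma(s_i)(fx^\lambda)=\frac{(1-\mathbf k_i^2)\,x^{(\mathbf q(-\lambda),\alpha_i^{m\vee})\alpha_i^m}}{1-\mathbf k_i^2x^{\alpha_i^m}}(s_if)x^\lambda+\mathbf k_i^2\,g_{\mathbf Q(\alpha_i)-\mathbf B(\lambda,\alpha_i)}(\mathrm{size}(\alpha_i^m))\,\frac{1-x^{-\alpha_i^m}}{1-\mathbf k_i^2x^{\alpha_i^m}}(s_if)x^{\alpha_i+s_i\lambda},$$ $$\sigma(g)(fx^\lambda)=gfx^\lambda$$ ($f,g\in\mathbb C(P^m)$, $\lambda\in P$, $1\le i\le r$) define a (unique) left $W\ltimes\mathbb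 C(P^m)$-module structure on $\mathbb C(P)$. 2. The formulas $$\pi(T_i)x^\lambda=(\mathbf k_i-\mathbf k_i^{-1})\frac{1-x^{-(\mathbf q(\lambda),\alpha_i^{m\vee})\alpha_i^m}}{1-x^{\alpha_i^m}}x^\lambda-\mathbf k_i\,g_{-\mathbf B(\lambda,\alpha_i)}(\mathrm{size}(\alpha_i^m))\,x^{s_i\lambda},\qquad \pi(x^\nu)x^\lambda=x^{\lambda+\nu}$$ ($\lambda\in P$, $\nu\in P^m$) define a (unique) representation $\pi$ of $\widetilde H^m(\mathbf k)$ on $\mathbb C[P]$, and there is a unique algebra isomorphism $\varphi:W\ltimes\mathbb C(P^m)\to\widetilde H^m_{\mathrm{loc}}(\mathbf k)$ with $\varphi(f)=f$ for $f\in\mathbb C(P^m)$ and $\varphi(s_i)=\frac{\mathbf k_i}{c_i}T_i+1-\frac{\mathbf k_i^2}{c_i}$. The localized module $\mathbb C[P]_{\mathrm{loc}}=\widetilde H^m_{\mathrm{loc}}(\mathbf k)\otimes_{\widetilde H^m(\mathbf k)}\mathbb C[P]$ is identified with $\mathbb C(P)$ by $fh\otimes v\mapsto f\cdot(\pi(h)v)$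 ($f\in\mathbb C(P^m)$, $h\in\widetilde H^m(\mathbf k)$, $v\in\mathbb C[P]$). If $\pi_{\mathrm{loc}}$ is the resulting action of $W\ltimes\mathbb C(P^m)$ on $\mathbb C(P)$ through $\varphi$, then $\rho-\rho^m\in P$ and $$\sigma(X)F=x^{\rho-\rho^m}\,\pi_{\mathrm{loc}}(X)\bigl(x^{\rho^m-\rho}F\bigr)\qquad(X\in W\ltimes\mathbb C(P^m),\ F\in\mathbb C(P)).$$ 3. If $\mathbf k^2$ is constant with value $v$ and $g_j(sh)=g_j(lg)=g_j$ for all $j$, then $\sigma$ is given by the Chinta–Gunnells formula $$\sigma(s_i)(fx^\lambda)=\frac{(s_if)x^{s_i\lambda}}{1-vx^{\alpha_i^m}}\Bigl[(1-v)x^{-\mathbf r_{m(\alpha_i)}(-(\lambda,\alpha_i^\vee))\alpha_i}-v\,g_{\mathbf Q(\alpha_i)-\mathbf B(\lambda,\alpha_i)}x^{(1-m(\alpha_i))\alpha_i}\bigl(1-x^{\alpha_i^m}\bigr)\Bigr].$$ -/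

import Mathlib

noncomputable section

namespace Metaplectic

variable {ι E N : Type*} [NormedAddCommGroup E] [InnerProductSpace ℝ E]
  [AddCommGroup N] [Module ℝ N]

/-! ### Lattices, group algebras and their fields of fractions -/

instance twoUniqueSums_addSubgroup (L : AddSubgroup E) : TwoUniqueSums L := by
  let _ : Module ℚ E := Module.compHom E (algebraMap ℚ ℝ)
  exact TwoUniqueSums.of_injective_addHom L.subtype.toAddHom Subtype.val_injective inferInstance

section RootPairing

variable (R : RootPairing ι ℝ E N)

/-- The weight lattice `P = {λ ∈ E | (λ, α^∨) ∈ ℤ for all roots α}`. -/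
def weightLattice : AddSubgroup E where
  carrier := {v | ∀ i, ∃ z : ℤ, R.coroot' i v = z}
  zero_mem' := fun i => ⟨0, by simp⟩
  add_mem' := by
    intro a b ha hb i
    obtain ⟨x, hx⟩ := ha i
    obtain ⟨y, hy⟩ := hb i
    exact ⟨x + y, by rw [map_add, hx, hy]; push_cast; rfl⟩
  neg_mem' := by
    intro a ha i
    obtain ⟨x, hx⟩ := ha i
    exact ⟨-x, by rw [map_neg, hx]; push_cast; rfl⟩

/-- The integer `(λ, α^∨)` for a weight `λ` and a root `α`. -/
def wt (v : weightLattice R) (i : ι) : ℤ := ⌊R.coroot' i (v : E)⌋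

theorem wt_spec (v : weightLattice R) (i : ι) : (wt R v i : ℝ) = R.coroot' i (v : E) := by
  obtain ⟨z, hz⟩ := v.2 i
  simp [wt, hz]

/-- A pointwise condition on coroot pairings that is stable under reflections is stable under the
Weyl group. -/
theorem weyl_stable (p : E → Prop) (h : ∀ i v, p v → p (R.reflection i v))
    (w : R.weylGroup) (v : E) (hv : p v) : p (w • v) := by
  obtain ⟨w, hw⟩ := w
  revert v
  induction hw using RootPairing.weylGroup.induction with
  | mem i => intro v hv; exact h i v hv
  | one => intro v hv; simpa using hv
  | mul x y hx hy hx' hy' =>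
    intro v hv
    have := hx' _ (hy' v hv)
    rwa [← mul_smul] at this

theorem weightLattice_stable (w : R.weylGroup) (v : E) (hv : v ∈ weightLattice R) :
    w • v ∈ weightLattice R := by
  refine weyl_stable R (fun v => v ∈ weightLattice R) ?_ w v hv
  intro i v hv j
  obtain ⟨z, hz⟩ := hv (R.reflectionPerm i j)
  exact ⟨z, by rw [R.coroot'_reflection, hz]⟩

/-- The action of `W` on a stable lattice. -/
@[reducible]
def latticeAction (L : AddSubgroup E) (hL : ∀ (w : R.weylGroup) (v : E), v ∈ L → w • v ∈ L) :
    DistribMulAction R.weylGroup L where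
  smul w v := ⟨w • (v : E), hL w v v.2⟩
  one_smul v := Subtype.ext (one_smul _ (v : E))
  mul_smul w w' v := Subtype.ext (mul_smul w w' (v : E))
  smul_zero w := Subtype.ext (smul_zero w)
  smul_add w v v' := Subtype.ext (smul_add w (v : E) (v' : E))

instance : DistribMulAction R.weylGroup (weightLattice R) :=
  latticeAction R _ (weightLattice_stable R)

/-- The simple (or any) reflection `s_α ∈ W`. -/
abbrev refl (i : ι) : R.weylGroup := RootPairing.weylGroup.ofIdx R i

variable [R.IsCrystallographic]

/-- A root, as an element of `P`. -/
def rootP (i : ι) : weightLattice R :=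
  ⟨R.root i, fun j => by
    obtain ⟨z, hz⟩ := R.exists_value (S := ℤ) i j
    exact ⟨z, hz.symm⟩⟩

theorem smul_rootP (w : R.weylGroup) (i : ι) : w • rootP R i = rootP R (w • i) :=
  Subtype.ext (RootPairing.weylGroup_apply_root R w i)

end RootPairing

/-- `ℂ[P]`. -/
abbrev GroupAlgP (R : RootPairing ι ℝ E N) : Type _ := AddMonoidAlgebra ℂ (weightLattice R)

/-- `ℂ(P)`. -/
abbrev FieldP (R : RootPairing ι ℝ E N) : Type _ := FractionRing (GroupAlgP R)

/-- The monomial `x^λ ∈ ℂ(P)`. -/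
def xP (R : RootPairing ι ℝ E N) (v : weightLattice R) : FieldP R :=
  algebraMap (GroupAlgP R) (FieldP R) (AddMonoidAlgebra.single v 1)

/-! ### The metaplectic data -/

/-- The metaplectic and Hecke data: a `W`-invariant quadratic form `Q : P → ℚ` which is integral
on the root lattice, a positive integer `n`, and a `W`-invariant function `k : Φ → ℂˣ`. -/
structure Datum (R : RootPairing ι ℝ E N) where
  Q : QuadraticMap ℤ (weightLattice R) ℚ
  Q_weyl : ∀ (w : R.weylGroup) (v : weightLattice R), Q (w • v) = Q v
  Q_int : ∀ v : weightLattice R, (v : E) ∈ AddSubgroup.closure (Set.range R.root) →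
    ∃ z : ℤ, Q v = z
  n : ℕ
  n_pos : 0 < n
  k : ι → ℂ
  k_ne_zero : ∀ i, k i ≠ 0
  k_weyl : ∀ (w : R.weylGroup) (i : ι), k (w • i) = k i

namespace Datum

variable {R : RootPairing ι ℝ E N} (D : Datum R)

/-- The bilinear form `B(λ, μ) = Q(λ + μ) - Q(λ) - Q(μ)`. -/
def B (v w : weightLattice R) : ℚ := D.Q (v + w) - D.Q v - D.Q w

variable [R.IsCrystallographic]

/-- `m(α) = n / gcd(n, Q(α))` (recall that `Q(α)` is an integer). -/
def m (i : ι) : ℕ := D.n / Int.gcd D.n ⌊D.Q (rootP R i)⌋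

theorem m_pos (i : ι) : 0 < D.m i :=
  Nat.div_pos (Nat.le_of_dvd D.n_pos (by
    exact_mod_cast Int.gcd_dvd_left (D.n : ℤ) ⌊D.Q (rootP R i)⌋))
    (Int.gcd_pos_of_ne_zero_left _ (by exact_mod_cast D.n_pos.ne'))

theorem m_weyl (w : R.weylGroup) (i : ι) : D.m (w • i) = D.m i := by
  rw [m, m, ← smul_rootP, D.Q_weyl]

/-- The weight lattice `P^m` of the root system `Φ^m = {m(α) α}`, whose coroots are
`m(α)⁻¹ α^∨`. -/
def Pm : AddSubgroup E where
  carrier := {v | ∀ i, ∃ z : ℤ, (D.m i : ℝ)⁻¹ * R.coroot' i v = z}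
  zero_mem' := fun i => ⟨0, by simp⟩
  add_mem' := by
    intro a b ha hb i
    obtain ⟨x, hx⟩ := ha i
    obtain ⟨y, hy⟩ := hb i
    exact ⟨x + y, by rw [map_add, mul_add, hx, hy]; push_cast; rfl⟩
  neg_mem' := by
    intro a ha i
    obtain ⟨x, hx⟩ := ha i
    exact ⟨-x, by rw [map_neg, mul_neg, hx]; push_cast; rfl⟩

theorem Pm_le : D.Pm ≤ weightLattice R := by
  intro v hv i
  obtain ⟨z, hz⟩ := hv i
  have : (D.m i : ℝ) ≠ 0 := by exact_mod_cast (D.m_pos i).ne'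
  refine ⟨D.m i * z, ?_⟩
  push_cast
  rw [← hz, mul_inv_cancel_left₀ this]

theorem Pm_stable (w : R.weylGroup) (v : E) (hv : v ∈ D.Pm) : w • v ∈ D.Pm := by
  refine weyl_stable R (fun v => v ∈ D.Pm) ?_ w v hv
  intro i v hv j
  obtain ⟨z, hz⟩ := hv (R.reflectionPerm i j)
  refine ⟨z, ?_⟩
  rw [R.coroot'_reflection, ← hz]
  have : R.reflectionPerm i j = refl R i • j := rfl
  rw [this, D.m_weyl]

instance : DistribMulAction R.weylGroup D.Pm := latticeAction R _ D.Pm_stable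

/-- `B(λ, α) = Q(α) (λ, α^∨)`. -/
theorem B_root (v : weightLattice R) (i : ι) :
    D.B v (rootP R i) = D.Q (rootP R i) * wt R v i := by
  have h1 : refl R i • v = v - wt R v i • rootP R i := by
    apply Subtype.ext
    change R.reflection i (v : E) = (v : E) - wt R v i • R.root i
    rw [R.reflection_apply, ← wt_spec R v i, Int.cast_smul_eq_zsmul]
  have h2 : refl R i • rootP R i = - rootP R i :=
    Subtype.ext (R.reflection_apply_self i)
  have h3 : D.B (refl R i • v) (refl R i • rootP R i) = D.B v (rootP R i) := by
    simp only [B, ← smul_add, D.Q_weyl]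
  have hB : ∀ a b, D.B a b = D.Q.polarBilin a b := fun a b => rfl
  have hself : D.Q.polarBilin (rootP R i) (rootP R i) = 2 * D.Q (rootP R i) := by
    simp [two_mul]
  rw [h1, h2, hB, hB] at h3
  simp only [map_sub, map_neg, LinearMap.sub_apply, map_zsmul, LinearMap.smul_apply, hself,
    zsmul_eq_mul] at h3
  rw [hB]
  linarith

theorem Q_root_int (i : ι) : D.Q (rootP R i) = (⌊D.Q (rootP R i)⌋ : ℤ) := by
  obtain ⟨z, hz⟩ := D.Q_int (rootP R i) (AddSubgroup.subset_closure ⟨i, rfl⟩)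
  simp [hz]

/-- `α^m = m(α) α`, as an element of `P`. -/
def rootmP (i : ι) : weightLattice R := D.m i • rootP R i

theorem rootm_mem (i : ι) : (D.rootmP i : E) ∈ D.Pm := by
  intro j
  set a := ⌊D.Q (rootP R i)⌋ with ha
  set b := ⌊D.Q (rootP R j)⌋ with hb
  set c := wt R (rootP R i) j with hc
  set d := wt R (rootP R j) i with hd
  have hab : b * c = a * d := by
    have h1 := D.B_root (rootP R i) j
    have h2 := D.B_root (rootP R j) i
    have h3 : D.B (rootP R i) (rootP R j) = D.B (rootP R j) (rootP R i) := by
      simp only [B, add_comm]; ring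
    rw [h1, h2, D.Q_root_int i, D.Q_root_int j] at h3
    exact_mod_cast h3
  have hn : (D.n : ℤ) ∣ (D.m i : ℤ) * a := by
    have hg := Int.gcd_dvd_right (D.n : ℤ) a
    have hg' : Int.gcd D.n a ∣ D.n := by
      exact_mod_cast Int.gcd_dvd_left (D.n : ℤ) a
    obtain ⟨t, ht⟩ := hg
    refine ⟨t, ?_⟩
    have hm : ((D.m i : ℤ)) * (Int.gcd D.n a : ℤ) = D.n := by
      exact_mod_cast Nat.div_mul_cancel hg'
    calc (D.m i : ℤ) * a = (D.m i : ℤ) * ((Int.gcd D.n a : ℤ) * t) := by rw [← ht]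
      _ = D.n * t := by rw [← mul_assoc, hm]
  have hdvd : (D.m j : ℤ) ∣ (D.m i : ℤ) * c := by
    have h1 : (D.n : ℤ) ∣ b * ((D.m i : ℤ) * c) := by
      have : b * ((D.m i : ℤ) * c) = ((D.m i : ℤ) * a) * d := by
        rw [mul_left_comm, hab]; ring
      rw [this]
      exact Dvd.dvd.mul_right hn d
    have h2 : D.m j ∣ ((D.m i : ℤ) * c).natAbs := by
      have h1' : D.n ∣ b.natAbs * ((D.m i : ℤ) * c).natAbs := by
        rw [← Int.natAbs_mul]; exact Int.natCast_dvd.mp h1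
      have : Nat.gcd D.n b.natAbs = Int.gcd D.n b := by simp [Int.gcd]
      rw [m, ← hb, ← this]
      exact (Nat.Coprime.dvd_of_dvd_mul_left
        (Nat.coprime_div_gcd_div_gcd (Nat.gcd_pos_of_pos_left _ D.n_pos))
        (by
          have hpos := Nat.gcd_pos_of_pos_left b.natAbs D.n_pos
          obtain ⟨u, hu⟩ := Nat.gcd_dvd_right D.n b.natAbs
          obtain ⟨v, hv⟩ := Nat.gcd_dvd_left D.n b.natAbs
          obtain ⟨s, hs⟩ := h1'
          refine ⟨s, ?_⟩
          have e1 : b.natAbs / Nat.gcd D.n b.natAbs = u :=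
            Nat.div_eq_of_eq_mul_right hpos hu
          have e2 : D.n / Nat.gcd D.n b.natAbs = v :=
            Nat.div_eq_of_eq_mul_right hpos hv
          rw [e1, e2]
          apply Nat.eq_of_mul_eq_mul_left hpos
          rw [← mul_assoc, ← hu, hs, ← mul_assoc, ← hv]))
    exact Int.natCast_dvd.mpr h2
  obtain ⟨z, hz⟩ := hdvd
  refine ⟨z, ?_⟩
  have hmj : (D.m j : ℝ) ≠ 0 := by exact_mod_cast (D.m_pos j).ne'
  have : R.coroot' j (D.rootmP i : E) = (D.m i : ℝ) * c := by
    rw [hc, wt_spec, rootmP, AddSubgroup.coe_nsmul, map_nsmul, nsmul_eq_mul]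
  rw [this]
  have hz' : (D.m i : ℝ) * c = D.m j * z := by exact_mod_cast hz
  rw [hz', inv_mul_cancel_left₀ hmj]

/-- `α^m = m(α) α`, as an element of `P^m`. -/
def rootm (i : ι) : D.Pm := ⟨D.rootmP i, D.rootm_mem i⟩

/-! ### The field `ℂ(P^m)` and the algebra `W ⋉ ℂ(P^m)` -/

/-- `ℂ[P^m]`. -/
abbrev A : Type _ := AddMonoidAlgebra ℂ D.Pm

/-- `ℂ(P^m)`. -/
abbrev K : Type _ := FractionRing D.A

/-- The monomial `x^ν ∈ ℂ[P^m]`. -/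
def xA (v : D.Pm) : D.A := AddMonoidAlgebra.single v 1

/-- The monomial `x^ν ∈ ℂ(P^m)`. -/
def xK (v : D.Pm) : D.K := algebraMap D.A D.K (D.xA v)

/-- `W` acts on `ℂ[P^m]` by `w (x^ν) = x^{w ν}`. -/
instance : MulSemiringAction R.weylGroup D.A where
  smul w f := AddMonoidAlgebra.mapDomainRingHom ℂ
    ((DistribSMul.toAddMonoidHom D.Pm w : D.Pm →+ D.Pm)) f
  one_smul f := by
    change AddMonoidAlgebra.mapDomainRingHom ℂ _ f = f
    induction f using AddMonoidAlgebra.induction_linear with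
    | zero => simp
    | add f g hf hg => rw [map_add, hf, hg]
    | single a b => simp
  mul_smul w w' f := by
    change AddMonoidAlgebra.mapDomainRingHom ℂ _ f = AddMonoidAlgebra.mapDomainRingHom ℂ _
      (AddMonoidAlgebra.mapDomainRingHom ℂ _ f)
    induction f using AddMonoidAlgebra.induction_linear with
    | zero => simp
    | add f g hf hg => rw [map_add, hf, hg, map_add, map_add]
    | single a b => simp [mul_smul]
  smul_zero w := map_zero _
  smul_add w := map_add _
  smul_one w := map_one _
  smul_mul w := map_mul _

/-- The action of `W` on `ℂ(P^m)` by field automorphisms extending that on `ℂ[P^m]`. -/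
instance : MulSemiringAction R.weylGroup D.K :=
  IsFractionRing.mulSemiringAction R.weylGroup D.A D.K

/-- The semidirect product algebra `W ⋉ ℂ(P^m)`: elements are finite sums `∑ f_w w` with
`f_w ∈ ℂ(P^m)`, and `(f v)(g w) = f (v g) (v w)`. -/
abbrev WK : Type _ := SkewMonoidAlgebra D.K R.weylGroup

/-- `w ∈ W` as an element of `W ⋉ ℂ(P^m)`. -/
def ofW (w : R.weylGroup) : D.WK := SkewMonoidAlgebra.single w 1

/-- `f ∈ ℂ(P^m)` as an element of `W ⋉ ℂ(P^m)`. -/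
def ofK (f : D.K) : D.WK := SkewMonoidAlgebra.single 1 f

/-- The inclusion `ℂ[P^m] ⊆ ℂ[P]`. -/
def inclA : D.A →+* GroupAlgP R :=
  AddMonoidAlgebra.mapDomainRingHom ℂ (AddSubgroup.inclusion D.Pm_le)

theorem inclA_injective : Function.Injective D.inclA :=
  AddMonoidAlgebra.mapDomain_injective (AddSubgroup.inclusion_injective D.Pm_le)

/-- The inclusion `ℂ(P^m) ⊆ ℂ(P)`. -/
def inclK : D.K →+* FieldP R :=
  IsFractionRing.lift (A := D.A) (K := D.K) (L := FieldP R)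
    (g := (algebraMap (GroupAlgP R) (FieldP R)).comp D.inclA)
    ((IsFractionRing.injective (GroupAlgP R) (FieldP R)).comp D.inclA_injective)

/-! ### Root lengths and representation parameters -/

end Datum

/-- The two possible sizes of the roots of `Φ^m`. -/
inductive RootSize
  | sh
  | lg

namespace Datum

variable {R : RootPairing ι ℝ E N} (D : Datum R) [R.IsCrystallographic]

open Classical in
/-- `size(α^m)`: short if `Φ^m` has a strictly longer root, and long otherwise. In particular all
roots are long if they have the same length. -/
def size (i : ι) : RootSize :=
  if ∃ j, ‖(D.m i : ℝ) • R.root i‖ < ‖(D.m j : ℝ) • R.root j‖ then .sh else .lg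

/-- Representation parameters `g_j(y)`, for `j ∈ ℤ` and `y ∈ {sh, lg}`. -/
structure RepParams where
  g : ℤ → RootSize → ℂ
  g_ne_zero : ∀ j y, g j y ≠ 0
  g_eq_neg_one : ∀ j y, (D.n : ℤ) ∣ j → g j y = -1
  g_emod : ∀ j y, g j y = g (j % D.n) y
  g_mul : ∀ (i : ι) (j : ℤ), ¬ (D.n : ℤ) ∣ j →
    g j (D.size i) * g (D.n - j) (D.size i) = (D.k i ^ 2)⁻¹

/-- The integer `B(λ, α)`, for a weight `λ` and a root `α`. -/
def BZ (v : weightLattice R) (i : ι) : ℤ := ⌊D.B v (rootP R i)⌋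

/-- The integer `Q(α)`, for a root `α`. -/
def QZ (i : ι) : ℤ := ⌊D.Q (rootP R i)⌋

theorem QZ_spec (i : ι) : (D.QZ i : ℚ) = D.Q (rootP R i) := (D.Q_root_int i).symm

theorem BZ_spec (v : weightLattice R) (i : ι) : (D.BZ v i : ℚ) = D.B v (rootP R i) := by
  rw [BZ, D.B_root, D.Q_root_int, ← Int.cast_mul, Int.floor_intCast]

end Datum

/-! ### Fundamental weights, `q` and `ρ` -/

theorem mem_weightLattice_of_simple {R : RootPairing ι ℝ E N} (b : R.Base) (v : E) (h : ∀ i : b.support, ∃ z : ℤ, R.coroot' i v = z) :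
    v ∈ weightLattice R := by
  intro i
  have key : ∀ y ∈ Submodule.span ℤ (R.coroot '' b.support), ∃ z : ℤ, R.toLinearMap v y = z := by
    intro y hy
    induction hy using Submodule.span_induction with
    | mem x hx => obtain ⟨j, hj, rfl⟩ := hx; exact h ⟨j, hj⟩
    | zero => exact ⟨0, by simp⟩
    | add x y _ _ hx hy =>
      obtain ⟨a, ha⟩ := hx
      obtain ⟨c, hc⟩ := hy
      exact ⟨a + c, by rw [map_add, ha, hc]; push_cast; rfl⟩
    | smul n x _ hx =>
      obtain ⟨a, ha⟩ := hx
      exact ⟨n * a, by rw [map_zsmul, ha, zsmul_eq_mul]; push_cast; rfl⟩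
  exact key _ (b.coroot_mem_span_int i)

section Base

variable {R : RootPairing ι ℝ E N} [R.IsRootSystem] (b : R.Base)

/-- The fundamental weights `ϖ_i ∈ E`, dual to the simple coroots. -/
def fundWeight (i : b.support) : E := R.toPerfPair.symm (b.toCoweightBasis.coord i)

theorem coroot'_fundWeight (i j : b.support) [DecidableEq b.support] :
    R.coroot' j (fundWeight b i) = if i = j then 1 else 0 := by
  have h : R.coroot' j (fundWeight b i) = R.toPerfPair (fundWeight b i) (R.coroot j) := rfl
  rw [h, fundWeight, LinearEquiv.apply_symm_apply, Module.Basis.coord_apply,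
    RootPairing.Base.toCoweightBasis_repr_coroot, Finsupp.single_apply]
  simp [eq_comm]

/-- The fundamental weights, as elements of `P`. -/
def fundWeightP (i : b.support) : weightLattice R :=
  ⟨fundWeight b i, mem_weightLattice_of_simple b _ (fun j => by
    classical
    exact ⟨if i = j then 1 else 0, by rw [coroot'_fundWeight]; split_ifs <;> simp⟩)⟩

open Classical in
/-- The half sum `½ ∑_{α > 0} c(α) α`, over the positive roots. -/
def halfSum [Fintype ι] (c : ι → ℝ) : E :=
  (2 : ℝ)⁻¹ • ∑ i : ι,
    if R.root i ∈ AddSubmonoid.closure (R.root '' b.support) then c i • R.root i else 0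

end Base

namespace Datum

variable {R : RootPairing ι ℝ E N} [R.IsCrystallographic] [R.IsRootSystem]
  (D : Datum R) (b : R.Base)

/-- `q(λ) = λ - r(λ)`, with `r(λ) = ∑_i r_{m(α_i)}((λ, α_i^∨)) ϖ_i`. -/
def q (v : weightLattice R) : weightLattice R :=
  v - ∑ i : b.support, (wt R v i % (D.m i : ℤ)) • fundWeightP b i

/-- The integer `(q(λ), (α_i^m)^∨) = m(α_i)⁻¹ (q(λ), α_i^∨)`. -/
def qwt (v : weightLattice R) (i : b.support) : ℤ :=
  ⌊(D.m i : ℝ)⁻¹ * R.coroot' i (D.q b v : E)⌋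

theorem qwt_aux (v : weightLattice R) (i : b.support) :
    (D.m i : ℝ)⁻¹ * R.coroot' i (D.q b v : E) = ((wt R v i / (D.m i : ℤ) : ℤ) : ℝ) := by
  classical
  have hm : (D.m i : ℝ) ≠ 0 := by exact_mod_cast (D.m_pos i).ne'
  have h1 : R.coroot' i (D.q b v : E) = ((wt R v i - wt R v i % (D.m i : ℤ) : ℤ) : ℝ) := by
    have : (D.q b v : E) = (v : E) - ∑ j : b.support,
        (wt R v j % (D.m j : ℤ)) • fundWeight b j := by
      simp [q, fundWeightP]
    rw [this, map_sub, map_sum, ← wt_spec]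
    simp only [map_zsmul, coroot'_fundWeight, zsmul_eq_mul]
    simp
  rw [h1, inv_mul_eq_iff_eq_mul₀ hm]
  have := Int.emod_add_mul_ediv (wt R v i) (D.m i : ℤ)
  have h2 : wt R v i - wt R v i % (D.m i : ℤ) = (D.m i : ℤ) * (wt R v i / (D.m i : ℤ)) := by
    linarith
  exact_mod_cast h2

theorem qwt_spec (v : weightLattice R) (i : b.support) :
    (D.qwt b v i : ℝ) = (D.m i : ℝ)⁻¹ * R.coroot' i (D.q b v : E) := by
  rw [qwt, qwt_aux, Int.floor_intCast]

end Datum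

/-! ### The extended affine Hecke algebra and its localization -/

/-- The alternating product `a b a b ⋯` with `n` factors. -/
def altProd {M : Type*} [Monoid M] : ℕ → M → M → M
  | 0, _, _ => 1
  | n + 1, a, b => a * altProd n b a

namespace Datum

variable {R : RootPairing ι ℝ E N} [R.IsCrystallographic] (D : Datum R) (b : R.Base)

/-- The free algebra on symbols `T_i` (for the simple roots) and `[f]` (for `f ∈ ℂ[P^m]`). -/
abbrev FreeH : Type _ := FreeAlgebra ℂ (b.support ⊕ D.A)

/-- The symbol `T_i`. -/
def preT (i : b.support) : D.FreeH b := FreeAlgebra.ι ℂ (Sum.inl i)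

/-- The symbol `[f]`. -/
def preA (f : D.A) : D.FreeH b := FreeAlgebra.ι ℂ (Sum.inr f)

/-- The defining relations of the extended affine Hecke algebra: the relations of the algebra
`ℂ[P^m]`, the quadratic and braid relations of the finite Hecke algebra, and the
Bernstein-Zelevinsky relations `T_i f - (s_i f) T_i = (k_i - k_i⁻¹) ∇_i(f)`, where
`∇_i(f) = (f - s_i f) / (1 - x^{α_i^m})` is the divided difference. -/
inductive HeckeRel : D.FreeH b → D.FreeH b → Prop
  | add (f g : D.A) : HeckeRel (D.preA b (f + g)) (D.preA b f + D.preA b g)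
  | mul (f g : D.A) : HeckeRel (D.preA b (f * g)) (D.preA b f * D.preA b g)
  | scalar (c : ℂ) : HeckeRel (D.preA b (algebraMap ℂ D.A c)) (algebraMap ℂ (D.FreeH b) c)
  | quadratic (i : b.support) :
      HeckeRel ((D.preT b i - algebraMap ℂ (D.FreeH b) (D.k i)) *
        (D.preT b i + algebraMap ℂ (D.FreeH b) (D.k i)⁻¹)) 0
  | braid (i j : b.support) (hij : i ≠ j) :
      HeckeRel (altProd (orderOf (refl R i * refl R j)) (D.preT b i) (D.preT b j))
        (altProd (orderOf (refl R i * refl R j)) (D.preT b j) (D.preT b i))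
  | cross (i : b.support) (f d : D.A)
      (hd : (1 - D.xA (D.rootm i)) * d = f - refl R (i : ι) • f) :
      HeckeRel (D.preT b i * D.preA b f - D.preA b (refl R (i : ι) • f) * D.preT b i)
        ((D.k i - (D.k i)⁻¹) • D.preA b d)

/-- The extended affine Hecke algebra `H̃^m(k)`. -/
abbrev H : Type _ := RingQuot (D.HeckeRel b)

/-- The generator `T_i` of `H̃^m(k)`. -/
def T (i : b.support) : D.H b := RingQuot.mkAlgHom ℂ (D.HeckeRel b) (D.preT b i)

theorem mk_rel {x y : D.FreeH b} (h : D.HeckeRel b x y) :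
    RingQuot.mkAlgHom ℂ (D.HeckeRel b) x = RingQuot.mkAlgHom ℂ (D.HeckeRel b) y :=
  RingQuot.mkAlgHom_rel ℂ h

/-- The canonical homomorphism `ℂ[P^m] → H̃^m(k)`. -/
def ofA : D.A →ₐ[ℂ] D.H b :=
  AlgHom.ofLinearMap
    { toFun := fun f => RingQuot.mkAlgHom ℂ (D.HeckeRel b) (D.preA b f)
      map_add' := fun f g => by rw [D.mk_rel b (.add f g), map_add]
      map_smul' := fun c f => by
        rw [Algebra.smul_def, D.mk_rel b (.mul _ f), map_mul, D.mk_rel b (.scalar c),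
          AlgHom.commutes, RingHom.id_apply, Algebra.smul_def] }
    (by
      have := D.mk_rel b (.scalar 1)
      rw [map_one, map_one, map_one] at this
      exact this)
    (fun f g => by
      change RingQuot.mkAlgHom ℂ (D.HeckeRel b) (D.preA b (f * g)) = _
      rw [D.mk_rel b (.mul f g), map_mul]
      rfl)

theorem commute_of_generators (z : D.H b) (hT : ∀ i, Commute (D.T b i) z)
    (hA : ∀ f, Commute (D.ofA b f) z) (h : D.H b) : Commute h z := by
  obtain ⟨x, rfl⟩ := RingQuot.mkAlgHom_surjective ℂ (D.HeckeRel b) h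
  induction x using FreeAlgebra.induction with
  | grade0 r => rw [AlgHom.commutes]; exact Algebra.commutes r z
  | grade1 x =>
    rcases x with i | f
    · exact hT i
    · exact hA f
  | mul a c ha hc => rw [map_mul]; exact ha.mul_left hc
  | add a c ha hc => rw [map_add]; exact ha.add_left hc

/-- `W`-invariant elements of `ℂ[P^m]` are central in `H̃^m(k)`. -/
theorem central_of_invariant (f : D.A) (hf : ∀ w : R.weylGroup, w • f = f) (h : D.H b) :
    Commute h (D.ofA b f) := by
  refine D.commute_of_generators b _ (fun i => ?_) (fun g => ?_) h
  · have := D.mk_rel b (.cross i f 0 (by rw [hf]; simp))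
    rw [hf, map_sub, map_mul, map_mul, map_smul] at this
    have h0 : RingQuot.mkAlgHom ℂ (D.HeckeRel b) (D.preA b 0) = 0 := map_zero (D.ofA b)
    rw [h0, smul_zero, sub_eq_zero] at this
    exact this
  · exact (Commute.all g f).map (D.ofA b)

/-- The multiplicative set `ℂ[P^m] ∖ {0}` in `H̃^m(k)`. -/
def S : Submonoid (D.H b) := (nonZeroDivisors D.A).map (D.ofA b)

theorem finite_weylGroup {R : RootPairing ι ℝ E N} [Finite ι] [R.IsRootSystem] :
    Finite R.weylGroup := by
  refine Finite.of_injective (fun w : R.weylGroup => R.weylGroupToPerm w) ?_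
  intro w w' h
  apply Subtype.ext
  apply RootPairing.Equiv.weightHom_injective R
  apply LinearEquiv.toLinearMap_injective
  refine LinearMap.ext_on_range (v := R.root) ?_ ?_
  · exact RootPairing.IsRootSystem.span_root_eq_top
  · intro i
    have h1 := RootPairing.weylGroup_apply_root R w i
    have h2 := RootPairing.weylGroup_apply_root R w' i
    have h' : R.weylGroupToPerm w = R.weylGroupToPerm w' := h
    rw [h', ← h2] at h1
    exact h1

variable [Finite ι] [R.IsRootSystem]

/-- Every nonzero element of `ℂ[P^m]` divides a nonzero `W`-invariant element. -/
theorem exists_norm (f : D.A) (hf : f ∈ nonZeroDivisors D.A) :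
    ∃ t ∈ nonZeroDivisors D.A, ∀ w : R.weylGroup, w • (f * t) = f * t := by
  classical
  have : Finite R.weylGroup := finite_weylGroup
  let _ : Fintype R.weylGroup := Fintype.ofFinite _
  have hf0 : f ≠ 0 := nonZeroDivisors.ne_zero hf
  refine ⟨∏ w ∈ Finset.univ.erase (1 : R.weylGroup), w • f, ?_, ?_⟩
  · rw [mem_nonZeroDivisors_iff_ne_zero, Finset.prod_ne_zero_iff]
    intro w _ h
    apply hf0
    have := congrArg (fun x => w⁻¹ • x) h
    simpa using this
  · have h : f * ∏ w ∈ Finset.univ.erase (1 : R.weylGroup), w • f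
        = ∏ w : R.weylGroup, w • f := by
      rw [← Finset.mul_prod_erase Finset.univ (fun w : R.weylGroup => w • f)
        (Finset.mem_univ 1), one_smul]
    intro w
    rw [h, Finset.smul_prod']
    simp_rw [← mul_smul]
    exact Fintype.prod_equiv (Equiv.mulLeft w) _ _ (fun _ => rfl)

theorem ore_aux (s : D.S b) : ∃ (t : D.H b) (u : D.S b),
    (u : D.H b) = t * s ∧ (u : D.H b) = s * t ∧ ∀ h : D.H b, Commute h u := by
  obtain ⟨s, f, hf, rfl⟩ := s
  obtain ⟨t, ht, hinv⟩ := D.exists_norm f hf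
  refine ⟨D.ofA b t, ⟨D.ofA b (f * t), ⟨f * t, mul_mem hf ht, rfl⟩⟩, ?_, ?_, ?_⟩
  · change D.ofA b (f * t) = D.ofA b t * D.ofA b f
    rw [mul_comm, map_mul]
  · change D.ofA b (f * t) = D.ofA b f * D.ofA b t
    rw [map_mul]
  · exact D.central_of_invariant b _ hinv

instance : OreLocalization.OreSet (D.S b) where
  ore_right_cancel r₁ r₂ s h := by
    obtain ⟨t, u, h1, h2, hc⟩ := D.ore_aux b s
    refine ⟨u, ?_⟩
    rw [← (hc r₁).eq, ← (hc r₂).eq, h2, ← mul_assoc, ← mul_assoc, h]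
  oreNum r s := r * (D.ore_aux b s).choose
  oreDenom r s := (D.ore_aux b s).choose_spec.choose
  ore_eq r s := by
    obtain ⟨h1, h2, hc⟩ := (D.ore_aux b s).choose_spec.choose_spec
    exact (hc r).eq.symm.trans ((congrArg (r * ·) h1).trans (mul_assoc _ _ _).symm)

/-- The localization `H̃^m_loc(k)` of `H̃^m(k)` at `ℂ[P^m] ∖ {0}`. -/
abbrev Hloc : Type _ := OreLocalization (D.S b) (D.H b)

/-- The canonical homomorphism `H̃^m(k) → H̃^m_loc(k)`. -/
def toLoc : D.H b →+* D.Hloc b := OreLocalization.numeratorRingHom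

/-- The canonical homomorphism `ℂ(P^m) → H̃^m_loc(k)`, extending `ℂ[P^m] → H̃^m(k)`. -/
def ofKLoc : D.K →+* D.Hloc b :=
  OreLocalization.universalHom (S := nonZeroDivisors D.A)
    ((D.toLoc b).comp (D.ofA b : D.A →+* D.H b))
    { toFun := fun f => OreLocalization.numeratorUnit
        (⟨D.ofA b f, f, f.2, rfl⟩ : D.S b)
      map_one' := Units.ext (map_one ((D.toLoc b).comp (D.ofA b : D.A →+* D.H b)))
      map_mul' := fun f g =>
        Units.ext (map_mul ((D.toLoc b).comp (D.ofA b : D.A →+* D.H b)) (f : D.A) (g : D.A)) }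
    (fun _ => rfl)

/-- The `c`-function `c_α = (1 - k_α² x^{α^m}) / (1 - x^{α^m})`. -/
def cFun (i : ι) : D.K :=
  (1 - algebraMap ℂ D.K (D.k i ^ 2) * D.xK (D.rootm i)) / (1 - D.xK (D.rootm i))

/-- `ℂ[P]` as an `H̃^m(k)`-module, through a representation `π` of `H̃^m(k)` on `ℂ[P]`. -/
@[nolint unusedArguments]
def RepModule (_π : D.H b →ₐ[ℂ] Module.End ℂ (GroupAlgP R)) : Type _ := GroupAlgP R

variable (π : D.H b →ₐ[ℂ] Module.End ℂ (GroupAlgP R))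

instance : AddCommGroup (D.RepModule b π) := inferInstanceAs (AddCommGroup (GroupAlgP R))

instance : Module (D.H b) (D.RepModule b π) :=
  Module.compHom (GroupAlgP R) (π : D.H b →+* Module.End ℂ (GroupAlgP R))

/-- An element of `ℂ[P]`, as an element of the module defined by `π`. -/
def toRepModule (v : GroupAlgP R) : D.RepModule b π := v

/-- The localized module `ℂ[P]_loc`, i.e. the extension of scalars of the `H̃^m(k)`-module
`(π, ℂ[P])` to `H̃^m_loc(k)`. -/
abbrev RepLoc : Type _ := OreLocalization (D.S b) (D.RepModule b π)

/-- The element `h ⊗ v` of `ℂ[P]_loc`, for `h ∈ H̃^m_loc(k)` and `v ∈ ℂ[P]`. -/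
def tmul (h : D.Hloc b) (v : GroupAlgP R) : D.RepLoc b π :=
  h • (OreLocalization.oreDiv (D.toRepModule b π v) 1 : D.RepLoc b π)

/-! ### The representations -/

variable {D} (G : D.RepParams)

/-- `π` is the representation of `H̃^m(k)` on `ℂ[P]` with
`π(T_i) x^λ = (k_i - k_i⁻¹) (1 - x^{-(q(λ), α_i^{m∨}) α_i^m}) / (1 - x^{α_i^m}) x^λ
  - k_i g_{-B(λ, α_i)}(size(α_i^m)) x^{s_i λ}` and `π(x^ν) x^λ = x^{λ + ν}`. -/
structure IsHeckeRep (π : D.H b →ₐ[ℂ] Module.End ℂ (GroupAlgP R)) : Prop where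
  apply_T : ∀ (i : b.support) (v : weightLattice R),
    algebraMap (GroupAlgP R) (FieldP R) (π (D.T b i) (AddMonoidAlgebra.single v 1)) =
      algebraMap ℂ (FieldP R) (D.k i - (D.k i)⁻¹) *
          ((1 - xP R (-(D.qwt b v i • D.rootmP i))) / (1 - xP R (D.rootmP i))) * xP R v -
        algebraMap ℂ (FieldP R) (D.k i * G.g (-D.BZ v i) (D.size i)) *
          xP R (refl R (i : ι) • v)
  apply_x : ∀ (u : D.Pm) (v : weightLattice R),
    π (D.ofA b (D.xA u)) (AddMonoidAlgebra.single v 1) =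
      AddMonoidAlgebra.single (v + AddSubgroup.inclusion D.Pm_le u) 1

/-- `φ : W ⋉ ℂ(P^m) ≅ H̃^m_loc(k)` is the localization isomorphism:
`φ(f) = f` for `f ∈ ℂ(P^m)`, and `φ(s_i) = (k_i / c_i) T_i + 1 - k_i² / c_i`. -/
structure IsLocIso (φ : D.WK ≃+* D.Hloc b) : Prop where
  apply_K : ∀ f : D.K, φ (D.ofK f) = D.ofKLoc b f
  apply_s : ∀ i : b.support, φ (D.ofW (refl R (i : ι))) =
    D.ofKLoc b (algebraMap ℂ D.K (D.k i) / D.cFun i) * D.toLoc b (D.T b i) + 1 -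
      D.ofKLoc b (algebraMap ℂ D.K (D.k i ^ 2) / D.cFun i)

/-- `Θ : ℂ[P]_loc ≅ ℂ(P)` is the identification `f h ⊗ v ↦ f (π(h) v)`, for `f ∈ ℂ(P^m)`,
`h ∈ H̃^m(k)` and `v ∈ ℂ[P]`. -/
def IsLocIdent (Θ : D.RepLoc b π ≃+ FieldP R) : Prop :=
  ∀ (f : D.K) (h : D.H b) (v : GroupAlgP R),
    Θ (D.tmul b π (D.ofKLoc b f * D.toLoc b h) v) =
      D.inclK f * algebraMap (GroupAlgP R) (FieldP R) (π h v)

/-- `σ` is the representation of `W ⋉ ℂ(P^m)` on `ℂ(P)` given by the metaplectic formulas. -/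
structure IsWeylRep (σ : D.WK →+* Module.End ℂ (FieldP R)) : Prop where
  apply_s : ∀ (i : b.support) (f : D.K) (v : weightLattice R),
    σ (D.ofW (refl R (i : ι))) (D.inclK f * xP R v) =
      algebraMap ℂ (FieldP R) (1 - D.k i ^ 2) * xP R (D.qwt b (-v) i • D.rootmP i) /
          (1 - algebraMap ℂ (FieldP R) (D.k i ^ 2) * xP R (D.rootmP i)) *
          D.inclK (refl R (i : ι) • f) * xP R v +
        algebraMap ℂ (FieldP R) (D.k i ^ 2 * G.g (D.QZ i - D.BZ v i) (D.size i)) *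
          ((1 - xP R (-D.rootmP i)) /
            (1 - algebraMap ℂ (FieldP R) (D.k i ^ 2) * xP R (D.rootmP i))) *
          D.inclK (refl R (i : ι) • f) * xP R (rootP R i + refl R (i : ι) • v)
  apply_K : ∀ (g f : D.K) (v : weightLattice R),
    σ (D.ofK g) (D.inclK f * xP R v) = D.inclK g * D.inclK f * xP R v

end Datum
end Metaplectic
end

/-! Put a_i = c_i / k_i and b_i = (k_i - k_i⁻¹) / (1 - x^{α_i^m}). Everything rests on the
substitution T_i = a_i s_i + b_i, which is invertible over ℂ(P^m). Take any ring containing an image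
of ℂ(P^m), and elements A_i with A_i f = (s_i f) A_i. Then T_i = a_i A_i + b_i satisfies the
quadratic Hecke relation exactly when A_i² = 1 (`dlT_quadratic_iff`). When A_i² = 1, the defect of a
braid relation for the T_i is a nonzero element of ℂ(P^m) times the defect for the A_i
(`dlT_braid`). So Hecke relations and Weyl group relations are interchangeable. The second fact is a
rank two computation, resting on the addition law for (1 + x^β) / (1 - x^β).

The principle is applied in three rings. In W ⋉ ℂ(P^m) it turns reflections into Hecke generators
and gives a map from the Hecke algebra (`exists_heckeHom`). In the localized Hecke algebra it turns
generators into reflections, which gives the inverse and so the isomorphism φ (`exists_locIso`). In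
the endomorphisms of ℂ(P) it produces the Weyl group action from the formulas for π(T_i)
(`RepParams.exists_rep`). Passing from involutions with braid relations to an action of W is
Matsumoto's theorem (`exists_weylGroup_lift`).

For the third ring the relations are checked on monomials x^λ. By semilinearity one representative
of each class modulo P^m is enough, and it can be chosen small: |(λ, α^∨)| ≤ m(α) for all roots α.
If moreover 0 ≤ (λ, α_i^∨), then T_i sends x^λ to a scalar multiple of x^{s_i λ}. On a small weight
that is dominant for i and j, both sides of the braid relation therefore give the same monomial, and
the scalars are one product over the positive roots of the rank two subsystem, taken in opposite
orders. The other small weights follow because the braid defect of the involutions anticommutes with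
the letters up to exchanging them (`RepParams.eq_of_eq_dominant`).

The resulting action of W ⋉ ℂ(P^m) restricts to π on ℂ[P], and its conjugate by x^{ρ - ρ^m} is σ.
Since (ρ - ρ^m, α_i^∨) = 1 - m(α_i), conjugation turns floors of (λ, α_i^∨) / m(α_i) into ceilings
and shifts the index of g by Q(α_i) modulo n. -/

noncomputable section


namespace Metaplectic

/-! ### Braid defects of two elements satisfying quadratic relations -/

section QuadraticPairs

variable {Z : Type*} [Ring Z] {T U c d : Z}

/-- When T² = cT + 1 and U² = dU + 1, the elements T - c and U - d are the inverses of T and U. The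
sum is then θ = TU + (TU)⁻¹, and this symmetry also gives θ = UT + (UT)⁻¹. -/
theorem central_sum_comm (hcd : c * d = d * c) (cU : c * U = U * c) (dT : d * T = T * d) :
    T * U + (U - d) * (T - c) = U * T + (T - c) * (U - d) := by
  simp only [sub_mul, mul_sub]
  rw [hcd, dT, cU]
  noncomm_ring

theorem central_sum_mul (hT : T * T = c * T + 1) (hU : U * U = d * U + 1) :
    (T * U + (U - d) * (T - c)) * (T * U) = T * U * (T * U) + 1 := by
  have h1 : (T - c) * T = 1 := by rw [sub_mul, hT]; noncomm_ring
  have h2 : (U - d) * U = 1 := by rw [sub_mul, hU]; noncomm_ring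
  have : (U - d) * (T - c) * (T * U) = (U - d) * ((T - c) * T) * U := by noncomm_ring
  rw [add_mul, this, h1, mul_one, h2]

/-- With X = TU and Y = UT one has θX = X² + 1 and θY = Y² + 1, and subtraction gives the
factorization. Both factors have short expansions in the reflections, which the words of length four
do not. -/
theorem altProd_four_sub (hT : T * T = c * T + 1) (hU : U * U = d * U + 1)
    (hcd : c * d = d * c) (cU : c * U = U * c) (dT : d * T = T * d) :
    altProd 4 T U - altProd 4 U T =
      (T * U + (U - d) * (T - c)) * (T * U - U * T) := by
  have h5 : (T * U + (U - d) * (T - c)) * (U * T) = U * T * (U * T) + 1 := by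
    rw [central_sum_comm hcd cU dT, central_sum_mul hU hT]
  rw [mul_sub, central_sum_mul hT hU, h5]
  simp only [altProd]
  noncomm_ring

/-- From θX = X² + 1 follows θ²X = X³ + X + θ, and likewise for Y, so (θ² - 1)(X - Y) = X³ - Y³. -/
theorem altProd_six_sub (hT : T * T = c * T + 1) (hU : U * U = d * U + 1)
    (hcd : c * d = d * c) (cU : c * U = U * c) (dT : d * T = T * d) :
    altProd 6 T U - altProd 6 U T =
      (T * U + (U - d) * (T - c) - 1) *
        ((T * U + (U - d) * (T - c) + 1) * (T * U - U * T)) := by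
  set θ := T * U + (U - d) * (T - c) with hθ
  have h4 : θ * (T * U) = T * U * (T * U) + 1 := central_sum_mul hT hU
  have h5 : θ * (U * T) = U * T * (U * T) + 1 := by
    rw [hθ, central_sum_comm hcd cU dT, central_sum_mul hU hT]
  have h6 : (θ - 1) * ((θ + 1) * (T * U - U * T)) =
      T * U * (T * U) * (T * U) - U * T * (U * T) * (U * T) := by
    have e1 : (θ - 1) * ((θ + 1) * (T * U - U * T)) =
      θ * (θ * (T * U)) - θ * (θ * (U * T)) - (T * U - U * T) := by noncomm_ring
    rw [e1, h4, h5, mul_add, mul_add, ← mul_assoc θ (T * U), ← mul_assoc θ (U * T), h4, h5]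
    noncomm_ring
  rw [h6]
  simp only [altProd]
  noncomm_ring

end QuadraticPairs

/-! ### Normal forms in two semilinear involutions -/

section WordExpansion

variable {K Z : Type*} [CommRing K] [Ring Z] (ι : K →+* Z) {A B : Z} {s t : K →+* K}

/-- Coefficients are moved to the left through A and B, and A² = B² = 1 leaves only alternating
words. The left factor has the shape of θ, the right factor that of the commutator of two
Demazure-Lusztig operators. -/
theorem wordExpansion_mul_four (hA : ∀ f, A * ι f = ι (s f) * A) (hB : ∀ f, B * ι f = ι (t f) * B)
    (hAA : A * A = 1) (hBB : B * B = 1) (u0 u1 u2 u3 u4 v1 v2 v3 v4 : K) :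
    (ι u0 + ι u1 * A + ι u2 * B + ι u3 * (A * B) + ι u4 * (B * A)) *
        (ι v1 * A + ι v2 * B + ι v3 * (A * B) + ι v4 * (B * A)) =
      ι (u1 * s v1 + u2 * t v2 + u3 * s (t v4) + u4 * t (s v3)) +
      ι (u0 * v1 + u3 * s (t v2) + u2 * t v4) * A +
      ι (u0 * v2 + u1 * s v3 + u4 * t (s v1)) * B +
      ι (u0 * v3 + u1 * s v2) * (A * B) +
      ι (u0 * v4 + u2 * t v1) * (B * A) +
      ι (u3 * s (t v1) + u1 * s v4) * (A * (B * A)) +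
      ι (u4 * t (s v2) + u2 * t v3) * (B * (A * B)) +
      ι (u3 * s (t v3)) * (A * (B * (A * B))) +
      ι (u4 * t (s v4)) * (B * (A * (B * A))) := by
  have hA' : ∀ f z, A * (ι f * z) = ι (s f) * (A * z) := fun f z => by
    rw [← mul_assoc, hA, mul_assoc]
  have hB' : ∀ f z, B * (ι f * z) = ι (t f) * (B * z) := fun f z => by
    rw [← mul_assoc, hB, mul_assoc]
  have hAA' : ∀ z, A * (A * z) = z := fun z => by rw [← mul_assoc, hAA, one_mul]
  have hBB' : ∀ z, B * (B * z) = z := fun z => by rw [← mul_assoc, hBB, one_mul]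
  simp only [mul_add, add_mul, map_add, map_mul, mul_assoc, hA', hB', hA, hB, hAA', hBB', hAA, hBB,
    mul_one]
  abel

/-- The right factor has the shape of the output of `wordExpansion_mul_four`; this is the second
multiplication needed for words of length six. -/
theorem wordExpansion_mul_eight (hA : ∀ f, A * ι f = ι (s f) * A)
    (hB : ∀ f, B * ι f = ι (t f) * B)
    (hAA : A * A = 1) (hBB : B * B = 1) (u0 u1 u2 u3 u4 e0 e1 e2 e3 e4 e5 e6 e7 e8 : K) :
    (ι u0 + ι u1 * A + ι u2 * B + ι u3 * (A * B) + ι u4 * (B * A)) *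
        (ι e0 + ι e1 * A + ι e2 * B + ι e3 * (A * B) + ι e4 * (B * A) +
          ι e5 * (A * (B * A)) + ι e6 * (B * (A * B)) +
          ι e7 * (A * (B * (A * B))) + ι e8 * (B * (A * (B * A)))) =
      ι (u0 * e0 + u1 * s e1 + u2 * t e2 + u3 * s (t e4) + u4 * t (s e3)) +
      ι (u0 * e1 + u1 * s e0 + u2 * t e4 + u3 * s (t e2) + u4 * t (s e5)) * A +
      ι (u0 * e2 + u1 * s e3 + u2 * t e0 + u3 * s (t e6) + u4 * t (s e1)) * B +
      ι (u0 * e3 + u1 * s e2 + u2 * t e6 + u3 * s (t e0) + u4 * t (s e7)) * (A * B) +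
      ι (u0 * e4 + u1 * s e5 + u2 * t e1 + u3 * s (t e8) + u4 * t (s e0)) * (B * A) +
      ι (u0 * e5 + u1 * s e4 + u2 * t e8 + u3 * s (t e1)) * (A * (B * A)) +
      ι (u0 * e6 + u1 * s e7 + u2 * t e3 + u4 * t (s e2)) * (B * (A * B)) +
      ι (u0 * e7 + u1 * s e6 + u3 * s (t e3)) * (A * (B * (A * B))) +
      ι (u0 * e8 + u2 * t e5 + u4 * t (s e4)) * (B * (A * (B * A))) +
      ι (u1 * s e8 + u3 * s (t e5)) * (A * (B * (A * (B * A)))) +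
      ι (u2 * t e7 + u4 * t (s e6)) * (B * (A * (B * (A * B)))) +
      ι (u3 * s (t e7)) * (A * (B * (A * (B * (A * B))))) +
      ι (u4 * t (s e8)) * (B * (A * (B * (A * (B * A))))) := by
  have hA' : ∀ f z, A * (ι f * z) = ι (s f) * (A * z) := fun f z => by
    rw [← mul_assoc, hA, mul_assoc]
  have hB' : ∀ f z, B * (ι f * z) = ι (t f) * (B * z) := fun f z => by
    rw [← mul_assoc, hB, mul_assoc]
  have hAA' : ∀ z, A * (A * z) = z := fun z => by rw [← mul_assoc, hAA, one_mul]
  have hBB' : ∀ z, B * (B * z) = z := fun z => by rw [← mul_assoc, hBB, one_mul]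
  simp only [mul_add, add_mul, map_add, map_mul, mul_assoc, hA', hB', hA, hB, hAA', hBB', hAA, hBB,
    mul_one]
  abel

theorem wordExpansion_triple (hA : ∀ f, A * ι f = ι (s f) * A) (hB : ∀ f, B * ι f = ι (t f) * B)
    (hAA : A * A = 1) (u0 u1 v0 v1 : K) :
    (ι u1 * A + ι u0) * ((ι v1 * B + ι v0) * (ι u1 * A + ι u0)) =
      ι (u0 * v0 * u0 + u1 * s v0 * s u1) +
      ι (u0 * v0 * u1 + u1 * s v0 * s u0) * A + ι (u0 * v1 * t u0) * B +
      ι (u1 * s v1 * s (t u0)) * (A * B) + ι (u0 * v1 * t u1) * (B * A) +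
      ι (u1 * s v1 * s (t u1)) * (A * (B * A)) := by
  have hA' : ∀ f z, A * (ι f * z) = ι (s f) * (A * z) := fun f z => by
    rw [← mul_assoc, hA, mul_assoc]
  have hB' : ∀ f z, B * (ι f * z) = ι (t f) * (B * z) := fun f z => by
    rw [← mul_assoc, hB, mul_assoc]
  simp only [mul_add, add_mul, map_add, map_mul, mul_assoc, hA', hB', hA, hB, hAA, mul_one]
  abel

theorem wordExpansion_sum (hA : ∀ f, A * ι f = ι (s f) * A) (hB : ∀ f, B * ι f = ι (t f) * B)
    (a b a' b' b₁ b₂ : K) :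
    (ι a * A + ι b) * (ι a' * B + ι b') + (ι a' * B + ι b₂) * (ι a * A + ι b₁) =
      ι (b * b' + b₂ * b₁) + ι (a * s b' + b₂ * a) * A + ι (b * a' + a' * t b₁) * B +
      ι (a * s a') * (A * B) + ι (a' * t a) * (B * A) := by
  have hA' : ∀ f z, A * (ι f * z) = ι (s f) * (A * z) := fun f z => by
    rw [← mul_assoc, hA, mul_assoc]
  have hB' : ∀ f z, B * (ι f * z) = ι (t f) * (B * z) := fun f z => by
    rw [← mul_assoc, hB, mul_assoc]
  simp only [mul_add, add_mul, map_add, map_mul, mul_assoc, hA', hB', hA, hB]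
  abel

theorem wordExpansion_commutator (hA : ∀ f, A * ι f = ι (s f) * A)
    (hB : ∀ f, B * ι f = ι (t f) * B) (a b a' b' : K) :
    (ι a * A + ι b) * (ι a' * B + ι b') - (ι a' * B + ι b') * (ι a * A + ι b) =
      ι (a * s b' - b' * a) * A + ι (b * a' - a' * t b) * B +
      ι (a * s a') * (A * B) + ι (-(a' * t a)) * (B * A) := by
  have hA' : ∀ f z, A * (ι f * z) = ι (s f) * (A * z) := fun f z => by
    rw [← mul_assoc, hA, mul_assoc]
  have hB' : ∀ f z, B * (ι f * z) = ι (t f) * (B * z) := fun f z => by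
    rw [← mul_assoc, hB, mul_assoc]
  have hbb : ι b' * ι b = ι b * ι b' := by rw [← map_mul, mul_comm, map_mul]
  simp only [mul_add, add_mul, map_sub, map_neg, map_mul, mul_assoc, hA', hB', hA, hB,
    sub_mul, neg_mul, hbb]
  abel

/-- The braid relation for A and B is not assumed, so the two longest words stay distinct. It
suffices that the shorter words cancel and that the two longest ones carry the same coefficient. -/
theorem words_three {c0 c1 c2 c3 c4 c5 d0 d1 d2 d3 d4 d5 C : K} (h0 : c0 = d0) (h1 : c1 = d2)
    (h2 : c2 = d1) (h3 : c3 = d4) (h4 : c4 = d3) (h5 : c5 = C) (h6 : d5 = C) :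
    ι c0 + ι c1 * A + ι c2 * B + ι c3 * (A * B) + ι c4 * (B * A) + ι c5 * (A * (B * A)) -
      (ι d0 + ι d1 * B + ι d2 * A + ι d3 * (B * A) + ι d4 * (A * B) + ι d5 * (B * (A * B))) =
      ι C * (A * (B * A) - B * (A * B)) := by
  subst h0 h1 h2 h3 h4 h5 h6
  rw [mul_sub]
  abel

theorem words_four {e0 e1 e2 e3 e4 e5 e6 e7 e8 C : K} (h0 : e0 = 0) (h1 : e1 = 0) (h2 : e2 = 0)
    (h3 : e3 = 0) (h4 : e4 = 0) (h5 : e5 = 0) (h6 : e6 = 0) (h7 : e7 = C) (h8 : e8 = -C) :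
    ι e0 + ι e1 * A + ι e2 * B + ι e3 * (A * B) + ι e4 * (B * A) +
          ι e5 * (A * (B * A)) + ι e6 * (B * (A * B)) +
          ι e7 * (A * (B * (A * B))) + ι e8 * (B * (A * (B * A))) =
      ι C * (A * (B * (A * B)) - B * (A * (B * A))) := by
  subst h0 h1 h2 h3 h4 h5 h6 h7 h8
  simp only [map_zero, zero_mul, zero_add, map_neg, neg_mul, mul_sub]
  abel

theorem words_six {e0 e1 e2 e3 e4 e5 e6 e7 e8 e9 e10 e11 e12 C : K} (h0 : e0 = 0) (h1 : e1 = 0)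
    (h2 : e2 = 0) (h3 : e3 = 0) (h4 : e4 = 0) (h5 : e5 = 0) (h6 : e6 = 0) (h7 : e7 = 0)
    (h8 : e8 = 0) (h9 : e9 = 0) (h10 : e10 = 0) (h11 : e11 = C) (h12 : e12 = -C) :
    ι e0 + ι e1 * A + ι e2 * B + ι e3 * (A * B) + ι e4 * (B * A) +
          ι e5 * (A * (B * A)) + ι e6 * (B * (A * B)) +
          ι e7 * (A * (B * (A * B))) + ι e8 * (B * (A * (B * A))) +
      ι e9 * (A * (B * (A * (B * A)))) + ι e10 * (B * (A * (B * (A * B)))) +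
      ι e11 * (A * (B * (A * (B * (A * B))))) + ι e12 * (B * (A * (B * (A * (B * A))))) =
      ι C * (A * (B * (A * (B * (A * B)))) - B * (A * (B * (A * (B * A))))) := by
  subst h0 h1 h2 h3 h4 h5 h6 h7 h8 h9 h10 h11 h12
  simp only [map_zero, zero_mul, zero_add, map_neg, neg_mul, mul_sub]
  abel

end WordExpansion
end Metaplectic


/-! ### Demazure-Lusztig operators on a rank two torus -/

namespace Metaplectic

/-- The monomials of a rank two torus over a field, with two reflections acting by field
endomorphisms, and an invariant parameter for each of them. -/
structure RankTwoTorus (K : Type*) [Field K] (p q : ℤ) where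
  X : ℤ → ℤ → K
  s : K →+* K
  t : K →+* K
  k : K
  l : K
  X_zero : X 0 0 = 1
  X_add : ∀ i j i' j', X (i + i') (j + j') = X i j * X i' j'
  X_ne_one : ∀ i j, (i ≠ 0 ∨ j ≠ 0) → X i j ≠ 1
  s_X : ∀ i j, s (X i j) = X (-i + p * j) j
  t_X : ∀ i j, t (X i j) = X i (-j + q * i)
  k_ne_zero : k ≠ 0
  l_ne_zero : l ≠ 0
  s_k : s k = k
  s_l : s l = l
  t_k : t k = k
  t_l : t l = l
  k_X_ne_one : ∀ i j, (i ≠ 0 ∨ j ≠ 0) → k ^ 2 * X i j ≠ 1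
  l_X_ne_one : ∀ i j, (i ≠ 0 ∨ j ≠ 0) → l ^ 2 * X i j ≠ 1

namespace RankTwoTorus

variable {K : Type*} [Field K] {p q : ℤ} (D : RankTwoTorus K p q)

/-- The same data with the two reflections exchanged. -/
def swap : RankTwoTorus K q p where
  X i j := D.X j i
  s := D.t
  t := D.s
  k := D.l
  l := D.k
  X_zero := D.X_zero
  X_add i j i' j' := D.X_add j i j' i'
  X_ne_one i j h := D.X_ne_one j i h.symm
  s_X i j := D.t_X j i
  t_X i j := D.s_X j i
  k_ne_zero := D.l_ne_zero
  l_ne_zero := D.k_ne_zero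
  s_k := D.t_l
  s_l := D.t_k
  t_k := D.s_l
  t_l := D.s_k
  k_X_ne_one i j h := D.l_X_ne_one j i h.symm
  l_X_ne_one i j h := D.k_X_ne_one j i h.symm

/-- The function `(1 + x^β) / (1 - x^β)`. -/
def h (i j : ℤ) : K := (1 + D.X i j) / (1 - D.X i j)

theorem one_sub_X_ne {i j : ℤ} (hij : i ≠ 0 ∨ j ≠ 0) : 1 - D.X i j ≠ 0 :=
  sub_ne_zero.2 (D.X_ne_one i j hij).symm

theorem X_neg (i j : ℤ) : D.X (-i) (-j) * D.X i j = 1 := by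
  rw [← D.X_add]; simp [D.X_zero]

theorem h_neg {i j i' j' : ℤ} (hi : i' = -i) (hj : j' = -j) (hij : i ≠ 0 ∨ j ≠ 0) :
    D.h i' j' = - D.h i j := by
  subst hi hj
  have h1 := D.X_neg i j
  have h2 := D.one_sub_X_ne hij
  have h3 : 1 - D.X (-i) (-j) ≠ 0 := D.one_sub_X_ne (by simpa using hij)
  rw [h, h, ← neg_div, div_eq_div_iff h3 h2]
  linear_combination (-2 : K) * h1

/-- This is the addition law of the hyperbolic cotangent. Together with oddness it gives all the
relations between different roots used in the braid computations. -/
theorem h_add (i j i' j' : ℤ) {m n : ℤ} (hm : i + i' = m) (hn : j + j' = n)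
    (h1 : i ≠ 0 ∨ j ≠ 0) (h2 : i' ≠ 0 ∨ j' ≠ 0) (h3 : m ≠ 0 ∨ n ≠ 0) :
    1 + D.h i j * D.h i' j' = D.h m n * (D.h i j + D.h i' j') := by
  subst hm hn
  have e1 := D.one_sub_X_ne h1
  have e2 := D.one_sub_X_ne h2
  have e3 := D.one_sub_X_ne h3
  rw [D.X_add] at e3
  simp only [h, D.X_add]
  field_simp
  ring

theorem s_h (i j : ℤ) : D.s (D.h i j) = D.h (-i + p * j) j := by
  simp [h, D.s_X]

theorem t_h (i j : ℤ) : D.t (D.h i j) = D.h i (-j + q * i) := by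
  simp [h, D.t_X]

/-- The leading coefficient of the Demazure–Lusztig operator with parameter `k`. -/
def a (k : K) (i j : ℤ) : K := (k + k⁻¹) / 2 - (k - k⁻¹) / 2 * D.h i j

theorem s_a {k : K} (hk : D.s k = k) (i j : ℤ) : D.s (D.a k i j) = D.a k (-i + p * j) j := by
  simp [a, D.s_h, hk, map_ofNat]

theorem t_a {k : K} (hk : D.t k = k) (i j : ℤ) : D.t (D.a k i j) = D.a k i (-j + q * i) := by
  simp [a, D.t_h, hk, map_ofNat]

variable [CharZero K]

/-- Used to eliminate the values of `a` at negative roots, so that only values at positive roots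
remain. -/
theorem a_mul_neg {k : K} (hk : k ≠ 0) {i j i' j' : ℤ} (hi : i' = -i) (hj : j' = -j)
    (hij : i ≠ 0 ∨ j ≠ 0) :
    D.a k i j * D.a k i' j' = 1 + ((k - k⁻¹) / 2) ^ 2 * (1 - D.h i j ^ 2) := by
  rw [a, a, D.h_neg hi hj hij]
  field_simp
  ring

theorem a_eq {k : K} (hk : k ≠ 0) {i j : ℤ} (hij : i ≠ 0 ∨ j ≠ 0) :
    D.a k i j = (1 - k ^ 2 * D.X i j) / (1 - D.X i j) / k := by
  have := D.one_sub_X_ne hij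
  rw [a, h]
  field_simp
  ring

theorem a_ne_zero {k : K} (hk : k ≠ 0) {i j : ℤ} (hij : i ≠ 0 ∨ j ≠ 0)
    (hX : k ^ 2 * D.X i j ≠ 1) : D.a k i j ≠ 0 := by
  rw [D.a_eq hk hij]
  exact div_ne_zero (div_ne_zero (sub_ne_zero.2 hX.symm) (D.one_sub_X_ne hij)) hk

/-- The constant term of the Demazure–Lusztig operator with parameter `k`. -/
def bCoeff (k : K) (i j : ℤ) : K := (k - k⁻¹) / 2 + (k - k⁻¹) / 2 * D.h i j

theorem s_bCoeff {k : K} (hk : D.s k = k) (i j : ℤ) :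
    D.s (D.bCoeff k i j) = D.bCoeff k (-i + p * j) j := by
  simp [bCoeff, D.s_h, hk, map_ofNat]

theorem t_bCoeff {k : K} (hk : D.t k = k) (i j : ℤ) :
    D.t (D.bCoeff k i j) = D.bCoeff k i (-j + q * i) := by
  simp [bCoeff, D.t_h, hk, map_ofNat]

theorem bCoeff_eq {k : K} (hk : k ≠ 0) (i j : ℤ) :
    D.bCoeff k i j = k - D.a k i j := by
  rw [bCoeff, a]
  field_simp
  ring

section Ring

variable {Z : Type*} [Ring Z] (ι : K →+* Z) {A B : Z}

/-- The Demazure–Lusztig operator attached to the first reflection. -/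
def T₁ (A : Z) : Z := ι (D.a D.k 1 0) * A + ι (D.bCoeff D.k 1 0)

/-- The Demazure–Lusztig operator attached to the second reflection. -/
def T₂ (B : Z) : Z := ι (D.a D.l 0 1) * B + ι (D.bCoeff D.l 0 1)

theorem T₁_quadratic (hA : ∀ f, A * ι f = ι (D.s f) * A) :
    D.T₁ ι A * D.T₁ ι A - ι (D.k - D.k⁻¹) * D.T₁ ι A - 1 =
      ι (D.a D.k 1 0 * D.a D.k (-1) 0) * (A * A - 1) := by
  have hA' : ∀ f z, A * (ι f * z) = ι (D.s f) * (A * z) := fun f z => by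
    rw [← mul_assoc, hA, mul_assoc]
  have e1 := D.a_mul_neg D.k_ne_zero (i := 1) (j := 0) (i' := -1) (j' := 0) rfl rfl (by simp)
  have e2 := D.h_neg (i := 1) (j := 0) (i' := -1) (j' := 0) rfl rfl (by simp)
  have e3 : D.T₁ ι A * D.T₁ ι A = ι (D.a D.k 1 0 * D.a D.k (-1) 0) * (A * A) +
      ι (D.a D.k 1 0 * (D.bCoeff D.k (-1) 0 + D.bCoeff D.k 1 0)) * A +
      ι (D.bCoeff D.k 1 0 * D.bCoeff D.k 1 0) := by
    simp only [T₁, mul_add, add_mul, map_add, map_mul, mul_assoc, hA', hA, D.s_a D.s_k,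
      D.s_bCoeff D.s_k]
    simp only [← mul_assoc, ← map_mul, mul_comm (D.bCoeff D.k 1 0)]
    norm_num
    abel
  have e4 : D.bCoeff D.k (-1) 0 + D.bCoeff D.k 1 0 = D.k - D.k⁻¹ := by
    rw [bCoeff, bCoeff, e2]; ring
  have e5 : D.bCoeff D.k 1 0 * D.bCoeff D.k 1 0 = (D.k - D.k⁻¹) * D.bCoeff D.k 1 0 + 1 -
      D.a D.k 1 0 * D.a D.k (-1) 0 := by
    rw [e1, bCoeff]; ring
  rw [e3, e4, e5, T₁, mul_comm (D.a D.k 1 0) (D.k - D.k⁻¹)]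
  simp only [map_mul, map_sub, map_add, map_one, mul_add, mul_sub, sub_mul, mul_assoc,
    mul_one]
  abel

/-- Adding the product of the inverses cancels the terms linear in `h` in the constant coefficient.
What is left is a multiple of 1 + h h', the left side of the addition law. -/
theorem central_sum_expansion (hA : ∀ f, A * ι f = ι (D.s f) * A)
    (hB : ∀ f, B * ι f = ι (D.t f) * B) :
    D.T₁ ι A * D.T₂ ι B + (D.T₂ ι B - ι (D.l - D.l⁻¹)) * (D.T₁ ι A - ι (D.k - D.k⁻¹)) =
      ι ((D.k - D.k⁻¹) / 2 * ((D.l - D.l⁻¹) / 2) * 2 * (1 + D.h 1 0 * D.h 0 1)) +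
      ι (D.a D.k 1 0 * ((D.l - D.l⁻¹) / 2) * (D.h p 1 + D.h 0 1)) * A +
      ι (D.a D.l 0 1 * ((D.k - D.k⁻¹) / 2) * (D.h 1 0 + D.h 1 q)) * B +
      ι (D.a D.k 1 0 * D.a D.l p 1) * (A * B) +
      ι (D.a D.l 0 1 * D.a D.k 1 q) * (B * A) := by
  have f1 : D.T₁ ι A - ι (D.k - D.k⁻¹) =
      ι (D.a D.k 1 0) * A + ι ((D.k - D.k⁻¹) / 2 * D.h 1 0 - (D.k - D.k⁻¹) / 2) := by
    rw [T₁, add_sub_assoc, ← map_sub, bCoeff]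
    congr 2; ring
  have f2 : D.T₂ ι B - ι (D.l - D.l⁻¹) =
      ι (D.a D.l 0 1) * B + ι ((D.l - D.l⁻¹) / 2 * D.h 0 1 - (D.l - D.l⁻¹) / 2) := by
    rw [T₂, add_sub_assoc, ← map_sub, bCoeff]
    congr 2; ring
  rw [f1, f2, T₁, T₂, wordExpansion_sum ι hA hB]
  have g1 : D.s (D.bCoeff D.l 0 1) = D.bCoeff D.l p 1 := by simp [D.s_bCoeff D.s_l]
  have g2 : D.s (D.a D.l 0 1) = D.a D.l p 1 := by simp [D.s_a D.s_l]
  have g3 : D.t (D.a D.k 1 0) = D.a D.k 1 q := by simp [D.t_a D.t_k]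
  have g4 : D.t ((D.k - D.k⁻¹) / 2 * D.h 1 0 - (D.k - D.k⁻¹) / 2) =
    (D.k - D.k⁻¹) / 2 * D.h 1 q - (D.k - D.k⁻¹) / 2 := by simp [D.t_h, D.t_k, map_ofNat]
  rw [g1, g2, g3, g4]
  congr 6 <;> simp only [bCoeff] <;> ring

theorem commutator_expansion (hA : ∀ f, A * ι f = ι (D.s f) * A)
    (hB : ∀ f, B * ι f = ι (D.t f) * B) :
    D.T₁ ι A * D.T₂ ι B - D.T₂ ι B * D.T₁ ι A =
      ι (D.a D.k 1 0 * ((D.l - D.l⁻¹) / 2) * (D.h p 1 - D.h 0 1)) * A +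
      ι (D.a D.l 0 1 * ((D.k - D.k⁻¹) / 2) * (D.h 1 0 - D.h 1 q)) * B +
      ι (D.a D.k 1 0 * D.a D.l p 1) * (A * B) +
      ι (-(D.a D.l 0 1 * D.a D.k 1 q)) * (B * A) := by
  rw [T₁, T₂, wordExpansion_commutator ι hA hB]
  have g1 : D.s (D.bCoeff D.l 0 1) = D.bCoeff D.l p 1 := by simp [D.s_bCoeff D.s_l]
  have g2 : D.s (D.a D.l 0 1) = D.a D.l p 1 := by simp [D.s_a D.s_l]
  have g3 : D.t (D.a D.k 1 0) = D.a D.k 1 q := by simp [D.t_a D.t_k]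
  have g4 : D.t (D.bCoeff D.k 1 0) = D.bCoeff D.k 1 q := by simp [D.t_bCoeff D.t_k]
  rw [g1, g2, g3, g4]
  congr 5 <;> simp only [bCoeff] <;> ring

end Ring
end RankTwoTorus
end Metaplectic


/-! ### Braid relations in rank two -/

namespace Metaplectic
/-- The Cartan integers `-p`, `-q` of a rank two base, and the order `m` of the product of the two
simple reflections. -/
def IsRankTwo (p q : ℤ) (m : ℕ) : Prop :=
  (p = 0 ∧ q = 0 ∧ m = 2) ∨ (p = 1 ∧ q = 1 ∧ m = 3) ∨ (p = 2 ∧ q = 1 ∧ m = 4) ∨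
    (p = 1 ∧ q = 2 ∧ m = 4) ∨ (p = 3 ∧ q = 1 ∧ m = 6) ∨ (p = 1 ∧ q = 3 ∧ m = 6)

theorem IsRankTwo.symm {p q : ℤ} {m : ℕ} (h : IsRankTwo p q m) : IsRankTwo q p m := by
  rw [IsRankTwo] at *
  tauto

/-- The order of the product of two reflections depends only on the product of the Cartan integers.
This is what survives the passage from Φ to Φ^m, where the two integers may be exchanged. -/
theorem IsRankTwo.of_mul_eq {p q p' q' : ℤ} {m : ℕ} (h : IsRankTwo p q m) (hp : 0 ≤ p')
    (hq : 0 ≤ q') (h0 : p' = 0 ↔ q' = 0) (hpq : p' * q' = p * q) : IsRankTwo p' q' m := by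
  have hbound : ∀ x y : ℤ, 0 ≤ x → 0 ≤ y → x * y ≤ 3 → (x = 0 ↔ y = 0) → x ≤ 3 := by
    intro x y hx hy hxy h0
    rcases hy.eq_or_lt with h | h
    · have := h0.2 h.symm; omega
    · nlinarith
  have hle : p * q ≤ 3 := by
    rcases h with h | h | h | h | h | h <;> obtain ⟨rfl, rfl, -⟩ := h <;> norm_num
  have h1 := hbound p' q' hp hq (hpq ▸ hle) h0
  have h2 := hbound q' p' hq hp (by rw [mul_comm]; exact hpq ▸ hle) h0.symm
  rw [IsRankTwo] at *
  rcases h with h | h | h | h | h | h <;> obtain ⟨rfl, rfl, rfl⟩ := h <;>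
    interval_cases p' <;> interval_cases q' <;> simp_all

namespace RankTwoTorus

variable {K : Type*} [Field K] {Z : Type*} [Ring Z] (ι : K →+* Z) {A B : Z}

theorem T₁_comm {p q : ℤ} (D : RankTwoTorus K p q) (hA : ∀ f, A * ι f = ι (D.s f) * A) {c : K}
    (hc : D.s c = c) : ι c * D.T₁ ι A = D.T₁ ι A * ι c := by
  rw [T₁, mul_add, add_mul, ← map_mul, ← map_mul, mul_assoc, hA, hc, ← mul_assoc, ← mul_assoc,
    ← map_mul, ← map_mul, mul_comm c, mul_comm c]

variable [CharZero K]

theorem T₁_quadratic' {p q : ℤ} (D : RankTwoTorus K p q) (hA : ∀ f, A * ι f = ι (D.s f) * A)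
    (hAA : A * A = 1) : D.T₁ ι A * D.T₁ ι A = ι (D.k - D.k⁻¹) * D.T₁ ι A + 1 := by
  have := D.T₁_quadratic ι hA
  rw [hAA, sub_self, mul_zero, sub_sub, sub_eq_zero] at this
  exact this

theorem T₂_quadratic {p q : ℤ} (D : RankTwoTorus K p q) (hB : ∀ f, B * ι f = ι (D.t f) * B)
    (hBB : B * B = 1) : D.T₂ ι B * D.T₂ ι B = ι (D.l - D.l⁻¹) * D.T₂ ι B + 1 :=
  D.swap.T₁_quadratic' ι hB hBB

theorem a_k_ne_zero {p q : ℤ} (D : RankTwoTorus K p q) {i j : ℤ} (hij : i ≠ 0 ∨ j ≠ 0) :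
    D.a D.k i j ≠ 0 := D.a_ne_zero D.k_ne_zero hij (D.k_X_ne_one _ _ hij)

theorem a_l_ne_zero {p q : ℤ} (D : RankTwoTorus K p q) {i j : ℤ} (hij : i ≠ 0 ∨ j ≠ 0) :
    D.a D.l i j ≠ 0 := D.a_ne_zero D.l_ne_zero hij (D.l_X_ne_one _ _ hij)

/-- Here and in the next cases C is the leading coefficient, the product of the factors `a` over the
positive roots of the rank two system. -/
theorem braid_two (D : RankTwoTorus K 0 0) (hA : ∀ f, A * ι f = ι (D.s f) * A)
    (hB : ∀ f, B * ι f = ι (D.t f) * B) :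
    ∃ C ≠ 0, altProd 2 (D.T₁ ι A) (D.T₂ ι B) - altProd 2 (D.T₂ ι B) (D.T₁ ι A) =
      ι C * (altProd 2 A B - altProd 2 B A) := by
  refine ⟨D.a D.k 1 0 * D.a D.l 0 1,
    mul_ne_zero (D.a_k_ne_zero (by simp)) (D.a_l_ne_zero (by simp)), ?_⟩
  simp only [altProd, mul_one]
  rw [D.commutator_expansion ι hA hB, mul_comm (D.a D.l 0 1) (D.a D.k 1 0), sub_self, sub_self, mul_zero,
    mul_zero, map_zero, zero_mul, zero_mul, zero_add, zero_add, map_neg, neg_mul, ← sub_eq_add_neg,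
    mul_sub]

/-- Equal parameters are needed here: one longest word collects `k` twice and `l` once, the other
`l` twice and `k` once. -/
theorem braid_three (D : RankTwoTorus K 1 1) (hkl : D.l = D.k)
    (hA : ∀ f, A * ι f = ι (D.s f) * A)
    (hB : ∀ f, B * ι f = ι (D.t f) * B) (hAA : A * A = 1) (hBB : B * B = 1) :
    ∃ C ≠ 0, altProd 3 (D.T₁ ι A) (D.T₂ ι B) - altProd 3 (D.T₂ ι B) (D.T₁ ι A) =
      ι C * (altProd 3 A B - altProd 3 B A) := by
  refine ⟨D.a D.k 1 0 * D.a D.k 1 1 * D.a D.k 0 1, mul_ne_zero (mul_ne_zero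
    (D.a_k_ne_zero (by simp)) (D.a_k_ne_zero (by simp))) (D.a_k_ne_zero (by simp)), ?_⟩
  simp only [altProd, mul_one, T₁, T₂, hkl]
  rw [wordExpansion_triple ι hA hB hAA, wordExpansion_triple ι hB hA hBB]
  simp only [D.s_a D.s_k, D.t_a D.t_k, D.s_bCoeff D.s_k, D.t_bCoeff D.t_k, mul_one, mul_zero,
    add_zero, Int.reduceAdd, Int.reduceNeg, neg_zero, zero_add]
  have r1 := D.h_add 1 0 0 1 (m := 1) (n := 1) rfl rfl (by simp) (by simp) (by simp)
  have n1 := D.h_neg (i := 1) (j := 0) (i' := -1) (j' := 0) rfl rfl (by simp)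
  have n2 := D.h_neg (i := 0) (j := 1) (i' := 0) (j' := -1) rfl rfl (by simp)
  have a1 := D.a_mul_neg D.k_ne_zero (i := 1) (j := 0) (i' := -1) (j' := 0) rfl rfl (by simp)
  have a2 := D.a_mul_neg D.k_ne_zero (i := 0) (j := 1) (i' := 0) (j' := -1) rfl rfl (by simp)
  simp only [bCoeff, n1, n2]
  generalize (D.k - D.k⁻¹) / 2 = c at *
  apply words_three <;> grind

theorem braid_four (D : RankTwoTorus K 2 1) (hA : ∀ f, A * ι f = ι (D.s f) * A)
    (hB : ∀ f, B * ι f = ι (D.t f) * B) (hAA : A * A = 1) (hBB : B * B = 1) :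
    ∃ C ≠ 0, altProd 4 (D.T₁ ι A) (D.T₂ ι B) - altProd 4 (D.T₂ ι B) (D.T₁ ι A) =
      ι C * (altProd 4 A B - altProd 4 B A) := by
  refine ⟨D.a D.k 1 0 * D.a D.l 2 1 * (D.a D.k 1 1 * D.a D.l 0 1),
    mul_ne_zero (mul_ne_zero (D.a_k_ne_zero (by simp)) (D.a_l_ne_zero (by simp)))
      (mul_ne_zero (D.a_k_ne_zero (by simp)) (D.a_l_ne_zero (by simp))), ?_⟩
  rw [altProd_four_sub (D.T₁_quadratic' ι hA hAA) (D.T₂_quadratic ι hB hBB)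
    (by rw [← map_mul, mul_comm, map_mul])
    (D.swap.T₁_comm ι hB (c := D.k - D.k⁻¹) (by simp [swap, D.t_k]))
    (D.T₁_comm ι hA (c := D.l - D.l⁻¹) (by simp [D.s_l])),
    D.central_sum_expansion ι hA hB, D.commutator_expansion ι hA hB,
    wordExpansion_mul_four ι hA hB hAA hBB]
  simp only [map_mul D.s, map_mul D.t, map_sub D.s, map_sub D.t,
    map_neg D.s, map_neg D.t, map_div₀, map_inv₀, map_ofNat,
    D.s_a D.s_k, D.t_a D.t_k, D.s_a D.s_l, D.t_a D.t_l, D.s_h, D.t_h, D.s_k, D.s_l, D.t_k, D.t_l,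
    altProd, mul_one, mul_zero, add_zero, Int.reduceAdd, Int.reduceNeg, Int.reduceMul, neg_zero,
    zero_add]
  have r1 := D.h_add 1 0 0 1 (m := 1) (n := 1) rfl rfl (by simp) (by simp) (by simp)
  have r2 := D.h_add 1 0 1 1 (m := 2) (n := 1) rfl rfl (by simp) (by simp) (by simp)
  have n1 := D.h_neg (i := 1) (j := 0) (i' := -1) (j' := 0) rfl rfl (by simp)
  have n2 := D.h_neg (i := 0) (j := 1) (i' := 0) (j' := -1) rfl rfl (by simp)
  have n3 := D.h_neg (i := 1) (j := 1) (i' := -1) (j' := -1) rfl rfl (by simp)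
  have n4 := D.h_neg (i := 2) (j := 1) (i' := -2) (j' := -1) rfl rfl (by simp)
  -- Each value of `a` at a negative root becomes a quotient by its value at the positive root.
  have a1 := eq_div_of_mul_eq (D.a_k_ne_zero (i := 1) (j := 0) (by simp))
    ((mul_comm _ _).trans (D.a_mul_neg D.k_ne_zero (i := 1) (j := 0) (i' := -1) (j' := -0) rfl rfl (by simp)))
  have z1 := D.a_k_ne_zero (i := 1) (j := 0) (by simp)
  have a2 := eq_div_of_mul_eq (D.a_l_ne_zero (i := 0) (j := 1) (by simp))
    ((mul_comm _ _).trans (D.a_mul_neg D.l_ne_zero (i := 0) (j := 1) (i' := -0) (j' := -1) rfl rfl (by simp)))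
  have z2 := D.a_l_ne_zero (i := 0) (j := 1) (by simp)
  have a3 := eq_div_of_mul_eq (D.a_k_ne_zero (i := 1) (j := 1) (by simp))
    ((mul_comm _ _).trans (D.a_mul_neg D.k_ne_zero (i := 1) (j := 1) (i' := -1) (j' := -1) rfl rfl (by simp)))
  have z3 := D.a_k_ne_zero (i := 1) (j := 1) (by simp)
  have a4 := eq_div_of_mul_eq (D.a_l_ne_zero (i := 2) (j := 1) (by simp))
    ((mul_comm _ _).trans (D.a_mul_neg D.l_ne_zero (i := 2) (j := 1) (i' := -2) (j' := -1) rfl rfl (by simp)))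
  have z4 := D.a_l_ne_zero (i := 2) (j := 1) (by simp)
  simp only [Int.reduceNeg, neg_zero] at a1 a2 a3 a4
  simp only [n1, n2, n3, n4, a1, a2, a3, a4]
  -- The values of `a` at positive roots may now be treated as independent nonzero symbols, and
  -- those of `h` as symbols subject only to the addition laws. Each coefficient is then a
  -- polynomial identity.
  clear n1 n2 n3 n4 a1 a2 a3 a4
  generalize (D.k - D.k⁻¹) / 2 = c at *
  generalize (D.l - D.l⁻¹) / 2 = d at *
  generalize D.a D.k 1 0 = x1 at *
  generalize D.a D.l 0 1 = x2 at *
  generalize D.a D.k 1 1 = x3 at *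
  generalize D.a D.l 2 1 = x4 at *
  generalize D.h 1 0 = y1 at *
  generalize D.h 0 1 = y2 at *
  generalize D.h 1 1 = y3 at *
  generalize D.h 2 1 = y4 at *
  clear hA hB hAA hBB
  apply words_four <;> field_simp <;> try grind

set_option maxHeartbeats 4000000 in
theorem braid_six (D : RankTwoTorus K 3 1) (hA : ∀ f, A * ι f = ι (D.s f) * A)
    (hB : ∀ f, B * ι f = ι (D.t f) * B) (hAA : A * A = 1) (hBB : B * B = 1) :
    ∃ C ≠ 0, altProd 6 (D.T₁ ι A) (D.T₂ ι B) - altProd 6 (D.T₂ ι B) (D.T₁ ι A) =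
      ι C * (altProd 6 A B - altProd 6 B A) := by
  refine ⟨D.a D.k 1 0 * D.a D.l 3 1 * (D.a D.k 2 1 * D.a D.l 3 2 * (D.a D.k 1 1 * D.a D.l 0 1)),
    mul_ne_zero (mul_ne_zero (D.a_k_ne_zero (by simp)) (D.a_l_ne_zero (by simp)))
      (mul_ne_zero (mul_ne_zero (D.a_k_ne_zero (by simp)) (D.a_l_ne_zero (by simp)))
      (mul_ne_zero (D.a_k_ne_zero (by simp)) (D.a_l_ne_zero (by simp)))), ?_⟩
  have h1 : ∀ (u : K) (w₁ w₂ w₃ w₄ : Z), ι u + w₁ + w₂ + w₃ + w₄ + 1 =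
    ι (u + 1) + w₁ + w₂ + w₃ + w₄ := fun u w₁ w₂ w₃ w₄ => by rw [map_add, map_one]; abel
  have h2 : ∀ (u : K) (w₁ w₂ w₃ w₄ : Z), ι u + w₁ + w₂ + w₃ + w₄ - 1 =
    ι (u - 1) + w₁ + w₂ + w₃ + w₄ := fun u w₁ w₂ w₃ w₄ => by rw [map_sub, map_one]; abel
  rw [altProd_six_sub (D.T₁_quadratic' ι hA hAA) (D.T₂_quadratic ι hB hBB)
    (by rw [← map_mul, mul_comm, map_mul])
    (D.swap.T₁_comm ι hB (c := D.k - D.k⁻¹) (by simp [swap, D.t_k]))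
    (D.T₁_comm ι hA (c := D.l - D.l⁻¹) (by simp [D.s_l])),
    D.central_sum_expansion ι hA hB, D.commutator_expansion ι hA hB, h1, h2,
    wordExpansion_mul_four ι hA hB hAA hBB, wordExpansion_mul_eight ι hA hB hAA hBB]
  simp only [map_mul D.s, map_mul D.t, map_add D.s, map_sub D.s, map_add D.t, map_sub D.t,
    map_neg D.s, map_neg D.t, map_div₀, map_inv₀, map_ofNat, map_one D.s, map_one D.t,
    D.s_a D.s_k, D.t_a D.t_k, D.s_a D.s_l, D.t_a D.t_l, D.s_h, D.t_h, D.s_k, D.s_l, D.t_k, D.t_l,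
    altProd, mul_one, mul_zero, add_zero, Int.reduceAdd, Int.reduceNeg, Int.reduceMul, neg_zero,
    zero_add]
  have r1 := D.h_add 1 0 0 1 (m := 1) (n := 1) rfl rfl (by simp) (by simp) (by simp)
  have r2 := D.h_add 1 0 1 1 (m := 2) (n := 1) rfl rfl (by simp) (by simp) (by simp)
  have r3 := D.h_add 1 0 2 1 (m := 3) (n := 1) rfl rfl (by simp) (by simp) (by simp)
  have r4 := D.h_add 1 1 2 1 (m := 3) (n := 2) rfl rfl (by simp) (by simp) (by simp)
  have r5 := D.h_add 0 1 3 1 (m := 3) (n := 2) rfl rfl (by simp) (by simp) (by simp)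
  have n1 := D.h_neg (i := 1) (j := 0) (i' := -1) (j' := 0) rfl rfl (by simp)
  have n2 := D.h_neg (i := 0) (j := 1) (i' := 0) (j' := -1) rfl rfl (by simp)
  have n3 := D.h_neg (i := 1) (j := 1) (i' := -1) (j' := -1) rfl rfl (by simp)
  have n4 := D.h_neg (i := 2) (j := 1) (i' := -2) (j' := -1) rfl rfl (by simp)
  have n5 := D.h_neg (i := 3) (j := 1) (i' := -3) (j' := -1) rfl rfl (by simp)
  have n6 := D.h_neg (i := 3) (j := 2) (i' := -3) (j' := -2) rfl rfl (by simp)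
  have a1 := eq_div_of_mul_eq (D.a_k_ne_zero (i := 1) (j := 0) (by simp))
    ((mul_comm _ _).trans (D.a_mul_neg D.k_ne_zero (i := 1) (j := 0) (i' := -1) (j' := -0) rfl rfl (by simp)))
  have z1 := D.a_k_ne_zero (i := 1) (j := 0) (by simp)
  have a2 := eq_div_of_mul_eq (D.a_l_ne_zero (i := 0) (j := 1) (by simp))
    ((mul_comm _ _).trans (D.a_mul_neg D.l_ne_zero (i := 0) (j := 1) (i' := -0) (j' := -1) rfl rfl (by simp)))
  have z2 := D.a_l_ne_zero (i := 0) (j := 1) (by simp)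
  have a3 := eq_div_of_mul_eq (D.a_k_ne_zero (i := 1) (j := 1) (by simp))
    ((mul_comm _ _).trans (D.a_mul_neg D.k_ne_zero (i := 1) (j := 1) (i' := -1) (j' := -1) rfl rfl (by simp)))
  have z3 := D.a_k_ne_zero (i := 1) (j := 1) (by simp)
  have a4 := eq_div_of_mul_eq (D.a_k_ne_zero (i := 2) (j := 1) (by simp))
    ((mul_comm _ _).trans (D.a_mul_neg D.k_ne_zero (i := 2) (j := 1) (i' := -2) (j' := -1) rfl rfl (by simp)))
  have z4 := D.a_k_ne_zero (i := 2) (j := 1) (by simp)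
  have a5 := eq_div_of_mul_eq (D.a_l_ne_zero (i := 3) (j := 1) (by simp))
    ((mul_comm _ _).trans (D.a_mul_neg D.l_ne_zero (i := 3) (j := 1) (i' := -3) (j' := -1) rfl rfl (by simp)))
  have z5 := D.a_l_ne_zero (i := 3) (j := 1) (by simp)
  have a6 := eq_div_of_mul_eq (D.a_l_ne_zero (i := 3) (j := 2) (by simp))
    ((mul_comm _ _).trans (D.a_mul_neg D.l_ne_zero (i := 3) (j := 2) (i' := -3) (j' := -2) rfl rfl (by simp)))
  have z6 := D.a_l_ne_zero (i := 3) (j := 2) (by simp)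
  simp only [Int.reduceNeg, neg_zero] at a1 a2 a3 a4 a5 a6
  simp only [n1, n2, n3, n4, n5, n6, a1, a2, a3, a4, a5, a6]
  clear n1 n2 n3 n4 n5 n6 a1 a2 a3 a4 a5 a6
  generalize (D.k - D.k⁻¹) / 2 = c at *
  generalize (D.l - D.l⁻¹) / 2 = d at *
  generalize D.a D.k 1 0 = x1 at *
  generalize D.a D.l 0 1 = x2 at *
  generalize D.a D.k 1 1 = x3 at *
  generalize D.a D.k 2 1 = x4 at *
  generalize D.a D.l 3 1 = x5 at *
  generalize D.a D.l 3 2 = x6 at *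
  generalize D.h 1 0 = y1 at *
  generalize D.h 0 1 = y2 at *
  generalize D.h 1 1 = y3 at *
  generalize D.h 2 1 = y4 at *
  generalize D.h 3 1 = y5 at *
  generalize D.h 3 2 = y6 at *
  clear hA hB hAA hBB
  apply words_six <;> field_simp <;> try grind

/-- The transposed types follow by exchanging the two reflections, which negates both defects and
keeps C. -/
theorem exists_braid_coefficient {p q : ℤ} {m : ℕ} (h : IsRankTwo p q m) (D : RankTwoTorus K p q)
    (hkl : p = 1 → q = 1 → D.l = D.k) (hA : ∀ f, A * ι f = ι (D.s f) * A)
    (hB : ∀ f, B * ι f = ι (D.t f) * B) (hAA : A * A = 1) (hBB : B * B = 1) :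
    ∃ C ≠ 0, altProd m (D.T₁ ι A) (D.T₂ ι B) - altProd m (D.T₂ ι B) (D.T₁ ι A) =
      ι C * (altProd m A B - altProd m B A) := by
  have aux : ∀ {x y x' y' : Z}, (∃ C : K, C ≠ 0 ∧ x - y = ι C * (x' - y')) →
      ∃ C : K, C ≠ 0 ∧ y - x = ι C * (y' - x') := by
    rintro x y x' y' ⟨C, hC, h⟩
    exact ⟨C, hC, by rw [← neg_sub, h, ← mul_neg, neg_sub]⟩
  rcases h with h | h | h | h | h | h <;> obtain ⟨rfl, rfl, rfl⟩ := h
  · exact D.braid_two ι hA hB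
  · exact D.braid_three ι (hkl rfl rfl) hA hB hAA hBB
  · exact D.braid_four ι hA hB hAA hBB
  · exact aux (D.swap.braid_four ι hB hA hBB hAA)
  · exact D.braid_six ι hA hB hAA hBB
  · exact aux (D.swap.braid_six ι hB hA hBB hAA)

end RankTwoTorus
end Metaplectic


/-! ### Pairs of simple reflections and their positive roots -/

namespace Metaplectic

variable {ι E N : Type*} [NormedAddCommGroup E] [InnerProductSpace ℝ E]
  [AddCommGroup N] [Module ℝ N]

section Reflections

variable {R : RootPairing ι ℝ E N}

theorem refl_smul (i : ι) (v : E) : refl R i • v = v - R.coroot' i v • R.root i :=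
  R.reflection_apply i v

theorem refl_mul_self (i : ι) : refl R i * refl R i = 1 :=
  Subtype.ext (by
    have := RootPairing.Equiv.reflection_inv R i
    change RootPairing.Equiv.reflection R i * RootPairing.Equiv.reflection R i = 1
    nth_rw 1 [← this]
    exact inv_mul_cancel _)

theorem refl_inv (i : ι) : (refl R i)⁻¹ = refl R i :=
  inv_eq_of_mul_eq_one_left (refl_mul_self i)

theorem refl_refl_smul {X : Type*} [MulAction R.weylGroup X] (i : ι) (x : X) :
    refl R i • refl R i • x = x := by
  rw [← mul_smul, refl_mul_self, one_smul]

theorem root_smul (w : R.weylGroup) (i : ι) : R.root (w • i) = w • R.root i :=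
  (RootPairing.weylGroup_apply_root R w i).symm

theorem weyl_smul_real (w : R.weylGroup) (c : ℝ) (v : E) : w • (c • v) = c • (w • v) :=
  map_smul (RootPairing.Equiv.weightHom R w).toLinearMap c v

theorem weyl_ext {w w' : R.weylGroup} (h : ∀ v : E, w • v = w' • v) : w = w' := by
  apply Subtype.ext
  apply RootPairing.Equiv.weightHom_injective R
  exact LinearEquiv.ext h

/-- Conjugation of a reflection by a reflection. -/
theorem refl_refl_smul_index (i j : ι) :
    refl R (refl R j • i) = refl R j * refl R i * refl R j := by
  apply weyl_ext
  intro v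
  change R.reflection (R.reflectionPerm j i) v = R.reflection j (R.reflection i (R.reflection j v))
  rw [R.reflection_reflectionPerm]
  rfl

theorem coroot'_smul (w : R.weylGroup) (i : ι) (v : E) :
    R.coroot' (w • i) (w • v) = R.coroot' i v := by
  obtain ⟨w, hw⟩ := w
  induction hw using RootPairing.weylGroup.induction generalizing i v with
  | one =>
    change R.coroot' ((1 : R.weylGroup) • i) ((1 : R.weylGroup) • v) = _
    simp
  | mem j =>
    have := R.coroot'_reflection (i := j) (j := R.reflectionPerm j i) v
    change R.coroot' (R.reflectionPerm j i) (R.reflection j v) = _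
    rw [this, R.reflectionPerm_self]
  | mul x y hx hy hx' hy' =>
    change R.coroot' (((⟨x, hx⟩ : R.weylGroup) * ⟨y, hy⟩) • i)
      (((⟨x, hx⟩ : R.weylGroup) * ⟨y, hy⟩) • v) = _
    rw [mul_smul, mul_smul, hx', hy']

variable {i j : ι} {p q : ℤ}

/-- The group generated by the two reflections preserves the plane v + ⟨α_i, α_j⟩. In these
coordinates its relations become identities in the pairings of v, checked by direct computation. -/
theorem refl_smul_add (hp : R.coroot' i (R.root j) = -p) (v : E) (x y : ℝ) :
    refl R i • (v + (x • R.root i + y • R.root j)) =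
      v + ((-R.coroot' i v - x + p * y) • R.root i + y • R.root j) := by
  have h2 : R.coroot' i (R.root i) = 2 := R.root_coroot_two i
  rw [refl_smul, map_add, map_add, map_smul, map_smul, hp, h2]
  simp only [smul_eq_mul]
  module

theorem refl_smul_add' (hq : R.coroot' j (R.root i) = -q) (v : E) (x y : ℝ) :
    refl R j • (v + (x • R.root i + y • R.root j)) =
      v + (x • R.root i + (-R.coroot' j v - y + q * x) • R.root j) := by
  rw [add_comm (x • _), refl_smul_add hq, add_comm (_ • R.root j)]

theorem altProd_refl {m : ℕ} (h : IsRankTwo p q m) (hp : R.coroot' i (R.root j) = -p)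
    (hq : R.coroot' j (R.root i) = -q) :
    altProd m (refl R i) (refl R j) = altProd m (refl R j) (refl R i) := by
  apply weyl_ext
  intro v
  have hv : v = v + ((0 : ℝ) • R.root i + (0 : ℝ) • R.root j) := by simp
  rw [hv]
  rcases h with h | h | h | h | h | h <;> obtain ⟨rfl, rfl, rfl⟩ := h <;>
  · simp only [altProd, mul_one, mul_smul, refl_smul_add hp, refl_smul_add' hq]
    congr 3 <;> push_cast <;> ring

theorem refl_mul_refl_pow {m : ℕ} (h : IsRankTwo p q m) (hp : R.coroot' i (R.root j) = -p)
    (hq : R.coroot' j (R.root i) = -q) : (refl R i * refl R j) ^ m = 1 := by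
  apply weyl_ext
  intro v
  have hv : v = v + ((0 : ℝ) • R.root i + (0 : ℝ) • R.root j) := by simp
  rw [one_smul]
  conv_lhs => rw [hv]
  conv_rhs => rw [hv]
  rcases h with h | h | h | h | h | h <;> obtain ⟨rfl, rfl, rfl⟩ := h <;>
  · simp only [pow_succ, pow_zero, one_mul, mul_smul, refl_smul_add hp, refl_smul_add' hq]
    congr 3 <;> push_cast <;> ring

theorem orderOf_refl_mul {m : ℕ} (h : IsRankTwo p q m) (hp : R.coroot' i (R.root j) = -p)
    (hq : R.coroot' j (R.root i) = -q) (hli : LinearIndependent ℝ ![R.root i, R.root j]) :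
    orderOf (refl R i * refl R j) = m := by
  have h2 : R.coroot' i (R.root i) = 2 := R.root_coroot_two i
  have h2' : R.coroot' j (R.root j) = 2 := R.root_coroot_two j
  have hj : R.root j = (0 : E) + ((0 : ℝ) • R.root i + (1 : ℝ) • R.root j) := by simp
  -- A power is shown to be nontrivial by following the single vector α_j. Only the exponents m / r
  -- with r prime matter, and r is 2 or 3.
  have key : ∀ k : ℕ, (∃ x y : ℝ, (x ≠ 0 ∨ y ≠ 1) ∧ (refl R i * refl R j) ^ k •
      ((0 : E) + ((0 : ℝ) • R.root i + (1 : ℝ) • R.root j)) = (0 : E) + (x • R.root i + y • R.root j)) → (refl R i * refl R j) ^ k ≠ 1 := by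
    rintro k ⟨x, y, hxy, e⟩ h1
    rw [h1, one_smul, ← hj] at e
    have := LinearIndependent.pair_iff.1 hli x (y - 1) (by rw [sub_smul, one_smul]; nth_rw 2 [e]; module)
    rcases hxy with hxy | hxy
    · exact hxy this.1
    · exact hxy (sub_eq_zero.1 this.2)
  refine orderOf_eq_of_pow_and_pow_div_prime ?_ (refl_mul_refl_pow h hp hq) ?_
  · rcases h with h | h | h | h | h | h <;> simp [h]
  intro r hr hrm
  apply key
  have hr' : r = 2 ∨ r = 3 := by
    have : r ≤ 6 := (Nat.le_of_dvd (by rcases h with h | h | h | h | h | h <;> simp [h]) hrm).trans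
      (by rcases h with h | h | h | h | h | h <;> simp [h])
    interval_cases r <;> first | (exfalso; revert hr; norm_num; done) | skip
    · simp
    · simp
    · rcases h with h | h | h | h | h | h <;> obtain ⟨rfl, rfl, rfl⟩ := h <;> omega
  rcases hr' with rfl | rfl <;> rcases h with h | h | h | h | h | h <;>
    obtain ⟨rfl, rfl, rfl⟩ := h <;> first | (exfalso; omega) | skip
  all_goals
    norm_num only [pow_succ, pow_zero, one_mul, mul_smul, refl_smul_add hp, refl_smul_add' hq, map_zero]
    refine ⟨_, _, ?_, rfl⟩
    norm_num

end Reflections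

section AltRoot

variable {R : RootPairing ι ℝ E N}

/-- The roots `α_i`, `s_i α_j`, `s_i s_j α_i`, … -/
def altRoot (R : RootPairing ι ℝ E N) : ℕ → ι → ι → ι
  | 0, i, _ => i
  | k + 1, i, j => refl R i • altRoot R k j i

/-- The coefficients of the roots `α_i`, `s_i α_j`, `s_i s_j α_i`, … -/
def altCoeff : ℕ → ℤ → ℤ → ℤ × ℤ
  | 0, _, _ => (1, 0)
  | k + 1, p, q => (-(altCoeff k q p).2 + p * (altCoeff k q p).1, (altCoeff k q p).1)

theorem root_altRoot {i j : ι} {p q : ℤ} (hp : R.coroot' i (R.root j) = -p)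
    (hq : R.coroot' j (R.root i) = -q) (k : ℕ) :
    R.root (altRoot R k i j) = (altCoeff k p q).1 • R.root i + (altCoeff k p q).2 • R.root j := by
  induction k generalizing i j p q with
  | zero => simp [altRoot, altCoeff]
  | succ k ih =>
    have := refl_smul_add hp 0 (altCoeff k q p).2 (altCoeff k q p).1
    rw [zero_add, zero_add, map_zero, neg_zero, zero_sub] at this
    rw [altRoot, root_smul, ih hq hp, altCoeff, add_comm]
    simp only [← Int.cast_smul_eq_zsmul ℝ]
    rw [this]
    push_cast
    rfl

theorem altCoeff_nonneg {p q : ℤ} {m : ℕ} (h : IsRankTwo p q m) {k : ℕ} (hk : k < m) :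
    0 ≤ (altCoeff k p q).1 ∧ 0 ≤ (altCoeff k p q).2 := by
  rcases h with h | h | h | h | h | h <;> obtain ⟨rfl, rfl, rfl⟩ := h <;> revert k <;> decide

theorem altCoeff_symm {p q : ℤ} {m : ℕ} (h : IsRankTwo p q m) {k : ℕ} (hk : k < m) :
    altCoeff (m - 1 - k) q p = ((altCoeff k p q).2, (altCoeff k p q).1) := by
  rcases h with h | h | h | h | h | h <;> obtain ⟨rfl, rfl, rfl⟩ := h <;> revert k <;> decide

/-- The chain of positive roots from α_i to α_j, read backwards, is the chain that starts at α_j. -/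
theorem altRoot_symm {i j : ι} {p q : ℤ} {m : ℕ} (h : IsRankTwo p q m)
    (hp : R.coroot' i (R.root j) = -p) (hq : R.coroot' j (R.root i) = -q) {k : ℕ} (hk : k < m) :
    altRoot R (m - 1 - k) j i = altRoot R k i j := by
  apply R.root.injective
  rw [root_altRoot hp hq, root_altRoot hq hp, altCoeff_symm h hk, add_comm]

end AltRoot

section Base

variable {R : RootPairing ι ℝ E N} (b : R.Base)

theorem height_eq_of_root_eq {i j k : ι} {x y : ℤ}
    (hk : R.root k = x • R.root i + y • R.root j) :
    b.height k = x * b.height i + y * b.height j := by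
  obtain ⟨f, -, -, hf⟩ := b.exists_root_eq_sum_int i
  obtain ⟨g, -, -, hg⟩ := b.exists_root_eq_sum_int j
  have hfg : R.root k = ∑ l ∈ b.support, (x • f + y • g) l • R.root l := by
    simp_rw [Pi.add_apply, Pi.smul_apply, add_smul, smul_assoc, Finset.sum_add_distrib,
      ← Finset.smul_sum, ← hf, ← hg, hk]
  simp_rw [RootPairing.Base.height_eq_sum hf, RootPairing.Base.height_eq_sum hg,
    RootPairing.Base.height_eq_sum hfg, Pi.add_apply, Pi.smul_apply,
    Finset.sum_add_distrib, smul_eq_mul, Finset.mul_sum]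

theorem height_refl_self (i : ι) : b.height (refl R i • i) = -b.height i := by
  have := height_eq_of_root_eq b (k := refl R i • i) (i := i) (j := i) (x := -1) (y := 0)
    (by rw [root_smul, refl_smul]; rw [show R.coroot' i (R.root i) = 2 from R.root_coroot_two i]
        module)
  simpa using this

/-- Height is additive and the chain consists of nonnegative combinations of α_i and α_j, so its
image under w has height at most zero as soon as those of α_i and α_j do. -/
theorem smul_altRoot_not_isPos {i j : ι} {p q : ℤ} {m : ℕ} (h : IsRankTwo p q m)
    (hp : R.coroot' i (R.root j) = -p) (hq : R.coroot' j (R.root i) = -q) {k : ℕ} (hk : k < m)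
    {w : R.weylGroup} (hi : ¬ b.IsPos (w • i)) (hj : ¬ b.IsPos (w • j)) :
    ¬ b.IsPos (w • altRoot R k i j) := by
  rw [RootPairing.Base.isPos_iff, not_lt] at *
  rw [height_eq_of_root_eq b (i := w • i) (j := w • j) (x := (altCoeff k p q).1)
    (y := (altCoeff k p q).2)
    (by rw [root_smul, root_altRoot hp hq, smul_add, root_smul, root_smul,
      ← Int.cast_smul_eq_zsmul ℝ, ← Int.cast_smul_eq_zsmul ℝ, ← Int.cast_smul_eq_zsmul ℝ,
      ← Int.cast_smul_eq_zsmul ℝ, weyl_smul_real, weyl_smul_real])]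
  have := altCoeff_nonneg h hk
  nlinarith

variable [Finite ι] [R.IsCrystallographic]

theorem exists_isRankTwo {i j : ι} (hi : i ∈ b.support) (hj : j ∈ b.support) (hij : i ≠ j) :
    ∃ (p q : ℤ), IsRankTwo p q (orderOf (refl R i * refl R j)) ∧
      R.coroot' i (R.root j) = -p ∧ R.coroot' j (R.root i) = -q := by
  have hli : LinearIndependent ℝ ![R.root i, R.root j] :=
    b.linearIndependent_pair_of_ne (i := ⟨i, hi⟩) (j := ⟨j, hj⟩) (by simpa using hij)
  have h1 := b.pairingIn_le_zero_of_ne hij hi hj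
  have h2 := b.pairingIn_le_zero_of_ne hij.symm hj hi
  have h4 := (R.linearIndependent_iff_coxeterWeightIn_ne_four ℤ).1 hli
  have h5 := R.coxeterWeightIn_mem_set_of_isCrystallographic i j
  have h0 : R.pairingIn ℤ i j = 0 ↔ R.pairingIn ℤ j i = 0 := by
    rw [RootPairing.pairingIn_eq_zero_iff]
  have hq : R.coroot' j (R.root i) = -((-R.pairingIn ℤ i j : ℤ) : ℝ) := by
    have := R.algebraMap_pairingIn ℤ i j
    rw [Int.cast_neg, neg_neg]
    exact this.symm
  have hp : R.coroot' i (R.root j) = -((-R.pairingIn ℤ j i : ℤ) : ℝ) := by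
    have := R.algebraMap_pairingIn ℤ j i
    rw [Int.cast_neg, neg_neg]
    exact this.symm
  have hm : ∃ m, IsRankTwo (-R.pairingIn ℤ j i) (-R.pairingIn ℤ i j) m := by
    rw [RootPairing.coxeterWeightIn] at h4 h5
    generalize R.pairingIn ℤ i j = x at *
    generalize R.pairingIn ℤ j i = y at *
    have base : ∃ p q m, IsRankTwo p q m ∧ p * q = x * y := by
      simp only [Set.mem_insert_iff, Set.mem_singleton_iff] at h5
      rcases h5 with h | h | h | h | h
      · exact ⟨0, 0, 2, by simp [IsRankTwo], by simp [h]⟩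
      · exact ⟨1, 1, 3, by simp [IsRankTwo], by simp [h]⟩
      · exact ⟨2, 1, 4, by simp [IsRankTwo], by simp [h]⟩
      · exact ⟨3, 1, 6, by simp [IsRankTwo], by simp [h]⟩
      · exact absurd h h4
    obtain ⟨p, q, m, h, e⟩ := base
    exact ⟨m, h.of_mul_eq (by omega) (by omega) (by omega) (by rw [e]; ring)⟩
  obtain ⟨m, hm⟩ := hm
  refine ⟨_, _, ?_, hp, hq⟩
  rwa [orderOf_refl_mul hm hp hq hli]

end Base
end Metaplectic


/-! ### Matsumoto's theorem and homomorphisms from the Weyl group -/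

namespace Metaplectic

variable {ι E N : Type*} [NormedAddCommGroup E] [InnerProductSpace ℝ E]
  [AddCommGroup N] [Module ℝ N] {R : RootPairing ι ℝ E N} (b : R.Base)

section Generation

variable [R.IsCrystallographic]

/-- The Weyl group is generated by the simple reflections. -/
theorem weylGroup_induction_simple [Finite ι] [R.IsReduced] {p : R.weylGroup → Prop} (one : p 1)
    (mul : ∀ i ∈ b.support, ∀ w, p w → p (refl R i * w)) (w : R.weylGroup) : p w := by
  -- Every root is reached from simple ones by negation and simple reflections, and conjugation
  -- writes its reflection as a word in simple reflections.
  have key : ∀ i : ι, ∀ w, p w → p (refl R i * w) := by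
    intro i
    refine b.induction_reflect i (p := fun i => ∀ w, p w → p (refl R i * w)) ?_ mul ?_
    · intro i hi
      have : refl R (R.reflectionPerm i i) = refl R i := by
        have := refl_refl_smul_index (R := R) i i
        rwa [refl_mul_self, one_mul] at this
      rwa [this]
    · intro i j hi hj w hw
      have : refl R (R.reflectionPerm j i) = refl R j * refl R i * refl R j :=
        refl_refl_smul_index i j
      rw [this, mul_assoc, mul_assoc]
      exact mul j hj _ (hi _ (mul j hj _ hw))
  have key' : ∀ w w' : R.weylGroup, p w' → p (w * w') := by
    intro w
    obtain ⟨w, hw⟩ := w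
    induction hw using RootPairing.weylGroup.induction with
    | one => intro w' h; exact (one_mul w').symm ▸ h
    | mem i => exact key i
    | mul x y hx hy hx' hy' =>
      intro w' h
      have := hx' _ (hy' _ h)
      rwa [← mul_assoc] at this
  simpa using key' w 1 one

end Generation

section Lift

/-- The number of positive roots made negative by `w⁻¹`. -/
def inversions (w : R.weylGroup) : ℕ := {j | b.IsPos j ∧ ¬ b.IsPos (w⁻¹ • j)}.ncard

theorem isPos_inv_refl_mul {i : ι} (w : R.weylGroup) :
    b.IsPos ((refl R i * w)⁻¹ • i) ↔ ¬ b.IsPos (w⁻¹ • i) := by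
  have h : b.height ((refl R i * w)⁻¹ • i) = -b.height (w⁻¹ • i) := by
    rw [mul_inv_rev, refl_inv, mul_smul]
    have e : R.root (w⁻¹ • refl R i • i) = (-1 : ℤ) • R.root (w⁻¹ • i) +
        (0 : ℤ) • R.root (w⁻¹ • i) := by
      rw [root_smul, root_smul, root_smul, refl_smul,
        show R.coroot' i (R.root i) = 2 from R.root_coroot_two i, two_smul]
      simp
    rw [height_eq_of_root_eq b e]
    ring
  rw [RootPairing.Base.isPos_iff, h, RootPairing.Base.isPos_iff]
  have := b.height_ne_zero (w⁻¹ • i)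
  omega

variable [Finite ι] [R.IsCrystallographic] [R.IsReduced]

/-- The reflection s_i permutes the positive roots other than α_i. It carries the inversions of w
injectively to inversions of s_i w, which has α_i as one more. -/
theorem inversions_lt {i : ι} (hi : i ∈ b.support) {w : R.weylGroup} (h : b.IsPos (w⁻¹ • i)) :
    inversions b w < inversions b (refl R i * w) := by
  have hpi : b.IsPos i := RootPairing.Base.isPos_of_mem_support hi
  have himg : (refl R i • · : ι → ι) '' {j | b.IsPos j ∧ ¬ b.IsPos (w⁻¹ • j)} ⊂
      {j | b.IsPos j ∧ ¬ b.IsPos ((refl R i * w)⁻¹ • j)} := by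
    refine (Set.ssubset_iff_of_subset ?_).2 ⟨i, ⟨hpi, ?_⟩, ?_⟩
    · rintro _ ⟨j, ⟨hj, hj'⟩, rfl⟩
      have hji : j ≠ i := fun e => hj' (e ▸ h)
      refine ⟨hj.reflectionPerm hi hji, ?_⟩
      rwa [mul_inv_rev, refl_inv, mul_smul, refl_refl_smul]
    · rw [isPos_inv_refl_mul]
      simpa using h
    · rintro ⟨j, ⟨hj, -⟩, e⟩
      have e' : refl R i • j = i := e
      have e2 : j = refl R i • i := 
        (refl_refl_smul (R := R) i j).symm.trans (congrArg (refl R i • ·) e')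
      have := height_refl_self b i
      rw [← e2] at this
      rw [RootPairing.Base.isPos_iff] at hj hpi
      omega
  rw [inversions, inversions, ← Set.ncard_image_of_injective _ (MulAction.injective (refl R i))]
  exact Set.ncard_lt_ncard himg

variable {M : Type*} [Monoid M] (A : b.support → M)

/-- `LiftRel w x` if `x` is the value on `w` of a reduced word in the elements `A_i`. -/
inductive LiftRel : R.weylGroup → M → Prop
  | one : LiftRel 1 1
  | mul (i : b.support) (w : R.weylGroup) (x : M) (h : LiftRel w x) (hi : b.IsPos (w⁻¹ • (i : ι))) :
      LiftRel (refl R (i : ι) * w) (A i * x)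

variable {A}

-- The chain `altRoot` lists the inversions of the alternating word. If v⁻¹ is not positive on its
-- first k members, putting back the k letters one at a time lengthens the word at every step.
omit [Finite ι] [R.IsCrystallographic] [R.IsReduced] in
theorem LiftRel.climb (k : ℕ) {i j : b.support} {v : R.weylGroup} {y : M}
    (h : LiftRel b A ((altProd k (refl R (i : ι)) (refl R (j : ι)))⁻¹ * v) y)
    (hv : ∀ l < k, ¬ b.IsPos (v⁻¹ • altRoot R l (i : ι) (j : ι))) :
    LiftRel b A v (altProd k (A i) (A j) * y) := by
  induction k generalizing i j v with
  | zero => simpa [altProd] using h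
  | succ k ih =>
    have h1 : LiftRel b A (refl R (i : ι) * v) (altProd k (A j) (A i) * y) := by
      apply ih
      · rwa [altProd, mul_inv_rev, refl_inv, mul_assoc] at h
      · intro l hl
        have := hv (l + 1) (by omega)
        rwa [altRoot, ← mul_smul, ← refl_inv (i : ι), ← mul_inv_rev] at this
    have h2 := LiftRel.mul i _ _ h1 ((isPos_inv_refl_mul b v).2 (hv 0 (by omega)))
    rwa [← mul_assoc, refl_mul_self, one_mul, ← mul_assoc] at h2

/-- The converse of `LiftRel.climb`: letters are removed from the left. The exchange property for
elements with fewer inversions enters as the hypothesis `IH`, which lets `LiftRel.exchange` call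
this lemma inside its own induction. -/
theorem LiftRel.peel {n : ℕ}
    (IH : ∀ (w : R.weylGroup) (x : M) (i : b.support), inversions b w < n → LiftRel b A w x →
      ¬ b.IsPos (w⁻¹ • (i : ι)) → ∃ y, LiftRel b A (refl R (i : ι) * w) y ∧ x = A i * y)
    (k : ℕ) {i j : b.support} {w : R.weylGroup} {x : M} (hw : inversions b w < n)
    (h : LiftRel b A w x) (hneg : ∀ l < k, ¬ b.IsPos (w⁻¹ • altRoot R l (i : ι) (j : ι))) :
    ∃ y, LiftRel b A ((altProd k (refl R (i : ι)) (refl R (j : ι)))⁻¹ * w) y ∧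
      x = altProd k (A i) (A j) * y := by
  induction k generalizing i j w x with
  | zero => exact ⟨x, by simpa [altProd] using h, by simp [altProd]⟩
  | succ k ih =>
    have h0 : ¬ b.IsPos (w⁻¹ • (i : ι)) := hneg 0 (by omega)
    obtain ⟨y, hy, rfl⟩ := IH w x i hw h h0
    have hlt : inversions b (refl R (i : ι) * w) < n := by
      refine lt_trans ?_ hw
      have := inversions_lt b i.2 ((isPos_inv_refl_mul b w).2 h0)
      rwa [← mul_assoc, refl_mul_self, one_mul] at this
    obtain ⟨z, hz, rfl⟩ := ih (i := j) (j := i) hlt hy (by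
      intro l hl
      have := hneg (l + 1) (by omega)
      rwa [altRoot, ← mul_smul, ← refl_inv (i : ι), ← mul_inv_rev] at this)
    refine ⟨z, ?_, ?_⟩
    · rwa [altProd, mul_inv_rev, refl_inv, mul_assoc]
    · rw [altProd, mul_assoc]

/-- The elements `A_i` satisfy the braid relations of the Weyl group. -/
def BraidRel (A : b.support → M) : Prop :=
  ∀ i j : b.support, i ≠ j →
    altProd (orderOf (refl R (i : ι) * refl R (j : ι))) (A i) (A j) =
      altProd (orderOf (refl R (i : ι) * refl R (j : ι))) (A j) (A i)

/-- If the reduced word starts with j ≠ i, then w⁻¹ is negative on both α_i and α_j, hence on all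
positive roots of their subsystem. So w begins with the longest element of ⟨s_i, s_j⟩, and the braid
relation rewrites that beginning so that it starts with i. -/
theorem LiftRel.exchange (hbr : BraidRel b A) {w : R.weylGroup} {x : M} {i : b.support}
    (h : LiftRel b A w x) (hi : ¬ b.IsPos (w⁻¹ • (i : ι))) :
    ∃ y, LiftRel b A (refl R (i : ι) * w) y ∧ x = A i * y := by
  induction hn : inversions b w using Nat.strong_induction_on generalizing w x i with
  | _ n ih =>
  cases h with
  | one => exact absurd (RootPairing.Base.isPos_of_mem_support i.2) (by simpa using hi)
  | mul j w' x' h' hj' =>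
    by_cases hij : i = j
    · subst hij
      exact ⟨x', by rwa [← mul_assoc, refl_mul_self, one_mul], rfl⟩
    have hij' : (i : ι) ≠ j := fun e => hij (Subtype.ext e)
    obtain ⟨p, q, hm, hp, hq⟩ := exists_isRankTwo b i.2 j.2 hij'
    have hbr' := hbr i j hij
    have hbr2 : altProd (orderOf (refl R (i : ι) * refl R (j : ι))) (refl R (i : ι)) (refl R (j : ι))
      = altProd (orderOf (refl R (i : ι) * refl R (j : ι))) (refl R (j : ι)) (refl R (i : ι)) :=
      altProd_refl hm hp hq
    generalize orderOf (refl R (i : ι) * refl R (j : ι)) = m at *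
    -- From here the longest word has m + 1 letters; its first letter j has already been split off.
    obtain ⟨m, rfl⟩ : ∃ k, m = k + 1 := by
      refine Nat.exists_eq_succ_of_ne_zero ?_
      rcases hm with h | h | h | h | h | h <;> simp [h]
    have hj : ¬ b.IsPos ((refl R (j : ι) * w')⁻¹ • (j : ι)) := by
      rw [isPos_inv_refl_mul]; simpa using hj'
    have hlt := inversions_lt b j.2 hj'
    obtain ⟨y, hy, rfl⟩ := LiftRel.peel b (n := n) (fun w x i hw hx hi => ih _ hw hx hi rfl) m
      (i := i) (j := j) (hn ▸ hlt) h' (by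
        intro l hl
        have := smul_altRoot_not_isPos b hm.symm hq hp (k := l + 1) (by omega) hj hi
        rwa [altRoot, mul_inv_rev, mul_smul, refl_inv, refl_refl_smul] at this)
    -- The witness is the longest word starting with i, without its first letter, followed by the
    -- remaining factor y.
    refine ⟨altProd m (A j) (A i) * y, ?_, ?_⟩
    · apply LiftRel.climb b m
      · have : (altProd m (refl R (j : ι)) (refl R (i : ι)))⁻¹ *
            (refl R (i : ι) * (refl R (j : ι) * w')) =
            (altProd m (refl R (i : ι)) (refl R (j : ι)))⁻¹ * w' := by
          rw [altProd, altProd] at hbr2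
          rw [inv_mul_eq_iff_eq_mul, ← mul_right_inj (refl R (i : ι)), ← mul_assoc, refl_mul_self,
            one_mul, ← mul_assoc, hbr2]
          group
        rwa [this]
      · intro l hl
        have := smul_altRoot_not_isPos b hm hp hq (k := l + 1) (by omega) hi hj
        rwa [altRoot, ← mul_smul, ← refl_inv (i : ι), ← mul_inv_rev] at this
    · rw [← mul_assoc, ← mul_assoc]
      exact congrArg (· * y) hbr'.symm

theorem LiftRel.unique (hbr : BraidRel b A) {w : R.weylGroup} {x y : M}
    (hx : LiftRel b A w x) (hy : LiftRel b A w y) : x = y := by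
  induction hx generalizing y with
  | one =>
    generalize hw : (1 : R.weylGroup) = w at hy
    cases hy with
    | one => rfl
    | mul i w x h hi =>
      -- A nonempty reduced word has an inversion, whereas the identity has none.
      have := inversions_lt b i.2 hi
      rw [← hw] at this
      simp [inversions] at this
  | mul i w x h hi ih =>
    obtain ⟨z, hz, rfl⟩ := hy.exchange b hbr (i := i) (by
      rw [isPos_inv_refl_mul]; simpa using hi)
    rw [← mul_assoc, refl_mul_self, one_mul] at hz
    rw [ih hz]

theorem LiftRel.exists (hbr : BraidRel b A) (w : R.weylGroup) :
    ∃ x, LiftRel b A w x := by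
  induction w using weylGroup_induction_simple b with
  | one => exact ⟨1, .one⟩
  | mul i hi w ih =>
    obtain ⟨x, hx⟩ := ih
    by_cases h : b.IsPos (w⁻¹ • i)
    · exact ⟨_, .mul ⟨i, hi⟩ w x hx h⟩
    · obtain ⟨y, hy, -⟩ := hx.exchange b hbr (i := ⟨i, hi⟩) h
      exact ⟨y, hy⟩

/-- Involutions satisfying the braid relations define a homomorphism on the Weyl group. -/
theorem exists_weylGroup_lift (hA : ∀ i, A i * A i = 1) (hbr : BraidRel b A) :
    ∃ f : R.weylGroup →* M, ∀ i : b.support, f (refl R (i : ι)) = A i := by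
  choose f hf using LiftRel.exists b hbr
  have f_one : f 1 = 1 := (hf 1).unique b hbr .one
  have f_refl : ∀ (i : b.support) (w : R.weylGroup), f (refl R (i : ι) * w) = A i * f w := by
    intro i w
    by_cases h : b.IsPos (w⁻¹ • (i : ι))
    · exact (hf _).unique b hbr (.mul i w _ (hf w) h)
    · obtain ⟨y, hy, e⟩ := (hf w).exchange b hbr (i := i) h
      rw [(hf _).unique b hbr hy, e, ← mul_assoc, hA, one_mul]
  refine ⟨⟨⟨f, f_one⟩, fun w w' => ?_⟩, fun i => ?_⟩
  · change f (w * w') = f w * f w'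
    induction w using weylGroup_induction_simple b with
    | one => rw [f_one, one_mul, one_mul]
    | mul i hi w ih =>
      rw [mul_assoc, f_refl ⟨i, hi⟩, f_refl ⟨i, hi⟩, ih, mul_assoc]
  · have := f_refl i 1
    rwa [mul_one, f_one, mul_one] at this

end Lift
end Metaplectic


/-! ### The field ℂ(P^m) and Demazure-Lusztig elements in an arbitrary ring -/

namespace Metaplectic

variable {ι E N : Type*} [NormedAddCommGroup E] [InnerProductSpace ℝ E]
  [AddCommGroup N] [Module ℝ N] {R : RootPairing ι ℝ E N}

namespace Datum

variable [R.IsCrystallographic] (D : Datum R)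

section Field

theorem smul_xA (w : R.weylGroup) (v : D.Pm) : w • D.xA v = D.xA (w • v) :=
  AddMonoidAlgebra.mapDomain_single

theorem smul_single (w : R.weylGroup) (v : D.Pm) (c : ℂ) :
    w • (AddMonoidAlgebra.single v c : D.A) = AddMonoidAlgebra.single (w • v) c :=
  AddMonoidAlgebra.mapDomain_single

theorem smul_algebraMap_A (w : R.weylGroup) (c : ℂ) :
    w • algebraMap ℂ D.A c = algebraMap ℂ D.A c := by
  rw [AddMonoidAlgebra.coe_algebraMap]
  simp only [Function.comp_apply, Algebra.algebraMap_self, RingHom.id_apply]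
  rw [smul_single, smul_zero]

theorem smul_algebraMap (w : R.weylGroup) (f : D.A) :
    w • algebraMap D.A D.K f = algebraMap D.A D.K (w • f) :=
  (IsFractionRing.ringEquivOfRingEquiv_algebraMap _ f)

theorem algebraMap_complex (c : ℂ) : algebraMap ℂ D.K c = algebraMap D.A D.K (algebraMap ℂ D.A c) :=
  IsScalarTower.algebraMap_apply ℂ D.A D.K c

theorem smul_algebraMap_complex (w : R.weylGroup) (c : ℂ) :
    w • algebraMap ℂ D.K c = algebraMap ℂ D.K c := by
  rw [algebraMap_complex, smul_algebraMap, smul_algebraMap_A]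

theorem smul_xK (w : R.weylGroup) (v : D.Pm) : w • D.xK v = D.xK (w • v) := by
  rw [xK, smul_algebraMap, smul_xA, xK]

theorem xA_add (u v : D.Pm) : D.xA (u + v) = D.xA u * D.xA v := by
  simp [xA, AddMonoidAlgebra.single_mul_single]

theorem xA_zero : D.xA 0 = 1 := rfl

theorem xK_add (u v : D.Pm) : D.xK (u + v) = D.xK u * D.xK v := by
  rw [xK, xA_add, map_mul, xK, xK]

theorem xK_zero : D.xK 0 = 1 := by
  rw [xK, xA_zero, map_one]

theorem xK_ne_zero (v : D.Pm) : D.xK v ≠ 0 := fun h => by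
  have := D.xK_add v (-v)
  rw [h, zero_mul, add_neg_cancel, xK_zero] at this
  exact one_ne_zero this

theorem xK_neg (v : D.Pm) : D.xK (-v) = (D.xK v)⁻¹ := by
  apply eq_inv_of_mul_eq_one_left
  rw [← xK_add, neg_add_cancel, xK_zero]

theorem algebraMap_mul_xK_ne_one (c : ℂ) {v : D.Pm} (hv : v ≠ 0) :
    algebraMap ℂ D.K c * D.xK v ≠ 1 := by
  intro h
  have h2 : (AddMonoidAlgebra.single v c : D.A) = AddMonoidAlgebra.single 0 1 := by
    apply IsFractionRing.injective D.A D.K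
    have e : (AddMonoidAlgebra.single v c : D.A) = algebraMap ℂ D.A c * D.xA v := by
      simp [xA, AddMonoidAlgebra.single_mul_single]
    rw [e, map_mul, ← algebraMap_complex]
    exact h.trans (map_one _).symm
  rw [AddMonoidAlgebra.single_inj] at h2
  rcases h2 with h2 | h2
  · exact hv h2.1
  · exact one_ne_zero h2.2

theorem xK_ne_one {v : D.Pm} (hv : v ≠ 0) : D.xK v ≠ 1 := by
  have := D.algebraMap_mul_xK_ne_one 1 hv
  rwa [map_one, one_mul] at this

theorem coe_rootm (i : ι) : (D.rootm i : E) = (D.m i : ℝ) • R.root i := by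
  change (D.rootmP i : E) = _
  rw [rootmP, AddSubgroup.coe_nsmul, ← Nat.cast_smul_eq_nsmul ℝ]
  rfl

theorem rootm_ne_zero (i : ι) : D.rootm i ≠ 0 := by
  intro h
  have h2 := congrArg (fun v : D.Pm => (v : E)) h
  simp only [coe_rootm, ZeroMemClass.coe_zero, smul_eq_zero, Nat.cast_eq_zero] at h2
  rcases h2 with h2 | h2
  · exact (D.m_pos i).ne' h2
  · exact R.ne_zero i h2

theorem zsmul_smul (w : R.weylGroup) (x : ℤ) (v : D.Pm) : w • (x • v) = x • (w • v) :=
  map_zsmul (DistribSMul.toAddMonoidHom D.Pm w) x v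

instance : CharZero D.K := charZero_of_injective_algebraMap (algebraMap ℂ D.K).injective

theorem coe_smul_Pm (w : R.weylGroup) (v : D.Pm) : ((w • v : D.Pm) : E) = w • (v : E) := rfl

theorem refl_smul_rootm_self (i : ι) : refl R i • D.rootm i = -D.rootm i := by
  apply Subtype.ext
  rw [coe_smul_Pm, AddSubgroup.coe_neg, coe_rootm, weyl_smul_real, ← smul_neg]
  congr 1
  exact R.reflection_apply_self i

theorem refl_smul_xK_self (i : ι) : refl R i • D.xK (D.rootm i) = (D.xK (D.rootm i))⁻¹ := by
  rw [smul_xK, refl_smul_rootm_self, xK_neg]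

/-- The action of `w` on `ℂ(P^m)`, as a ring homomorphism. -/
def smulHom (w : R.weylGroup) : D.K →+* D.K := MulSemiringAction.toRingHom R.weylGroup D.K w

theorem smulHom_apply (w : R.weylGroup) (f : D.K) : D.smulHom w f = w • f := rfl

end Field

section DemazureLusztig

/-- The scalar `k_i`, as an element of `ℂ(P^m)`. -/
def kK (i : ι) : D.K := algebraMap ℂ D.K (D.k i)

theorem kK_ne_zero (i : ι) : D.kK i ≠ 0 :=
  (map_ne_zero _).2 (D.k_ne_zero i)

theorem smul_kK (w : R.weylGroup) (i : ι) : w • D.kK i = D.kK i := D.smul_algebraMap_complex w _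

theorem kK_sq_mul_xK_ne_one (i : ι) {v : D.Pm} (hv : v ≠ 0) : D.kK i ^ 2 * D.xK v ≠ 1 := by
  rw [kK, ← map_pow]
  exact D.algebraMap_mul_xK_ne_one _ hv

/-- The leading coefficient of the Demazure-Lusztig operator. -/
def dlA (i : ι) : D.K := (1 - D.kK i ^ 2 * D.xK (D.rootm i)) / (1 - D.xK (D.rootm i)) / D.kK i

/-- The constant coefficient of the Demazure-Lusztig operator. -/
def dlB (i : ι) : D.K := (D.kK i - (D.kK i)⁻¹) / (1 - D.xK (D.rootm i))

theorem one_sub_xK_ne (i : ι) : 1 - D.xK (D.rootm i) ≠ 0 :=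
  sub_ne_zero.2 (D.xK_ne_one (D.rootm_ne_zero i)).symm

theorem one_sub_kK_ne (i : ι) : 1 - D.kK i ^ 2 * D.xK (D.rootm i) ≠ 0 :=
  sub_ne_zero.2 (D.kK_sq_mul_xK_ne_one i (D.rootm_ne_zero i)).symm

theorem dlA_ne_zero (i : ι) : D.dlA i ≠ 0 :=
  div_ne_zero (div_ne_zero (D.one_sub_kK_ne i) (D.one_sub_xK_ne i)) (D.kK_ne_zero i)

theorem smul_dlA_ne_zero (w : R.weylGroup) (i : ι) : w • D.dlA i ≠ 0 :=
  (map_ne_zero (D.smulHom w)).2 (D.dlA_ne_zero i)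

theorem refl_smul_dlB (i : ι) : D.dlB i + refl R i • D.dlB i = D.kK i - (D.kK i)⁻¹ := by
  have h1 : refl R i • D.dlB i = (D.kK i - (D.kK i)⁻¹) / (1 - (D.xK (D.rootm i))⁻¹) := by
    rw [← smulHom_apply, dlB, map_div₀, map_sub, map_sub, map_inv₀, map_one]
    simp only [smulHom_apply, smul_kK, refl_smul_xK_self]
  have h2 := D.one_sub_xK_ne i
  have h3 := D.xK_ne_zero (D.rootm i)
  have h4 := D.kK_ne_zero i
  have h5 : D.xK (D.rootm i) - 1 ≠ 0 := by rw [← neg_sub]; exact neg_ne_zero.2 h2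
  rw [h1, dlB]
  field_simp
  ring

theorem dlB_sq (i : ι) : D.dlB i * D.dlB i =
    (D.kK i - (D.kK i)⁻¹) * D.dlB i + 1 - D.dlA i * refl R i • D.dlA i := by
  have h1 : refl R i • D.dlA i = (1 - D.kK i ^ 2 * (D.xK (D.rootm i))⁻¹) /
      (1 - (D.xK (D.rootm i))⁻¹) / D.kK i := by
    rw [← smulHom_apply, dlA, map_div₀, map_div₀, map_sub, map_sub, map_mul, map_pow, map_one]
    simp only [smulHom_apply, smul_kK, refl_smul_xK_self]
  have h2 := D.one_sub_xK_ne i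
  have h3 := D.xK_ne_zero (D.rootm i)
  have h4 := D.kK_ne_zero i
  have h5 : D.xK (D.rootm i) - 1 ≠ 0 := by rw [← neg_sub]; exact neg_ne_zero.2 h2
  rw [h1, dlB, dlA]
  field_simp
  ring

variable {Z : Type*} [Ring Z] (e : D.K →+* Z)

/-- The Demazure-Lusztig operator `a_i A + b_i`. -/
def dlT (i : ι) (A : Z) : Z := e (D.dlA i) * A + e (D.dlB i)

/-- A² = 1 is not assumed, so the identity can be read in both directions: the factor on the right
is the image of a nonzero element of a field, hence a unit. -/
theorem dlT_quadratic {i : ι} {A : Z} (hA : ∀ f, A * e f = e (refl R i • f) * A) :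
    D.dlT e i A * D.dlT e i A - e (D.kK i - (D.kK i)⁻¹) * D.dlT e i A - 1 =
      e (D.dlA i * refl R i • D.dlA i) * (A * A - 1) := by
  have hA' : ∀ f z, A * (e f * z) = e (refl R i • f) * (A * z) := fun f z => by
    rw [← mul_assoc, hA, mul_assoc]
  have e3 : D.dlT e i A * D.dlT e i A = e (D.dlA i * refl R i • D.dlA i) * (A * A) +
      e (D.dlA i * (D.dlB i + refl R i • D.dlB i)) * A + e (D.dlB i * D.dlB i) := by
    simp only [dlT, mul_add, add_mul, map_add, map_mul, mul_assoc, hA', hA]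
    simp only [← mul_assoc, ← map_mul, mul_comm (D.dlB i)]
    abel
  rw [e3, refl_smul_dlB, dlB_sq, dlT, mul_comm (D.dlA i) (D.kK i - (D.kK i)⁻¹)]
  simp only [map_mul, map_sub, map_add, map_one, mul_add, mul_sub, sub_mul, mul_assoc, mul_one]
  abel

theorem dlT_quadratic_iff {i : ι} {A : Z} (hA : ∀ f, A * e f = e (refl R i • f) * A) :
    D.dlT e i A * D.dlT e i A = e (D.kK i - (D.kK i)⁻¹) * D.dlT e i A + 1 ↔ A * A = 1 := by
  have h := D.dlT_quadratic e hA
  have hu : IsUnit (e (D.dlA i * refl R i • D.dlA i)) :=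
    (IsUnit.mk0 _ (mul_ne_zero (D.dlA_ne_zero i) (D.smul_dlA_ne_zero _ i))).map e
  rw [← sub_eq_zero (a := A * A), ← hu.mul_right_eq_zero, ← h, sub_sub, sub_eq_zero]

end DemazureLusztig

section RankTwo

variable [Finite ι] (b : R.Base)

omit [Finite ι] in
theorem refl_smul_rootm {i j : ι} {p : ℤ}
    (h : (D.m i : ℝ)⁻¹ * R.coroot' i ((D.m j : ℝ) • R.root j) = -p) :
    refl R i • D.rootm j = D.rootm j + p • D.rootm i := by
  apply Subtype.ext
  rw [coe_smul_Pm, AddSubgroup.coe_add, AddSubgroup.coe_zsmul, coe_rootm, coe_rootm, refl_smul,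
    ← Int.cast_smul_eq_zsmul ℝ, smul_smul, sub_eq_add_neg, ← neg_smul]
  congr 2
  have hm : (D.m i : ℝ) ≠ 0 := by exact_mod_cast (D.m_pos i).ne'
  rw [inv_mul_eq_iff_eq_mul₀ hm] at h
  rw [h]
  ring

/-- Rescaling multiplies p by m(α_j) / m(α_i) and q by the inverse ratio. The product pq is
unchanged, and so is the order of s_i s_j. -/
theorem exists_isRankTwo_rootm {i j : ι} (hi : i ∈ b.support) (hj : j ∈ b.support) (hij : i ≠ j) :
    ∃ p q : ℤ, IsRankTwo p q (orderOf (refl R i * refl R j)) ∧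
      refl R i • D.rootm j = D.rootm j + p • D.rootm i ∧
      refl R j • D.rootm i = D.rootm i + q • D.rootm j ∧
      (p = 1 → q = 1 → D.k i = D.k j) := by
  obtain ⟨p, q, hm, hp, hq⟩ := exists_isRankTwo b hi hj hij
  obtain ⟨p', hp'⟩ := D.rootm_mem j i
  obtain ⟨q', hq'⟩ := D.rootm_mem i j
  have ep : (D.rootmP j : E) = (D.m j : ℝ) • R.root j := D.coe_rootm j
  have eq : (D.rootmP i : E) = (D.m i : ℝ) • R.root i := D.coe_rootm i
  rw [ep] at hp'
  rw [eq] at hq'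
  have hi0 : (0 : ℝ) < D.m i := by exact_mod_cast D.m_pos i
  have hj0 : (0 : ℝ) < D.m j := by exact_mod_cast D.m_pos j
  have fp : (p' : ℝ) = -(D.m j * p / D.m i) := by
    rw [← hp', map_smul, hp, smul_eq_mul]; field_simp
  have fq : (q' : ℝ) = -(D.m i * q / D.m j) := by
    rw [← hq', map_smul, hq, smul_eq_mul]; field_simp
  have hpq : 0 ≤ p ∧ 0 ≤ q ∧ (p = 0 ↔ q = 0) ∧ (p * q = 1 → p = 1 ∧ q = 1) := by
    rcases hm with h | h | h | h | h | h <;> obtain ⟨rfl, rfl, -⟩ := h <;> norm_num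
  obtain ⟨hp0, hq0, h0, h1⟩ := hpq
  have hp0' : (0 : ℝ) ≤ p := by exact_mod_cast hp0
  have hq0' : (0 : ℝ) ≤ q := by exact_mod_cast hq0
  have e : -p' * -q' = p * q := by
    have : (-p' : ℝ) * -q' = p * q := by rw [fp, fq]; field_simp
    exact_mod_cast this
  refine ⟨-p', -q', hm.of_mul_eq ?_ ?_ ?_ e, D.refl_smul_rootm (by rw [hp']; push_cast; ring),
    D.refl_smul_rootm (by rw [hq']; push_cast; ring), fun h h' => ?_⟩
  · have : (0 : ℝ) ≤ -p' := by rw [fp]; rw [neg_neg]; positivity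
    exact_mod_cast this
  · have : (0 : ℝ) ≤ -q' := by rw [fq]; rw [neg_neg]; positivity
    exact_mod_cast this
  · have a1 : (p' : ℝ) = 0 ↔ (p : ℝ) = 0 := by
      rw [fp, neg_eq_zero, div_eq_zero_iff, mul_eq_zero]; simp [hi0.ne', hj0.ne']
    have a2 : (q' : ℝ) = 0 ↔ (q : ℝ) = 0 := by
      rw [fq, neg_eq_zero, div_eq_zero_iff, mul_eq_zero]; simp [hi0.ne', hj0.ne']
    rw [Int.cast_eq_zero, Int.cast_eq_zero] at a1 a2
    rw [neg_eq_zero, neg_eq_zero, a1, a2, h0]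
  -- Type A₂ for Φ^m forces type A₂ for Φ. There s_i s_j carries α_i to α_j, so the invariant
  -- parameters coincide.
  · obtain ⟨rfl, rfl⟩ := h1 (by rw [← e, h, h', one_mul])
    have : (refl R i * refl R j) • i = j := by
      apply R.root.injective
      rw [root_smul, mul_smul]
      have := refl_smul_add' hq 0 1 0
      simp only [zero_add, one_smul, zero_smul, add_zero, map_zero] at this
      rw [this]
      have := refl_smul_add hp 0 1 1
      simp only [zero_add, one_smul, map_zero] at this
      norm_num [this]
    rw [← this, D.k_weyl]

/-- The rank two torus attached to two simple reflections. -/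
def torus {i j : ι} (hli : LinearIndependent ℝ ![R.root i, R.root j]) {p q : ℤ}
    (hp : refl R i • D.rootm j = D.rootm j + p • D.rootm i)
    (hq : refl R j • D.rootm i = D.rootm i + q • D.rootm j) : RankTwoTorus D.K p q :=
  have hne : ∀ x y : ℤ, (x ≠ 0 ∨ y ≠ 0) → x • D.rootm i + y • D.rootm j ≠ 0 := by
    intro x y hxy h
    have h2 := congrArg (fun v : D.Pm => (v : E)) h
    simp only [AddSubgroup.coe_add, AddSubgroup.coe_zsmul, coe_rootm, ZeroMemClass.coe_zero,
      ← Int.cast_smul_eq_zsmul ℝ, smul_smul] at h2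
    obtain ⟨h3, h4⟩ := LinearIndependent.pair_iff.1 hli _ _ h2
    have hi0 : (D.m i : ℝ) ≠ 0 := by exact_mod_cast (D.m_pos i).ne'
    have hj0 : (D.m j : ℝ) ≠ 0 := by exact_mod_cast (D.m_pos j).ne'
    simp only [mul_eq_zero, hi0, hj0, or_false, Int.cast_eq_zero] at h3 h4
    tauto
  { X := fun x y => D.xK (x • D.rootm i + y • D.rootm j)
    s := D.smulHom (refl R i)
    t := D.smulHom (refl R j)
    k := D.kK i
    l := D.kK j
    X_zero := by rw [zero_smul, zero_smul, add_zero, xK_zero]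
    X_add := fun x y x' y' => by rw [← xK_add]; congr 1; module
    X_ne_one := fun x y h => D.xK_ne_one (hne x y h)
    s_X := fun x y => by
      rw [smulHom_apply, smul_xK, smul_add, zsmul_smul, zsmul_smul, refl_smul_rootm_self, hp]
      congr 1; module
    t_X := fun x y => by
      rw [smulHom_apply, smul_xK, smul_add, zsmul_smul, zsmul_smul, refl_smul_rootm_self, hq]
      congr 1; module
    k_ne_zero := D.kK_ne_zero i
    l_ne_zero := D.kK_ne_zero j
    s_k := D.smul_kK _ i
    s_l := D.smul_kK _ j
    t_k := D.smul_kK _ i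
    t_l := D.smul_kK _ j
    k_X_ne_one := fun x y h => D.kK_sq_mul_xK_ne_one i (hne x y h)
    l_X_ne_one := fun x y h => D.kK_sq_mul_xK_ne_one j (hne x y h) }

/-- The bridge between Hecke and Weyl braid relations. As C ≠ 0 its image is a unit, so either
relation implies the other. The ring is left arbitrary because the lemma is applied to endomorphisms
of ℂ(P), to the semidirect product and to the localized Hecke algebra. -/
theorem dlT_braid {i j : b.support} (hij : i ≠ j) {Z : Type*} [Ring Z] (e : D.K →+* Z) {A B : Z}
    (hA : ∀ f, A * e f = e (refl R (i : ι) • f) * A)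
    (hB : ∀ f, B * e f = e (refl R (j : ι) • f) * B) (hAA : A * A = 1) (hBB : B * B = 1) :
    ∃ C ≠ 0, altProd (orderOf (refl R (i : ι) * refl R (j : ι))) (D.dlT e i A) (D.dlT e j B) -
      altProd (orderOf (refl R (i : ι) * refl R (j : ι))) (D.dlT e j B) (D.dlT e i A) =
      e C * (altProd (orderOf (refl R (i : ι) * refl R (j : ι))) A B -
        altProd (orderOf (refl R (i : ι) * refl R (j : ι))) B A) := by
  have hij' : (i : ι) ≠ j := fun h => hij (Subtype.ext h)
  obtain ⟨p, q, hm, hp, hq, hk⟩ := D.exists_isRankTwo_rootm b i.2 j.2 hij'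
  have := (D.torus (b.linearIndependent_pair_of_ne hij) hp hq).exists_braid_coefficient e hm
    (fun h h' => congrArg (algebraMap ℂ D.K) (hk h h').symm) hA hB hAA hBB
  have hT1 : (D.torus (b.linearIndependent_pair_of_ne hij) hp hq).T₁ e A = D.dlT e i A := by
    rw [RankTwoTorus.T₁, dlT, RankTwoTorus.bCoeff_eq _ (RankTwoTorus.k_ne_zero _),
      RankTwoTorus.a_eq _ (RankTwoTorus.k_ne_zero _) (by simp)]
    have hX : (D.torus (b.linearIndependent_pair_of_ne hij) hp hq).X 1 0 = D.xK (D.rootm i) := by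
      simp [torus]
    have hk : (D.torus (b.linearIndependent_pair_of_ne hij) hp hq).k = D.kK i := rfl
    rw [hX, hk, dlA, dlB]
    congr 2
    have h2 := D.one_sub_xK_ne i
    have h4 := D.kK_ne_zero i
    field_simp
    ring
  have hT2 : (D.torus (b.linearIndependent_pair_of_ne hij) hp hq).T₂ e B = D.dlT e j B := by
    have hk : (D.torus (b.linearIndependent_pair_of_ne hij) hp hq).l = D.kK j := rfl
    rw [RankTwoTorus.T₂, dlT, RankTwoTorus.bCoeff_eq _ (RankTwoTorus.l_ne_zero _),
      RankTwoTorus.a_eq _ (RankTwoTorus.l_ne_zero _) (by simp)]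
    have hX : (D.torus (b.linearIndependent_pair_of_ne hij) hp hq).X 0 1 = D.xK (D.rootm j) := by
      simp [torus]
    rw [hX, hk, dlA, dlB]
    congr 2
    have h2 := D.one_sub_xK_ne j
    have h4 := D.kK_ne_zero j
    field_simp
    ring
  rwa [hT1, hT2] at this

end RankTwo
end Datum
end Metaplectic


/-! ### Weights, small representatives modulo P^m, and ρ - ρ^m -/

namespace Metaplectic

variable {ι E N : Type*} [NormedAddCommGroup E] [InnerProductSpace ℝ E]
  [AddCommGroup N] [Module ℝ N] {R : RootPairing ι ℝ E N}

section Weights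

theorem coe_smul_weight (w : R.weylGroup) (v : weightLattice R) :
    ((w • v : weightLattice R) : E) = w • (v : E) := rfl

theorem wt_eq_of_coe {v : weightLattice R} {i : ι} {z : ℤ} (h : R.coroot' i (v : E) = z) :
    wt R v i = z := by
  rw [wt, h, Int.floor_intCast]

theorem wt_add (v u : weightLattice R) (i : ι) : wt R (v + u) i = wt R v i + wt R u i :=
  wt_eq_of_coe (by rw [AddSubgroup.coe_add, map_add, ← wt_spec, ← wt_spec, Int.cast_add])

theorem wt_neg (v : weightLattice R) (i : ι) : wt R (-v) i = -wt R v i :=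
  wt_eq_of_coe (by rw [AddSubgroup.coe_neg, map_neg, ← wt_spec, Int.cast_neg])

theorem wt_sub (v u : weightLattice R) (i : ι) : wt R (v - u) i = wt R v i - wt R u i := by
  rw [sub_eq_add_neg, wt_add, wt_neg, sub_eq_add_neg]

theorem wt_zsmul (z : ℤ) (v : weightLattice R) (i : ι) : wt R (z • v) i = z * wt R v i :=
  wt_eq_of_coe (by rw [AddSubgroup.coe_zsmul, map_zsmul, ← wt_spec, zsmul_eq_mul, Int.cast_mul])

theorem wt_smul (w : R.weylGroup) (v : weightLattice R) (i : ι) :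
    wt R (w • v) (w • i) = wt R v i :=
  wt_eq_of_coe (by rw [coe_smul_weight, coroot'_smul, wt_spec])

theorem wt_smul_left (w : R.weylGroup) (v : weightLattice R) (i : ι) :
    wt R (w • v) i = wt R v (w⁻¹ • i) := by
  rw [← wt_smul w v (w⁻¹ • i), smul_inv_smul]

theorem wt_refl_smul_left (i j : ι) (v : weightLattice R) :
    wt R (refl R i • v) j = wt R v (refl R i • j) := by
  rw [wt_smul_left, refl_inv]

variable [R.IsCrystallographic]

theorem wt_rootP_self (i : ι) : wt R (rootP R i) i = 2 :=
  wt_eq_of_coe (R.root_coroot_two i)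

theorem refl_smul_weight (i : ι) (v : weightLattice R) :
    refl R i • v = v - wt R v i • rootP R i := by
  apply Subtype.ext
  rw [coe_smul_weight, refl_smul, ← wt_spec, Int.cast_smul_eq_zsmul]
  rfl

theorem wt_refl_smul_self (i : ι) (v : weightLattice R) :
    wt R (refl R i • v) i = -wt R v i := by
  rw [refl_smul_weight, wt_sub, wt_zsmul, wt_rootP_self]
  ring

end Weights

namespace Datum

variable [R.IsCrystallographic] (D : Datum R)

/-- The inclusion `P^m ⊆ P`. -/
def inclP : D.Pm →+ weightLattice R := AddSubgroup.inclusion D.Pm_le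

theorem coe_inclP (u : D.Pm) : (D.inclP u : E) = u := rfl

theorem inclP_smul (w : R.weylGroup) (u : D.Pm) : D.inclP (w • u) = w • D.inclP u := rfl

theorem inclP_rootm (i : ι) : D.inclP (D.rootm i) = D.rootmP i := rfl

theorem dvd_wt_inclP (u : D.Pm) (i : ι) : (D.m i : ℤ) ∣ wt R (D.inclP u) i := by
  obtain ⟨z, hz⟩ := u.2 i
  have : (D.m i : ℝ) ≠ 0 := by exact_mod_cast (D.m_pos i).ne'
  rw [inv_mul_eq_iff_eq_mul₀ this] at hz
  exact ⟨z, wt_eq_of_coe (by rw [coe_inclP, hz]; push_cast; rfl)⟩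

theorem rootmP_eq (i : ι) : D.rootmP i = (D.m i : ℤ) • rootP R i := by
  rw [rootmP, natCast_zsmul]

/-- The weights `λ` with `|(λ, α^∨)| ≤ m(α)` for all roots `α`. -/
def IsSmall (v : weightLattice R) : Prop := ∀ i, |wt R v i| ≤ D.m i

theorem IsSmall.smul {v : weightLattice R} (h : D.IsSmall v) (w : R.weylGroup) :
    D.IsSmall (w • v) := by
  intro i
  rw [wt_smul_left, ← D.m_weyl w⁻¹]
  exact h _

/-- The sum of the squares (v, β^∨)² is a W-invariant quadratic form. Along the line v - zα_i it is
a parabola with equal values at z = 0 and z = t = (v, α_i^∨). If |t| > m(α_i), a step of length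
m(α_i) towards s_i v ends strictly between these points and lowers the form, so the descent stops at
a small weight. -/
theorem exists_isSmall_add [Finite ι] (v : weightLattice R) :
    ∃ u : D.Pm, D.IsSmall (v + D.inclP u) := by
  classical
  cases nonempty_fintype ι
  set f : weightLattice R → ℤ := fun v => ∑ j, wt R v j ^ 2 with hf
  have hf0 : ∀ v, 0 ≤ f v := fun v => Finset.sum_nonneg fun j _ => sq_nonneg _
  induction hn : (f v).toNat using Nat.strong_induction_on generalizing v with
  | _ n ih =>
  by_cases hv : D.IsSmall v
  · exact ⟨0, by rwa [map_zero, add_zero]⟩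
  obtain ⟨i, hi⟩ := not_forall.1 hv
  rw [not_le] at hi
  set t := wt R v i with ht
  have hm : (0 : ℤ) < D.m i := by exact_mod_cast D.m_pos i
  have ht0 : t ≠ 0 := by rintro h; rw [h] at hi; simp at hi; omega
  set c : ι → ℤ := fun j => wt R (rootP R i) j with hc
  have hline : ∀ z : ℤ, f (v - z • rootP R i) =
      f v - 2 * z * ∑ j, wt R v j * c j + z ^ 2 * ∑ j, c j ^ 2 := by
    intro z
    simp only [hf, wt_sub, wt_zsmul]
    rw [Finset.mul_sum, Finset.mul_sum, ← Finset.sum_sub_distrib, ← Finset.sum_add_distrib]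
    exact Finset.sum_congr rfl fun j _ => by simp only [hc]; ring
  have hsym : f (v - t • rootP R i) = f v := by
    rw [ht, ← refl_smul_weight]
    simp only [hf, wt_refl_smul_left]
    exact Equiv.sum_comp (MulAction.toPerm (refl R i)) (fun j => wt R v j ^ 2)
  -- Comparing the values at z = 0 and z = t determines the linear coefficient of the parabola.
  have hS : 2 * ∑ j, wt R v j * c j = t * ∑ j, c j ^ 2 := by
    rw [hline] at hsym
    apply mul_left_cancel₀ ht0
    linarith
  have hpos : 0 < ∑ j, c j ^ 2 := by
    refine Finset.sum_pos' (fun j _ => sq_nonneg _) ⟨i, Finset.mem_univ _, ?_⟩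
    simp [hc, wt_rootP_self]
  obtain ⟨ε, hε, hεt⟩ : ∃ ε : ℤ, ε ^ 2 = 1 ∧ ε * t = |t| := by
    rcases abs_cases t with h | h
    · exact ⟨1, by norm_num, by rw [h.1, one_mul]⟩
    · exact ⟨-1, by norm_num, by rw [h.1]; ring⟩
  have hlt : f (v - (ε * D.m i) • rootP R i) < f v := by
    rw [hline]
    have e : f v - 2 * (ε * D.m i) * ∑ j, wt R v j * c j + (ε * D.m i) ^ 2 * ∑ j, c j ^ 2 =
        f v - (D.m i * (|t| - D.m i)) * ∑ j, c j ^ 2 := by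
      rw [← hεt]
      linear_combination (-(ε * D.m i)) * hS + (D.m i : ℤ) ^ 2 * (∑ j, c j ^ 2) * hε
    rw [e]
    have : 0 < (D.m i * (|t| - D.m i)) * ∑ j, c j ^ 2 :=
      mul_pos (mul_pos hm (by linarith)) hpos
    linarith
  obtain ⟨u, hu⟩ := ih _ (by
    rw [← hn]
    exact (Int.toNat_lt_toNat (lt_of_le_of_lt (hf0 _) hlt)).2 hlt) _ rfl
  refine ⟨u - ε • D.rootm i, ?_⟩
  convert hu using 1
  rw [map_sub, map_zsmul, inclP_rootm, rootmP_eq, smul_smul]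
  abel

end Datum

section HalfSum

variable (b : R.Base)

theorem root_mem_closure_iff (j : ι) :
    R.root j ∈ AddSubmonoid.closure (R.root '' b.support) ↔ b.IsPos j := by
  classical
  have key : ∀ x ∈ AddSubmonoid.closure (R.root '' (b.support : Set ι)),
      ∃ f : ι → ℕ, x = ∑ l ∈ b.support, f l • R.root l := by
    intro x hx
    induction hx using AddSubmonoid.closure_induction with
    | mem x hx =>
      obtain ⟨l, hl, rfl⟩ := hx
      refine ⟨Pi.single l 1, ?_⟩
      rw [Finset.sum_eq_single_of_mem l hl (fun k _ hk => by simp [hk])]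
      simp
    | zero => exact ⟨0, by simp⟩
    | add x y _ _ hx hy =>
      obtain ⟨f, rfl⟩ := hx
      obtain ⟨g, rfl⟩ := hy
      exact ⟨f + g, by simp [add_smul, Finset.sum_add_distrib]⟩
  have key2 : ∀ j, R.root j ∈ AddSubmonoid.closure (R.root '' (b.support : Set ι)) →
      b.IsPos j := by
    intro j hj
    obtain ⟨f, hf⟩ := key _ hj
    rw [RootPairing.Base.isPos_iff', RootPairing.Base.height_eq_sum (f := fun l => (f l : ℤ))
      (by simpa using hf)]
    exact Finset.sum_nonneg fun l _ => Int.natCast_nonneg _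
  refine ⟨key2 j, fun h => (b.root_mem_or_neg_mem j).resolve_right fun h' => ?_⟩
  have h2 : R.root (refl R j • j) = -R.root j := R.reflection_apply_self j ▸ root_smul _ _
  have h3 := key2 (refl R j • j) (h2 ▸ h')
  rw [RootPairing.Base.isPos_iff, height_refl_self] at h3
  rw [RootPairing.Base.isPos_iff] at h
  omega

variable [Fintype ι] [R.IsCrystallographic] [R.IsReduced] [R.IsRootSystem]

omit [R.IsRootSystem] in
theorem refl_smul_pos_iff {i : ι} (hi : i ∈ b.support) (j : ι) :
    (b.IsPos (refl R i • j) ∧ refl R i • j ≠ i) ↔ (b.IsPos j ∧ j ≠ i) := by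
  have key : ∀ j, (b.IsPos j ∧ j ≠ i) → (b.IsPos (refl R i • j) ∧ refl R i • j ≠ i) := by
    rintro j ⟨hj, hji⟩
    refine ⟨hj.reflectionPerm hi hji, fun h => ?_⟩
    have e : j = refl R i • i := (refl_refl_smul (R := R) i j).symm.trans (congrArg (refl R i • ·) h)
    have h2 := height_refl_self b i
    rw [← e] at h2
    have := RootPairing.Base.isPos_of_mem_support hi
    rw [RootPairing.Base.isPos_iff] at hj this
    omega
  exact ⟨fun h => by simpa only [refl_refl_smul] using key _ h, key j⟩

-- The reflection s_i permutes the positive roots other than α_i and negates their pairing with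
-- α_i^∨. Their contributions cancel, and only that of α_i remains.
omit [R.IsRootSystem] in
theorem coroot'_halfSum {c : ι → ℝ} (hc : ∀ (w : R.weylGroup) i, c (w • i) = c i) {i : ι}
    (hi : i ∈ b.support) : R.coroot' i (halfSum b c) = c i := by
  classical
  have h1 : R.coroot' i (halfSum b c) =
      2⁻¹ * ∑ j, if b.IsPos j then c j * R.coroot' i (R.root j) else 0 := by
    rw [halfSum, map_smul, smul_eq_mul, map_sum]
    congr 1
    refine Finset.sum_congr rfl fun j _ => ?_
    simp only [root_mem_closure_iff]
    split_ifs <;> simp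
  have h2 : ∀ j, (if b.IsPos j then c j * R.coroot' i (R.root j) else 0) =
      (if b.IsPos j ∧ j ≠ i then c j * R.coroot' i (R.root j) else 0) +
      if j = i then 2 * c i else 0 := by
    intro j
    by_cases hji : j = i
    · subst hji
      rw [if_pos (RootPairing.Base.isPos_of_mem_support hi), if_neg (by simp), if_pos rfl,
        show R.coroot' j (R.root j) = 2 from R.root_coroot_two j]
      ring
    · simp [hji]
  have h3 : ∑ j, (if b.IsPos j ∧ j ≠ i then c j * R.coroot' i (R.root j) else 0) = 0 := by
    have := Equiv.sum_comp (MulAction.toPerm (refl R i))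
      (fun j => if b.IsPos j ∧ j ≠ i then c j * R.coroot' i (R.root j) else 0)
    simp only [MulAction.toPerm_apply] at this
    simp only [refl_smul_pos_iff b hi, hc, root_smul] at this
    have h4 : ∀ j, R.coroot' i (refl R i • R.root j) = -R.coroot' i (R.root j) := by
      intro j
      rw [refl_smul, map_sub, map_smul, show R.coroot' i (R.root i) = 2 from R.root_coroot_two i,
        smul_eq_mul]
      ring
    simp only [h4, mul_neg] at this
    rw [← add_self_eq_zero]
    nth_rw 1 [← this]
    rw [← Finset.sum_add_distrib]
    exact Finset.sum_eq_zero fun j _ => by split_ifs <;> ring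
  rw [h1, Finset.sum_congr rfl fun j _ => h2 j, Finset.sum_add_distrib, h3,
    Finset.sum_ite_eq' Finset.univ i, if_pos (Finset.mem_univ _)]
  ring

omit [R.IsRootSystem] in
/-- The weight `ρ - ρ^m`. -/
theorem Datum.exists_rho_sub (D : Datum R) : ∃ δ : weightLattice R,
    (δ : E) = halfSum b (fun _ => 1) - halfSum b (fun i => D.m i) ∧
      ∀ i ∈ b.support, wt R δ i = 1 - D.m i := by
  have h : ∀ i ∈ b.support, R.coroot' i (halfSum b (fun _ => 1) - halfSum b (fun i => (D.m i : ℝ)))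
      = ((1 - D.m i : ℤ) : ℝ) := by
    intro i hi
    rw [map_sub, coroot'_halfSum b (fun _ _ => rfl) hi,
      coroot'_halfSum b (fun w i => by rw [D.m_weyl]) hi]
    push_cast
    rfl
  exact ⟨⟨_, mem_weightLattice_of_simple b _ fun i => ⟨_, h i i.2⟩⟩, rfl,
    fun i hi => wt_eq_of_coe (h i hi)⟩

end HalfSum
end Metaplectic


/-! ### ℂ(P) over ℂ(P^m) and semilinear operators -/

namespace Metaplectic

variable {ι E N : Type*} [NormedAddCommGroup E] [InnerProductSpace ℝ E]
  [AddCommGroup N] [Module ℝ N] {R : RootPairing ι ℝ E N}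

section Monomials

theorem xP_add (u v : weightLattice R) : xP R (u + v) = xP R u * xP R v := by
  rw [xP, xP, xP, ← map_mul, AddMonoidAlgebra.single_mul_single, one_mul]

theorem xP_zero : xP R 0 = 1 := map_one (algebraMap (GroupAlgP R) (FieldP R))

theorem xP_ne_zero (v : weightLattice R) : xP R v ≠ 0 := fun h => by
  have := xP_add v (-v)
  rw [h, zero_mul, add_neg_cancel, xP_zero] at this
  exact one_ne_zero this

theorem xP_neg (v : weightLattice R) : xP R (-v) = (xP R v)⁻¹ := by
  apply eq_inv_of_mul_eq_one_left
  rw [← xP_add, neg_add_cancel, xP_zero]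

theorem algebraMap_single (v : weightLattice R) (c : ℂ) :
    algebraMap (GroupAlgP R) (FieldP R) (AddMonoidAlgebra.single v c) = c • xP R v := by
  rw [xP, ← algebraMap_smul (GroupAlgP R) c, Algebra.smul_def (algebraMap ℂ (GroupAlgP R) c),
    ← map_mul]
  congr 1
  simp [AddMonoidAlgebra.single_mul_single]

end Monomials

/-- A semilinear map on a ring extends to its field of fractions, if suitable denominators
exist. -/
theorem exists_semilinear_extension {A B K F : Type*} [CommRing A] [IsDomain A] [CommRing B]
    [Field K] [Field F] (j : A →+* B) (α : A →+* K) (β : B →+* F) (γ : K →+* F)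
    (hγ : ∀ a, γ (α a) = β (j a)) (hα : Function.Injective α) (hβ : Function.Injective β)
    (hK : ∀ f, ∃ a c, c ≠ 0 ∧ α a / α c = f)
    (hF : ∀ y, ∃ p d, d ≠ 0 ∧ γ (α d) * y = β p) (s : K →+* K) (L₀ : B →+ F)
    (hL₀ : ∀ d p, L₀ (j d * p) = γ (s (α d)) * L₀ p) :
    ∃ L : F →+ F, (∀ f y, L (γ f * y) = γ (s f) * L y) ∧ ∀ p, L (β p) = L₀ p := by
  choose p d hd hpd using hF
  have hs : ∀ d, d ≠ 0 → γ (s (α d)) ≠ 0 := fun d hd => by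
    rw [map_ne_zero, map_ne_zero]
    exact (map_ne_zero_iff α hα).2 hd
  have hs' : ∀ d, d ≠ 0 → γ (α d) ≠ 0 := fun d hd => by
    rw [map_ne_zero]
    exact (map_ne_zero_iff α hα).2 hd
  -- The value is forced: y = p / d must go to L₀(p) / s(d).
  let L : F → F := fun y => (γ (s (α (d y))))⁻¹ * L₀ (p y)
  -- The value does not depend on the chosen fraction. Additivity and semilinearity then follow from
  -- convenient choices of denominator.
  have hL : ∀ y a c, c ≠ 0 → γ (α c) * y = β a → γ (s (α c)) * L y = L₀ a := by
    intro y a c hc h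
    have h1 : j c * p y = j (d y) * a := by
      apply hβ
      rw [map_mul, map_mul, ← h, ← hpd, ← hγ, ← hγ]
      ring
    have h2 := congrArg L₀ h1
    rw [hL₀, hL₀] at h2
    have h3 := hs _ (hd y)
    simp only [L]
    field_simp
    linear_combination h2
  have hL' : ∀ y, γ (s (α (d y))) * L y = L₀ (p y) := fun y => hL y _ _ (hd y) (hpd y)
  have hadd : ∀ x y, L (x + y) = L x + L y := by
    intro x y
    have h1 := hL (x + y) (j (d y) * p x + j (d x) * p y) (d x * d y)
      (mul_ne_zero (hd x) (hd y)) (by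
        rw [map_add, map_mul, map_mul, map_mul, map_mul, ← hpd, ← hpd, ← hγ, ← hγ]
        ring)
    rw [map_add, hL₀, hL₀, ← hL' x, ← hL' y, map_mul, map_mul, map_mul] at h1
    apply mul_left_cancel₀ (mul_ne_zero (hs _ (hd x)) (hs _ (hd y)))
    linear_combination h1
  have hsemi : ∀ f y, L (γ f * y) = γ (s f) * L y := by
    intro f y
    obtain ⟨a, c, hc, rfl⟩ := hK f
    have hc' := hs' c hc
    have hc2 := hs c hc
    have h1 := hL (γ (α a / α c) * y) (j a * p y) (c * d y) (mul_ne_zero hc (hd y)) (by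
      rw [map_mul, map_mul, map_mul, ← hpd, map_div₀, ← hγ]
      field_simp)
    rw [hL₀, ← hL' y, map_mul, map_mul, map_mul] at h1
    apply mul_left_cancel₀ (mul_ne_zero hc2 (hs _ (hd y)))
    rw [h1, map_div₀, map_div₀]
    field_simp
  refine ⟨AddMonoidHom.mk' L hadd, hsemi, fun b => ?_⟩
  have := hL (β b) b 1 one_ne_zero (by rw [map_one, map_one, one_mul])
  rwa [map_one, map_one, map_one, one_mul] at this

namespace Datum

variable [R.IsCrystallographic] (D : Datum R)

theorem inclA_single (u : D.Pm) (c : ℂ) :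
    D.inclA (AddMonoidAlgebra.single u c) = AddMonoidAlgebra.single (D.inclP u) c :=
  AddMonoidAlgebra.mapDomain_single

theorem inclK_algebraMap (f : D.A) :
    D.inclK (algebraMap D.A D.K f) = algebraMap (GroupAlgP R) (FieldP R) (D.inclA f) :=
  IsFractionRing.lift_algebraMap _ f

theorem inclK_xK (u : D.Pm) : D.inclK (D.xK u) = xP R (D.inclP u) := by
  rw [xK, inclK_algebraMap, xA, inclA_single, xP]

theorem inclK_complex (c : ℂ) : D.inclK (algebraMap ℂ D.K c) = algebraMap ℂ (FieldP R) c := by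
  rw [algebraMap_complex, inclK_algebraMap, AddMonoidAlgebra.coe_algebraMap, Function.comp_apply,
    inclA_single, map_zero, algebraMap_single, xP_zero, Algebra.smul_def, mul_one]
  rfl

theorem inclK_kK (i : ι) : D.inclK (D.kK i) = algebraMap ℂ (FieldP R) (D.k i) := D.inclK_complex _

section Fractions

variable [Finite ι]

/-- The product of all m(α) carries P into P^m, so every monomial has a power in ℂ[P^m] and ℂ[P] is
integral over it. A nonzero algebraic element divides a nonzero element of the base. Hence
denominators of ℂ(P) can be taken in ℂ[P^m]. -/
theorem exists_inclA_multiple {q : GroupAlgP R} (hq : q ≠ 0) :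
    ∃ d : D.A, d ≠ 0 ∧ q ∣ D.inclA d := by
  let _ : Algebra D.A (GroupAlgP R) := D.inclA.toAlgebra
  cases nonempty_fintype ι
  have hn : 0 < ∏ i, D.m i := Finset.prod_pos fun i _ => D.m_pos i
  have key : IsIntegral D.A q := by
    induction q using AddMonoidAlgebra.induction_linear with
    | zero => exact isIntegral_zero
    | add x y hx hy =>
      by_cases h1 : x = 0
      · rw [h1, zero_add] at hq ⊢; exact hy hq
      by_cases h2 : y = 0
      · rw [h2, add_zero] at hq ⊢; exact hx hq
      exact (hx h1).add (hy h2)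
    | single v c =>
      refine IsIntegral.of_pow hn ?_
      have hmem : (((∏ i, D.m i) • v : weightLattice R) : E) ∈ D.Pm := by
        intro i
        obtain ⟨a, ha⟩ := Finset.dvd_prod_of_mem D.m (Finset.mem_univ i)
        have hm : (D.m i : ℝ) ≠ 0 := by exact_mod_cast (D.m_pos i).ne'
        refine ⟨a * wt R v i, ?_⟩
        rw [AddSubgroup.coe_nsmul, map_nsmul, ← wt_spec, ha, nsmul_eq_mul]
        push_cast
        field_simp
      have e : (AddMonoidAlgebra.single v c : GroupAlgP R) ^ (∏ i, D.m i) =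
          algebraMap D.A (GroupAlgP R) (AddMonoidAlgebra.single ⟨_, hmem⟩ (c ^ (∏ i, D.m i))) := by
        rw [AddMonoidAlgebra.single_pow]
        exact (D.inclA_single ⟨_, hmem⟩ _).symm
      rw [e]
      exact isIntegral_algebraMap
  exact key.isAlgebraic.exists_nonzero_dvd (mem_nonZeroDivisors_of_ne_zero hq)

omit [Finite ι] in
theorem inclK_algebraMap_ne_zero {d : D.A} (hd : d ≠ 0) : D.inclK (algebraMap D.A D.K d) ≠ 0 := by
  rw [map_ne_zero]
  exact fun h => hd (IsFractionRing.injective D.A D.K (h.trans (map_zero _).symm))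

theorem exists_fraction (y : FieldP R) : ∃ (p : GroupAlgP R) (d : D.A), d ≠ 0 ∧
    D.inclK (algebraMap D.A D.K d) * y = algebraMap (GroupAlgP R) (FieldP R) p := by
  obtain ⟨a, c, hc, rfl⟩ := IsFractionRing.div_surjective (GroupAlgP R) y
  obtain ⟨d, hd, r, hr⟩ := D.exists_inclA_multiple (nonZeroDivisors.ne_zero hc)
  have hc' : algebraMap (GroupAlgP R) (FieldP R) c ≠ 0 :=
    IsFractionRing.to_map_ne_zero_of_mem_nonZeroDivisors hc
  refine ⟨r * a, d, hd, ?_⟩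
  rw [inclK_algebraMap, hr, map_mul, map_mul]
  field_simp

/-- `ℂ(P)` is spanned over `ℂ(P^m)` by monomials. -/
theorem fieldP_induction {p : FieldP R → Prop} (add : ∀ x y, p x → p y → p (x + y))
    (mul : ∀ (f : D.K) (v : weightLattice R), p (D.inclK f * xP R v)) (y : FieldP R) : p y := by
  obtain ⟨a, d, hd, h⟩ := D.exists_fraction y
  have hd' := D.inclK_algebraMap_ne_zero hd
  have e : y = D.inclK (algebraMap D.A D.K d)⁻¹ * algebraMap (GroupAlgP R) (FieldP R) a := by
    rw [← h, map_inv₀, inv_mul_cancel_left₀ hd']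
  rw [e]
  clear h e
  induction a using AddMonoidAlgebra.induction_linear with
  | zero =>
    have := mul 0 0
    rw [map_zero, zero_mul] at this
    rwa [map_zero, mul_zero]
  | add x y hx hy => rw [map_add, mul_add]; exact add _ _ hx hy
  | single v c =>
    rw [algebraMap_single, Algebra.smul_def, ← D.inclK_complex, ← mul_assoc, ← map_mul]
    exact mul _ v

end Fractions

section Semilinear

/-- A map `L` on `ℂ(P)` with `L (f y) = (w f) L y` for `f ∈ ℂ(P^m)`. -/
def IsSemilinear (w : R.weylGroup) (L : Module.End ℂ (FieldP R)) : Prop :=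
  ∀ (f : D.K) (y : FieldP R), L (D.inclK f * y) = D.inclK (w • f) * L y

variable {D}

theorem IsSemilinear.mul {w w' : R.weylGroup} {L L' : Module.End ℂ (FieldP R)}
    (h : D.IsSemilinear w L) (h' : D.IsSemilinear w' L') : D.IsSemilinear (w * w') (L * L') := by
  intro f y
  rw [Module.End.mul_apply, Module.End.mul_apply, h', h, mul_smul]

theorem IsSemilinear.one : D.IsSemilinear 1 1 := fun f y => by
  rw [Module.End.one_apply, Module.End.one_apply, one_smul]

theorem IsSemilinear.sub {w : R.weylGroup} {L L' : Module.End ℂ (FieldP R)}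
    (h : D.IsSemilinear w L) (h' : D.IsSemilinear w L') : D.IsSemilinear w (L - L') := by
  intro f y
  rw [LinearMap.sub_apply, LinearMap.sub_apply, h, h', mul_sub]

theorem IsSemilinear.altProd (n : ℕ) {w w' : R.weylGroup} {L L' : Module.End ℂ (FieldP R)}
    (h : D.IsSemilinear w L) (h' : D.IsSemilinear w' L') :
    D.IsSemilinear (altProd n w w') (altProd n L L') := by
  induction n generalizing w w' L L' with
  | zero => exact .one
  | succ n ih => exact h.mul (ih h' h)

variable [Finite ι]

theorem IsSemilinear.ext {w : R.weylGroup} {L L' : Module.End ℂ (FieldP R)}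
    (h : D.IsSemilinear w L) (h' : D.IsSemilinear w L') (hv : ∀ v, L (xP R v) = L' (xP R v)) :
    L = L' := by
  refine LinearMap.ext fun y => ?_
  induction y using D.fieldP_induction with
  | add x y hx hy => rw [map_add, map_add, hx, hy]
  | mul f v => rw [h, h', hv]

variable (D)

/-- Compatibility with translations by P^m is the only condition on the values at monomials for a
semilinear extension to exist. -/
theorem exists_isSemilinear (w : R.weylGroup) (M : weightLattice R → FieldP R)
    (hM : ∀ u v, M (D.inclP u + v) = xP R (w • D.inclP u) * M v) :
    ∃ L : Module.End ℂ (FieldP R), D.IsSemilinear w L ∧ ∀ v, L (xP R v) = M v := by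
  let L0 : GroupAlgP R →ₗ[ℂ] FieldP R :=
    Finsupp.linearCombination ℂ M ∘ₗ (AddMonoidAlgebra.coeffLinearEquiv ℂ).toLinearMap
  have hL0 : ∀ v c, L0 (AddMonoidAlgebra.single v c) = c • M v :=
    fun v c => Finsupp.linearCombination_single ℂ c v
  have hmul : ∀ (d : D.A) (p : GroupAlgP R),
      L0 (D.inclA d * p) = D.inclK (w • algebraMap D.A D.K d) * L0 p := by
    intro d p
    rw [smul_algebraMap, inclK_algebraMap]
    induction d using AddMonoidAlgebra.induction_linear with
    | zero => rw [map_zero, zero_mul, map_zero, smul_zero, map_zero, map_zero, zero_mul]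
    | add x y hx hy => rw [map_add, add_mul, map_add, hx, hy, smul_add, map_add, map_add, add_mul]
    | single u c =>
      induction p using AddMonoidAlgebra.induction_linear with
      | zero => rw [mul_zero, map_zero, mul_zero]
      | add x y hx hy => rw [mul_add, map_add, hx, hy, map_add, mul_add]
      | single v c' =>
        rw [inclA_single, AddMonoidAlgebra.single_mul_single, hL0, hL0, smul_single, inclA_single,
          algebraMap_single, hM, inclP_smul, mul_smul, smul_mul_smul_comm, mul_smul]
  obtain ⟨L, hL, hL'⟩ := exists_semilinear_extension D.inclA (algebraMap D.A D.K)
    (algebraMap (GroupAlgP R) (FieldP R)) D.inclK D.inclK_algebraMap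
    (IsFractionRing.injective D.A D.K) (IsFractionRing.injective (GroupAlgP R) (FieldP R))
    (fun f => by
      obtain ⟨a, c, hc, h⟩ := IsFractionRing.div_surjective D.A f
      exact ⟨a, c, nonZeroDivisors.ne_zero hc, h⟩)
    D.exists_fraction (D.smulHom w) L0.toAddMonoidHom hmul
  refine ⟨{ toFun := L, map_add' := L.map_add, map_smul' := fun c y => ?_ }, hL, fun v => ?_⟩
  · have := hL (algebraMap ℂ D.K c) y
    rw [smulHom_apply, smul_algebraMap_complex, inclK_complex] at this
    rwa [RingHom.id_apply, Algebra.smul_def, Algebra.smul_def]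
  · exact (hL' _).trans ((hL0 v 1).trans (one_smul ℂ _))

end Semilinear
end Datum
end Metaplectic


/-! ### The metaplectic operators on small weights -/

namespace Metaplectic

variable {ι E N : Type*} [NormedAddCommGroup E] [InnerProductSpace ℝ E]
  [AddCommGroup N] [Module ℝ N] {R : RootPairing ι ℝ E N}

namespace Datum

variable [R.IsCrystallographic] (D : Datum R)

section Arithmetic

theorem BZ_eq (v : weightLattice R) (i : ι) : D.BZ v i = D.QZ i * wt R v i := by
  have h := D.BZ_spec v i
  rw [D.B_root, ← D.QZ_spec] at h
  exact_mod_cast h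

theorem BZ_smul (w : R.weylGroup) (v : weightLattice R) (i : ι) :
    D.BZ (w • v) (w • i) = D.BZ v i := by
  rw [BZ, BZ, ← smul_rootP, B, B, ← smul_add, D.Q_weyl, D.Q_weyl, D.Q_weyl]

/-- Dividing n and Q(α) by their gcd leaves m(α) and an integer coprime to it. Through B(λ, α) =
Q(α)(λ, α^∨), periodicity of g modulo n becomes periodicity in (λ, α^∨) modulo m(α). -/
theorem dvd_QZ_mul_iff (i : ι) (z : ℤ) : (D.n : ℤ) ∣ D.QZ i * z ↔ (D.m i : ℤ) ∣ z := by
  have hpos : 0 < Int.gcd D.n (D.QZ i) :=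
    Int.gcd_pos_of_ne_zero_left _ (by exact_mod_cast D.n_pos.ne')
  obtain ⟨s, hs⟩ := Int.gcd_dvd_right (D.n : ℤ) (D.QZ i)
  have hm : (D.n : ℤ) = Int.gcd D.n (D.QZ i) * D.m i := by
    have h : D.m i * Int.gcd D.n (D.QZ i) = D.n :=
      Nat.div_mul_cancel (by exact_mod_cast Int.gcd_dvd_left (D.n : ℤ) (D.QZ i))
    rw [mul_comm]
    exact_mod_cast h.symm
  have hcop : IsCoprime (D.m i : ℤ) s := by
    rw [Int.isCoprime_iff_gcd_eq_one]
    have h := Int.gcd_mul_left (Int.gcd D.n (D.QZ i)) (D.m i) s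
    rw [← hs, ← hm, Int.natAbs_natCast] at h
    exact Nat.eq_of_mul_eq_mul_left hpos (by rw [mul_one]; exact h.symm)
  have hpos' : ((Int.gcd D.n (D.QZ i) : ℕ) : ℤ) ≠ 0 := by exact_mod_cast hpos.ne'
  have e : D.QZ i * z = Int.gcd D.n (D.QZ i) * (s * z) := by
    nth_rw 1 [hs]; rw [mul_assoc]
  rw [e]
  nth_rw 1 [hm]
  rw [mul_dvd_mul_iff_left hpos']
  exact ⟨fun h => hcop.dvd_of_dvd_mul_left h, fun h => Dvd.dvd.mul_left h s⟩

theorem dvd_BZ_iff (v : weightLattice R) (i : ι) :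
    (D.n : ℤ) ∣ D.BZ v i ↔ (D.m i : ℤ) ∣ wt R v i := by
  rw [BZ_eq, dvd_QZ_mul_iff]

variable {D} (G : D.RepParams)

theorem RepParams.g_congr {j j' : ℤ} (h : (D.n : ℤ) ∣ j - j') (y : RootSize) :
    G.g j y = G.g j' y := by
  rw [G.g_emod j, G.g_emod j', Int.emod_eq_emod_iff_emod_sub_eq_zero.2 (Int.emod_eq_zero_of_dvd h)]

theorem RepParams.g_mul_neg (i : ι) {j : ℤ} (hj : ¬ (D.n : ℤ) ∣ j) :
    G.g j (D.size i) * G.g (-j) (D.size i) = (D.k i ^ 2)⁻¹ := by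
  rw [← G.g_mul i j hj, G.g_congr (j := -j) (j' := D.n - j) ⟨-1, by ring⟩]

/-- The coefficient `k_α g_{-B(λ, α)}` of the reflected monomial. -/
def RepParams.coeff (v : weightLattice R) (i : ι) : ℂ :=
  D.k i * G.g (-D.BZ v i) (D.size i)

theorem RepParams.coeff_ne_zero (v : weightLattice R) (i : ι) : G.coeff v i ≠ 0 :=
  mul_ne_zero (D.k_ne_zero i) (G.g_ne_zero _ _)

theorem RepParams.coeff_of_dvd {v : weightLattice R} {i : ι} (h : (D.m i : ℤ) ∣ wt R v i) :
    G.coeff v i = -D.k i := by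
  rw [RepParams.coeff, G.g_eq_neg_one _ _ (by rwa [dvd_neg, dvd_BZ_iff]), mul_neg_one]

theorem RepParams.coeff_add_inclP (u : D.Pm) (v : weightLattice R) (i : ι) :
    G.coeff (D.inclP u + v) i = G.coeff v i := by
  rw [RepParams.coeff, RepParams.coeff]
  congr 1
  apply G.g_congr
  have : -D.BZ (D.inclP u + v) i - -D.BZ v i = -D.BZ (D.inclP u) i := by
    rw [BZ_eq, BZ_eq, BZ_eq, wt_add]; ring
  rw [this, dvd_neg, dvd_BZ_iff]
  exact D.dvd_wt_inclP u i

omit [R.IsCrystallographic] in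
theorem norm_smul_eq
    (hR : ∀ (i : ι) (v : E), R.coroot' i v = 2 * inner ℝ v (R.root i) / ‖R.root i‖ ^ 2)
    (w : R.weylGroup) (v : E) : ‖w • v‖ = ‖v‖ := by
  refine weyl_stable R (fun u => ‖u‖ = ‖v‖) ?_ w v rfl
  intro i u hu
  rw [← hu, R.reflection_apply]
  have h0 : ‖R.root i‖ ≠ 0 := norm_ne_zero_iff.2 (R.ne_zero i)
  have h := hR i u
  rw [eq_div_iff (pow_ne_zero 2 h0)] at h
  refine (sq_eq_sq₀ (norm_nonneg _) (norm_nonneg _)).1 ?_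
  change ‖u - R.coroot' i u • R.root i‖ ^ 2 = _
  rw [norm_sub_sq_real, inner_smul_right, norm_smul, mul_pow, Real.norm_eq_abs, sq_abs]
  linear_combination (R.coroot' i u) * h

theorem size_smul
    (hR : ∀ (i : ι) (v : E), R.coroot' i v = 2 * inner ℝ v (R.root i) / ‖R.root i‖ ^ 2)
    (w : R.weylGroup) (i : ι) : D.size (w • i) = D.size i := by
  rw [size, size, D.m_weyl, root_smul, ← weyl_smul_real, norm_smul_eq hR]

-- Pairings with coroots are not linear in the root, but inner products are. This lets dominance for
-- two simple roots pass to nonnegative combinations of them.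
omit [R.IsCrystallographic] in
theorem wt_nonneg_iff
    (hR : ∀ (i : ι) (v : E), R.coroot' i v = 2 * inner ℝ v (R.root i) / ‖R.root i‖ ^ 2)
    (v : weightLattice R) (i : ι) : 0 ≤ wt R v i ↔ 0 ≤ inner ℝ (v : E) (R.root i) := by
  have h0 : 0 < ‖R.root i‖ := norm_pos_iff.2 (R.ne_zero i)
  rw [← Int.cast_nonneg_iff (R := ℝ), wt_spec, hR, le_div_iff₀ (by positivity), zero_mul]
  constructor <;> intro h <;> linarith

theorem RepParams.coeff_smul
    (hR : ∀ (i : ι) (v : E), R.coroot' i v = 2 * inner ℝ v (R.root i) / ‖R.root i‖ ^ 2)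
    (w : R.weylGroup) (v : weightLattice R) (i : ι) :
    G.coeff (w • v) (w • i) = G.coeff v i := by
  rw [RepParams.coeff, RepParams.coeff, BZ_smul, D.k_weyl, size_smul hR]

/-- The scalar by which the Demazure-Lusztig operator moves a small dominant monomial. -/
def RepParams.smallCoeff (v : weightLattice R) (i : ι) : ℂ :=
  if wt R v i = D.m i then (D.k i)⁻¹ else -G.coeff v i

theorem RepParams.smallCoeff_smul
    (hR : ∀ (i : ι) (v : E), R.coroot' i v = 2 * inner ℝ v (R.root i) / ‖R.root i‖ ^ 2)
    (w : R.weylGroup) (v : weightLattice R) (i : ι) :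
    G.smallCoeff (w • v) (w • i) = G.smallCoeff v i := by
  rw [RepParams.smallCoeff, RepParams.smallCoeff, wt_smul, D.m_weyl, D.k_weyl, G.coeff_smul hR]

/-- At (v, α^∨) = m(α) the two scalars are k⁻¹ and k. Strictly below, the index is not divisible by
n and changes sign under the reflection, so g_j g_{-j} = k⁻² applies. The product 1 is what the
quadratic relation requires. -/
theorem RepParams.smallCoeff_mul {v : weightLattice R} {i : ι} (h0 : 0 < wt R v i)
    (h1 : wt R v i ≤ D.m i) :
    G.smallCoeff v i * G.smallCoeff (refl R i • v) i = 1 := by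
  have hk := D.k_ne_zero i
  have hm : (0 : ℤ) < D.m i := by exact_mod_cast D.m_pos i
  have hne : wt R (refl R i • v) i ≠ D.m i := by rw [wt_refl_smul_self]; omega
  rw [RepParams.smallCoeff, RepParams.smallCoeff, if_neg hne]
  split_ifs with h
  · rw [G.coeff_of_dvd (by rw [wt_refl_smul_self, h, dvd_neg]), neg_neg, inv_mul_cancel₀ hk]
  · have hnd : ¬ (D.n : ℤ) ∣ -D.BZ v i := by
      rw [dvd_neg, dvd_BZ_iff]
      intro hd
      have := Int.le_of_dvd h0 hd
      omega
    have e : D.BZ (refl R i • v) i = -D.BZ v i := by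
      rw [BZ_eq, BZ_eq, wt_refl_smul_self]; ring
    rw [RepParams.coeff, RepParams.coeff, e, neg_mul_neg]
    have := G.g_mul_neg i hnd
    rw [mul_mul_mul_comm, this]
    field_simp

end Arithmetic

section Operators

variable {D} [Finite ι] (G : D.RepParams)

/-- The formula is a_i⁻¹ (T_i - b_i) x^v with T_i acting as π prescribes; the integer quotient of
(v, α_i^∨) by m(α_i) is (q(v), α_i^{m∨}). Translation by P^m shifts this quotient by an integer and
does not change g, which gives semilinearity. -/
theorem exists_weylOp (i : ι) : ∃ L : Module.End ℂ (FieldP R), D.IsSemilinear (refl R i) L ∧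
    ∀ v, L (xP R v) = -(D.inclK (D.dlA i))⁻¹ *
      (D.inclK (D.dlB i) * xP R (v - (wt R v i / (D.m i : ℤ)) • D.rootmP i) +
        algebraMap ℂ (FieldP R) (G.coeff v i) * xP R (refl R i • v)) := by
  refine D.exists_isSemilinear _ _ fun u v => ?_
  obtain ⟨z, hz⟩ := D.dvd_wt_inclP u i
  have hm : (D.m i : ℤ) ≠ 0 := by exact_mod_cast (D.m_pos i).ne'
  have e1 : D.inclP u + v - (wt R (D.inclP u + v) i / (D.m i : ℤ)) • D.rootmP i =
      refl R i • D.inclP u + (v - (wt R v i / (D.m i : ℤ)) • D.rootmP i) := by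
    rw [refl_smul_weight i (D.inclP u), wt_add, hz, Int.mul_add_ediv_left _ _ hm, rootmP_eq]
    module
  rw [e1, G.coeff_add_inclP, smul_add, xP_add, xP_add]
  ring

/-- The operator on `ℂ(P)` representing a reflection. -/
def RepParams.weylOp (i : ι) : Module.End ℂ (FieldP R) := (exists_weylOp G i).choose

theorem RepParams.weylOp_semilinear (i : ι) : D.IsSemilinear (refl R i) (G.weylOp i) :=
  (exists_weylOp G i).choose_spec.1

theorem RepParams.weylOp_xP (i : ι) (v : weightLattice R) :
    G.weylOp i (xP R v) = -(D.inclK (D.dlA i))⁻¹ *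
      (D.inclK (D.dlB i) * xP R (v - (wt R v i / (D.m i : ℤ)) • D.rootmP i) +
        algebraMap ℂ (FieldP R) (G.coeff v i) * xP R (refl R i • v)) :=
  (exists_weylOp G i).choose_spec.2 v

variable (D)

/-- Multiplication by elements of `ℂ(P^m)` on `ℂ(P)`. -/
def mulK : D.K →+* Module.End ℂ (FieldP R) :=
  (Algebra.lmul ℂ (FieldP R)).toRingHom.comp D.inclK

omit [Finite ι] in
theorem mulK_apply (f : D.K) (y : FieldP R) : D.mulK f y = D.inclK f * y := rfl

variable {D}

omit [Finite ι] in
theorem IsSemilinear.mul_mulK {w : R.weylGroup} {L : Module.End ℂ (FieldP R)}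
    (h : D.IsSemilinear w L) (f : D.K) : L * D.mulK f = D.mulK (w • f) * L :=
  LinearMap.ext fun y => h f y

theorem IsSemilinear.ext_isSmall {w : R.weylGroup} {L L' : Module.End ℂ (FieldP R)}
    (h : D.IsSemilinear w L) (h' : D.IsSemilinear w L')
    (hv : ∀ v, D.IsSmall v → L (xP R v) = L' (xP R v)) : L = L' := by
  refine h.ext h' fun v => ?_
  obtain ⟨u, hu⟩ := D.exists_isSmall_add v
  have e : xP R v = D.inclK (D.xK (-u)) * xP R (v + D.inclP u) := by
    rw [inclK_xK, ← xP_add, map_neg]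
    congr 1; abel
  rw [e, h, h', hv _ hu]

/-- The Demazure-Lusztig operators on `ℂ(P)`. -/
def RepParams.dlOp (i : ι) : Module.End ℂ (FieldP R) := D.dlT D.mulK i (G.weylOp i)

theorem RepParams.dlOp_xP (i : ι) (v : weightLattice R) :
    G.dlOp i (xP R v) =
      D.inclK (D.dlB i) * (xP R v - xP R (v - (wt R v i / (D.m i : ℤ)) • D.rootmP i)) -
        G.coeff v i • xP R (refl R i • v) := by
  have h : D.inclK (D.dlA i) ≠ 0 := (map_ne_zero _).2 (D.dlA_ne_zero i)
  rw [RepParams.dlOp, dlT, LinearMap.add_apply, Module.End.mul_apply, mulK_apply, mulK_apply,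
    G.weylOp_xP, neg_mul, mul_neg, mul_inv_cancel_left₀ h, Algebra.smul_def]
  ring

omit [Finite ι] in
theorem inclK_dlB_mul (i : ι) : D.inclK (D.dlB i) * (1 - xP R (D.rootmP i)) =
    algebraMap ℂ (FieldP R) (D.k i - (D.k i)⁻¹) := by
  have h := D.one_sub_xK_ne i
  have e : (1 : FieldP R) - xP R (D.rootmP i) = D.inclK (1 - D.xK (D.rootm i)) := by
    rw [map_sub, map_one, inclK_xK, inclP_rootm]
  rw [e, ← map_mul, dlB, div_mul_cancel₀ _ h, map_sub, map_inv₀, inclK_kK, map_sub, map_inv₀]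

omit [Finite ι] in
theorem refl_smul_eq_of_wt {v : weightLattice R} {i : ι} {z : ℤ} (h : wt R v i = D.m i * z) :
    refl R i • v = v - z • D.rootmP i := by
  rw [refl_smul_weight, h, rootmP_eq, smul_smul, mul_comm]

/-- The integer quotient is 0 or 1. If it is 0, the divided difference vanishes. If it is 1, then
s_i v = v - α_i^m and both terms are multiples of that monomial, with total -(k - k⁻¹) + k = k⁻¹. -/
theorem RepParams.dlOp_of_nonneg {v : weightLattice R} {i : ι} (h0 : 0 ≤ wt R v i)
    (h1 : wt R v i ≤ D.m i) :
    G.dlOp i (xP R v) = G.smallCoeff v i • xP R (refl R i • v) := by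
  have hm : (0 : ℤ) < D.m i := by exact_mod_cast D.m_pos i
  rw [G.dlOp_xP, RepParams.smallCoeff]
  split_ifs with h
  · rw [h, Int.ediv_self hm.ne', one_smul, G.coeff_of_dvd (by rw [h])]
    have e : refl R i • v = v - D.rootmP i := by
      rw [refl_smul_eq_of_wt (z := 1) (by rw [h, mul_one]), one_smul]
    have e2 : xP R v = xP R (D.rootmP i) * xP R (v - D.rootmP i) := by
      rw [← xP_add]; congr 1; abel
    have h2 := D.inclK_dlB_mul i
    rw [map_sub] at h2
    rw [e, e2, Algebra.smul_def, Algebra.smul_def, map_neg]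
    linear_combination (-xP R (v - D.rootmP i)) * h2
  · rw [Int.ediv_eq_zero_of_lt h0 (by omega), zero_smul, sub_zero, sub_self, mul_zero, zero_sub,
      neg_smul]

/-- The integer quotient is -1 on the whole range, endpoint included, so the divided difference is
the scalar k - k⁻¹. -/
theorem RepParams.dlOp_of_neg {v : weightLattice R} {i : ι} (h0 : wt R v i < 0)
    (h1 : -(D.m i : ℤ) ≤ wt R v i) :
    G.dlOp i (xP R v) = (D.k i - (D.k i)⁻¹) • xP R v +
      G.smallCoeff v i • xP R (refl R i • v) := by
  have hm : (0 : ℤ) < D.m i := by exact_mod_cast D.m_pos i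
  have h2 : wt R v i / (D.m i : ℤ) = -1 := by
    rw [Int.ediv_eq_iff_of_pos hm]
    constructor <;> linarith
  rw [G.dlOp_xP, RepParams.smallCoeff, if_neg (by omega), h2, neg_smul, one_smul, sub_neg_eq_add,
    xP_add, neg_smul, sub_eq_add_neg]
  congr 1
  rw [Algebra.smul_def, ← D.inclK_dlB_mul i]
  ring

theorem RepParams.dlOp_dlOp_of_isSmall {v : weightLattice R} (hv : D.IsSmall v) (i : ι) :
    G.dlOp i (G.dlOp i (xP R v)) =
      (D.k i - (D.k i)⁻¹) • G.dlOp i (xP R v) + xP R v := by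
  have hk := D.k_ne_zero i
  have hm : (0 : ℤ) < D.m i := by exact_mod_cast D.m_pos i
  obtain ⟨h1, h2⟩ := abs_le.1 (hv i)
  have hs : refl R i • refl R i • v = v := refl_refl_smul (R := R) i v
  have hw : wt R (refl R i • v) i = -wt R v i := wt_refl_smul_self i v
  rcases lt_trichotomy (wt R v i) 0 with h | h | h
  · rw [G.dlOp_of_neg h h1, map_add, map_smul, map_smul, G.dlOp_of_neg h h1,
      G.dlOp_of_nonneg (v := refl R i • v) (by omega) (by omega), hs, smul_smul (G.smallCoeff v i),
      ← hs, mul_comm (G.smallCoeff _ i), hs]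
    have := G.smallCoeff_mul (v := refl R i • v) (i := i) (by omega) (by omega)
    rw [hs] at this
    rw [this, one_smul]
  · have e : refl R i • v = v := by rw [refl_smul_weight, h, zero_smul, sub_zero]
    have e2 : G.smallCoeff v i = D.k i := by
      rw [RepParams.smallCoeff, if_neg (by omega), G.coeff_of_dvd (by rw [h]; exact dvd_zero _),
        neg_neg]
    rw [G.dlOp_of_nonneg h.ge h2, e, e2, map_smul, G.dlOp_of_nonneg h.ge h2, e, e2, smul_smul,
      smul_smul]
    nth_rw 3 [← one_smul ℂ (xP R v)]
    rw [← add_smul]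
    congr 1
    field_simp
    ring
  · rw [G.dlOp_of_nonneg h.le h2, map_smul, G.dlOp_of_neg (v := refl R i • v) (by omega) (by omega),
      hs, smul_add, smul_smul, smul_smul, smul_smul, G.smallCoeff_mul h h2, one_smul, mul_comm]

/-- The square is ℂ(P^m)-linear, so small monomials suffice. On them the quadratic relation for T_i
holds, and `dlT_quadratic` turns it into A² = 1. -/
theorem RepParams.weylOp_mul_self (i : ι) : G.weylOp i * G.weylOp i = 1 := by
  have hs := G.weylOp_semilinear i
  have h1 : D.IsSemilinear 1 (G.weylOp i * G.weylOp i) := by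
    have := hs.mul hs
    rwa [refl_mul_self] at this
  refine h1.ext_isSmall .one fun v hv => ?_
  have h2 := D.dlT_quadratic D.mulK hs.mul_mulK
  have h3 := congrArg (fun L : Module.End ℂ (FieldP R) => L (xP R v)) h2
  simp only [LinearMap.sub_apply, Module.End.mul_apply, Module.End.one_apply, mulK_apply] at h3
  have h4 := G.dlOp_dlOp_of_isSmall hv i
  simp only [RepParams.dlOp] at h4
  have e : D.inclK (D.kK i - (D.kK i)⁻¹) = algebraMap ℂ (FieldP R) (D.k i - (D.k i)⁻¹) := by
    rw [map_sub, map_inv₀, inclK_kK, map_sub, map_inv₀]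
  rw [h4, e, Algebra.smul_def, add_sub_cancel_left, sub_self, zero_eq_mul] at h3
  have h5 : D.inclK (D.dlA i * refl R i • D.dlA i) ≠ 0 := by
    rw [map_ne_zero]
    exact mul_ne_zero (D.dlA_ne_zero i) (D.smul_dlA_ne_zero _ i)
  exact sub_eq_zero.1 (h3.resolve_left h5)

end Operators
end Datum
end Metaplectic


/-! ### Braid relations for the operators on ℂ(P) -/

namespace Metaplectic

section AltWord

variable {M : Type*} [Monoid M]

/-- The alternating product `⋯ b a b a` with `n` factors and last factor `a`. -/
def altWord : ℕ → M → M → M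
  | 0, _, _ => 1
  | n + 1, a, b => altWord n b a * a

theorem altWord_succ (n : ℕ) (a b : M) :
    altWord (n + 1) a b = (if Even n then a else b) * altWord n a b := by
  induction n generalizing a b with
  | zero => simp [altWord]
  | succ n ih =>
    rw [altWord, ih, mul_assoc, altWord]
    congr 1
    by_cases h : Even n <;> simp [h, Nat.even_add_one]

/-- Operators act from the right, so it is convenient to fix the last letter of a word and add
letters on the left. -/
theorem altProd_eq_altWord (n : ℕ) (a b : M) :
    altProd n a b = if Even n then altWord n b a else altWord n a b := by
  induction n generalizing a b with
  | zero => simp [altProd, altWord]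
  | succ n ih =>
    rw [altProd, ih, altWord_succ, altWord_succ]
    by_cases h : Even n <;> simp [h, Nat.even_add_one]

theorem altProd_eq_iff (n : ℕ) (a b : M) :
    altProd n a b = altProd n b a ↔ altWord n a b = altWord n b a := by
  rw [altProd_eq_altWord, altProd_eq_altWord]
  split_ifs
  · exact eq_comm
  · rfl

/-- The difference of the two alternating words anticommutes with the letters. -/
theorem altWord_sub_mul {Z : Type*} [Ring Z] {A B : Z} (hA : A * A = 1) (hB : B * B = 1) (m : ℕ) :
    (altWord (m + 1) A B - altWord (m + 1) B A) * A =
      -(if Even (m + 1) then A else B) * (altWord (m + 1) A B - altWord (m + 1) B A) := by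
  set c := if Even (m + 1) then A else B with hc
  have hcc : c * c = 1 := by rw [hc]; split_ifs <;> assumption
  have h1 : altWord (m + 1) A B * A = altWord m B A := by
    rw [altWord, mul_assoc, hA, mul_one]
  have h2 : altWord (m + 1) B A * A = c * altWord (m + 1) A B := altWord_succ (m + 1) A B
  have h3 : altWord (m + 1) B A = c * altWord m B A := by
    rw [altWord_succ, hc]
    by_cases h : Even m <;> simp [h, Nat.even_add_one]
  rw [sub_mul, h1, h2, neg_mul, mul_sub, h3, ← mul_assoc c c, hcc, one_mul, neg_sub]

theorem altWord_sub_mul' {Z : Type*} [Ring Z] {A B : Z} (hA : A * A = 1) (hB : B * B = 1)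
    (m : ℕ) : (altWord (m + 1) A B - altWord (m + 1) B A) * B =
      -(if Even (m + 1) then B else A) * (altWord (m + 1) A B - altWord (m + 1) B A) := by
  have h := altWord_sub_mul hB hA m
  rwa [← neg_sub (altWord (m + 1) A B), neg_mul, mul_neg, neg_inj] at h

end AltWord

variable {ι E N : Type*} [NormedAddCommGroup E] [InnerProductSpace ℝ E]
  [AddCommGroup N] [Module ℝ N] {R : RootPairing ι ℝ E N}

/-- Pairing the weight moved by n letters with the next simple coroot amounts to pairing the
original weight with the coroot of the n-th root of the chain. -/
theorem altWord_inv_smul (n : ℕ) (i j : ι) :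
    (altWord n (refl R i) (refl R j))⁻¹ • (if Even n then i else j) = altRoot R n i j := by
  induction n generalizing i j with
  | zero => simp [altWord, altRoot]
  | succ n ih =>
    rw [altWord, mul_inv_rev, refl_inv, mul_smul, altRoot, ← ih j i]
    by_cases h : Even n <;> simp [h, Nat.even_add_one]

/-- The number of positive roots on which a weight is negative. -/
def negCount (b : R.Base) (v : weightLattice R) : ℕ := {l | b.IsPos l ∧ wt R v l < 0}.ncard

variable [R.IsCrystallographic]

theorem negCount_refl_smul_lt [Finite ι] [R.IsReduced] (b : R.Base) {i : ι} (hi : i ∈ b.support)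
    {v : weightLattice R} (h : wt R v i < 0) : negCount b (refl R i • v) < negCount b v := by
  have hpi : b.IsPos i := RootPairing.Base.isPos_of_mem_support hi
  have himg : (refl R i • · : ι → ι) '' {l | b.IsPos l ∧ wt R (refl R i • v) l < 0} ⊂
      {l | b.IsPos l ∧ wt R v l < 0} := by
    refine (Set.ssubset_iff_of_subset ?_).2 ⟨i, ⟨hpi, h⟩, ?_⟩
    · rintro _ ⟨l, ⟨hl, hl'⟩, rfl⟩
      have hli : l ≠ i := by
        rintro rfl
        rw [wt_refl_smul_self] at hl'
        omega
      exact ⟨hl.reflectionPerm hi hli, by rwa [wt_refl_smul_left] at hl'⟩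
    · rintro ⟨l, ⟨hl, -⟩, e⟩
      have e2 : l = refl R i • i :=
        (refl_refl_smul (R := R) i l).symm.trans (congrArg (refl R i • ·) e)
      have := height_refl_self b i
      rw [← e2] at this
      rw [RootPairing.Base.isPos_iff] at hl hpi
      omega
  rw [negCount, negCount, ← Set.ncard_image_of_injective _ (MulAction.injective (refl R i))]
  exact Set.ncard_lt_ncard himg

namespace Datum

variable {D : Datum R} [Finite ι] (G : D.RepParams)
  (hR : ∀ (i : ι) (v : E), R.coroot' i v = 2 * inner ℝ v (R.root i) / ‖R.root i‖ ^ 2)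

omit [Finite ι] [R.IsCrystallographic] in
include hR in
theorem wt_altRoot_nonneg {i j : ι} {p q : ℤ} {m : ℕ} (h : IsRankTwo p q m)
    (hp : R.coroot' i (R.root j) = -p) (hq : R.coroot' j (R.root i) = -q) {k : ℕ} (hk : k < m)
    {v : weightLattice R} (hi : 0 ≤ wt R v i) (hj : 0 ≤ wt R v j) :
    0 ≤ wt R v (altRoot R k i j) := by
  rw [wt_nonneg_iff hR] at *
  obtain ⟨h1, h2⟩ := altCoeff_nonneg h hk
  rw [root_altRoot hp hq, ← Int.cast_smul_eq_zsmul ℝ, ← Int.cast_smul_eq_zsmul ℝ, inner_add_right,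
    inner_smul_right, inner_smul_right]
  exact add_nonneg (mul_nonneg (by exact_mod_cast h1) hi) (mul_nonneg (by exact_mod_cast h2) hj)

-- Before each letter, the current weight pairs with the next simple coroot as v does with a
-- positive root of the subsystem, hence nonnegatively. So every letter merely reflects the
-- monomial, and by W-invariance its scalar depends only on v and that root.
include hR in
theorem RepParams.altWord_dlOp_xP {i j : ι} {p q : ℤ} {m : ℕ} (h : IsRankTwo p q m)
    (hp : R.coroot' i (R.root j) = -p) (hq : R.coroot' j (R.root i) = -q)
    {v : weightLattice R} (hv : D.IsSmall v) (hi : 0 ≤ wt R v i) (hj : 0 ≤ wt R v j)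
    {n : ℕ} (hn : n ≤ m) :
    altWord n (G.dlOp i) (G.dlOp j) (xP R v) =
      (∏ k ∈ Finset.range n, G.smallCoeff v (altRoot R k i j)) •
        xP R (altWord n (refl R i) (refl R j) • v) := by
  induction n with
  | zero => simp [altWord]
  | succ n ih =>
    set w := altWord n (refl R i) (refl R j) with hw
    set c := if Even n then i else j with hc
    have e1 : (if Even n then G.dlOp i else G.dlOp j) = G.dlOp c := by rw [hc]; split_ifs <;> rfl
    have e2 : (if Even n then refl R i else refl R j) = refl R c := by rw [hc]; split_ifs <;> rfl
    have e3 : w⁻¹ • c = altRoot R n i j := altWord_inv_smul n i j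
    have e4 : wt R (w • v) c = wt R v (altRoot R n i j) := by rw [wt_smul_left, e3]
    have e5 : G.smallCoeff (w • v) c = G.smallCoeff v (altRoot R n i j) := by
      have := G.smallCoeff_smul hR w v (w⁻¹ • c)
      rw [smul_inv_smul] at this
      rw [this, e3]
    rw [altWord_succ, altWord_succ, e1, e2, Module.End.mul_apply, ih (by omega), map_smul,
      G.dlOp_of_nonneg (e4 ▸ wt_altRoot_nonneg hR h hp hq (by omega) hi hj)
        ((abs_le.1 (hv.smul D w c)).2), e5, smul_smul, Finset.prod_range_succ, ← mul_smul]

variable (b : R.Base) [R.IsReduced]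

-- Both Hecke words send x^v to the same monomial, with the same scalars multiplied in opposite
-- orders. The nonzero factor C then transfers the equality to the involutions.
omit [R.IsReduced] in
include hR in
theorem RepParams.altProd_weylOp_dominant {i j : b.support} (hij : i ≠ j) {v : weightLattice R}
    (hv : D.IsSmall v) (hi : 0 ≤ wt R v i) (hj : 0 ≤ wt R v j) :
    altProd (orderOf (refl R (i : ι) * refl R (j : ι))) (G.weylOp i) (G.weylOp j) (xP R v) =
      altProd (orderOf (refl R (i : ι) * refl R (j : ι))) (G.weylOp j) (G.weylOp i)
        (xP R v) := by
  have hij' : (i : ι) ≠ j := fun h => hij (Subtype.ext h)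
  obtain ⟨C, hC, hCe⟩ := D.dlT_braid b hij D.mulK (G.weylOp_semilinear i).mul_mulK
    (G.weylOp_semilinear j).mul_mulK (G.weylOp_mul_self i) (G.weylOp_mul_self j)
  obtain ⟨p, q, hm, hp, hq⟩ := exists_isRankTwo b i.2 j.2 hij'
  have hrefl := altProd_refl hm hp hq
  generalize orderOf (refl R (i : ι) * refl R (j : ι)) = m at *
  rw [altProd_eq_iff] at hrefl
  have hword : altWord m (G.dlOp i) (G.dlOp j) (xP R v) =
      altWord m (G.dlOp j) (G.dlOp i) (xP R v) := by
    rw [G.altWord_dlOp_xP hR hm hp hq hv hi hj le_rfl,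
      G.altWord_dlOp_xP hR hm.symm hq hp hv hj hi le_rfl, hrefl, ← Finset.prod_range_reflect]
    congr 1
    exact Finset.prod_congr rfl fun k hk => by
      rw [← altRoot_symm hm.symm hq hp (k := k) (Finset.mem_range.1 hk)]
  have hT : altProd m (G.dlOp i) (G.dlOp j) (xP R v) =
      altProd m (G.dlOp j) (G.dlOp i) (xP R v) := by
    rw [altProd_eq_altWord, altProd_eq_altWord]
    split_ifs
    · exact hword.symm
    · exact hword
  have h2 := congrArg (fun L : Module.End ℂ (FieldP R) => L (xP R v)) hCe
  simp only [LinearMap.sub_apply, Module.End.mul_apply, mulK_apply] at h2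
  simp only [RepParams.dlOp] at hT
  rw [hT, sub_self, zero_eq_mul, map_eq_zero] at h2
  exact sub_eq_zero.1 (h2.resolve_left hC)

/-- If V kills x^v, the relation with U makes it kill A_l x^v. That vector is a ℂ(P^m)-combination
of x^v and x^{s_l v} in which the latter has a nonzero coefficient, so V kills x^{s_l v}. Reflecting
in i or j thus reaches every small weight from a dominant one. -/
theorem RepParams.eq_of_eq_dominant {i j : b.support} {V : Module.End ℂ (FieldP R)}
    {w : R.weylGroup} (hV : D.IsSemilinear w V)
    {U U' : Module.End ℂ (FieldP R)} (hi : V * G.weylOp i = U * V) (hj : V * G.weylOp j = U' * V)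
    (h : ∀ v, D.IsSmall v → 0 ≤ wt R v i → 0 ≤ wt R v j → V (xP R v) = 0)
    (v : weightLattice R) (hv : D.IsSmall v) : V (xP R v) = 0 := by
  have step : ∀ (l : ι) (U : Module.End ℂ (FieldP R)), V * G.weylOp l = U * V →
      ∀ v, V (xP R v) = 0 → V (xP R (refl R l • v)) = 0 := by
    intro l U hU v hv
    have h1 := congrArg (fun L : Module.End ℂ (FieldP R) => L (xP R v)) hU
    simp only [Module.End.mul_apply] at h1
    rw [hv, map_zero, G.weylOp_xP, sub_eq_add_neg v, ← neg_smul, xP_add, ← inclP_rootm,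
      ← map_zsmul, ← inclK_xK, ← map_inv₀, ← map_neg, hV, map_add, ← mul_assoc, ← inclK_complex,
      hV, mul_right_comm, ← map_mul, hV, hv, mul_zero, zero_add, mul_eq_zero,
      mul_eq_zero] at h1
    have h2 : D.inclK (w • -(D.dlA l)⁻¹) ≠ 0 := by
      rw [map_ne_zero]
      exact (map_ne_zero (D.smulHom w)).2 (neg_ne_zero.2 (inv_ne_zero (D.dlA_ne_zero l)))
    have h3 : D.inclK (w • algebraMap ℂ D.K (G.coeff v l)) ≠ 0 := by
      rw [map_ne_zero, smul_algebraMap_complex, map_ne_zero]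
      exact G.coeff_ne_zero v l
    exact (h1.resolve_left h2).resolve_left h3
  induction hn : negCount b v using Nat.strong_induction_on generalizing v with
  | _ n ih =>
  rcases lt_or_ge (wt R v i) 0 with h1 | h1
  · have := ih _ (hn ▸ negCount_refl_smul_lt b i.2 h1) _ (hv.smul D _) rfl
    have := step i U hi _ this
    rwa [refl_refl_smul] at this
  rcases lt_or_ge (wt R v j) 0 with h2 | h2
  · have := ih _ (hn ▸ negCount_refl_smul_lt b j.2 h2) _ (hv.smul D _) rfl
    have := step j U' hj _ this
    rwa [refl_refl_smul] at this
  exact h v hv h1 h2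

include hR in
theorem RepParams.braidRel_weylOp : BraidRel b (fun i : b.support => G.weylOp i) := by
  intro i j hij
  have hij' : (i : ι) ≠ j := fun h => hij (Subtype.ext h)
  obtain ⟨p, q, hm, hp, hq⟩ := exists_isRankTwo b i.2 j.2 hij'
  have hdom := fun v hv hi hj => G.altProd_weylOp_dominant hR b hij (v := v) hv hi hj
  have hi := G.weylOp_semilinear (i : ι)
  have hj := G.weylOp_semilinear (j : ι)
  have hrefl := altProd_refl hm hp hq
  change altProd _ (G.weylOp i) (G.weylOp j) = altProd _ (G.weylOp j) (G.weylOp i)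
  generalize orderOf (refl R (i : ι) * refl R (j : ι)) = m at *
  obtain ⟨m, rfl⟩ : ∃ k, m = k + 1 := by
    refine Nat.exists_eq_succ_of_ne_zero ?_
    rcases hm with h | h | h | h | h | h <;> simp [h]
  -- The braid defect anticommutes with the letters up to exchanging them, which is the relation
  -- that `RepParams.eq_of_eq_dominant` needs.
  have hVi := altWord_sub_mul (G.weylOp_mul_self i) (G.weylOp_mul_self j) m
  have hVj := altWord_sub_mul' (G.weylOp_mul_self i) (G.weylOp_mul_self j) m
  have hV : ∀ v, D.IsSmall v → 0 ≤ wt R v i → 0 ≤ wt R v j →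
      (altWord (m + 1) (G.weylOp i) (G.weylOp j) - altWord (m + 1) (G.weylOp j) (G.weylOp i))
        (xP R v) = 0 := by
    intro v hv h1 h2
    have h3 := hdom v hv h1 h2
    rw [altProd_eq_altWord, altProd_eq_altWord] at h3
    rw [LinearMap.sub_apply, sub_eq_zero]
    split_ifs at h3
    · exact h3.symm
    · exact h3
  have hsemi : D.IsSemilinear (altProd (m + 1) (refl R (i : ι)) (refl R (j : ι)))
      (altWord (m + 1) (G.weylOp i) (G.weylOp j) - altWord (m + 1) (G.weylOp j) (G.weylOp i)) := by
    have h1 := hi.altProd (m + 1) hj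
    have h2 := hj.altProd (m + 1) hi
    rw [← hrefl] at h2
    rw [altProd_eq_altWord _ (G.weylOp i)] at h1
    rw [altProd_eq_altWord _ (G.weylOp j)] at h2
    split_ifs at h1 h2
    · exact h2.sub h1
    · exact h1.sub h2
  rw [altProd_eq_iff, ← sub_eq_zero]
  refine hsemi.ext_isSmall (fun f y => ?_) fun v hv => ?_
  · simp
  · rw [LinearMap.zero_apply]
    exact G.eq_of_eq_dominant b hsemi hVi hVj hV v hv

/-- The action of the semidirect product algebra on `ℂ(P)`. -/
theorem RepParams.exists_rep (hR : ∀ (i : ι) (v : E),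
      R.coroot' i v = 2 * inner ℝ v (R.root i) / ‖R.root i‖ ^ 2) :
    ∃ r : D.WK →+* Module.End ℂ (FieldP R), (∀ f, r (D.ofK f) = D.mulK f) ∧
      ∀ i : b.support, r (D.ofW (refl R (i : ι))) = G.weylOp i := by
  obtain ⟨g, hg⟩ := exists_weylGroup_lift b (fun i => G.weylOp_mul_self (i : ι))
    (G.braidRel_weylOp hR b)
  have hcomm : ∀ {x : D.K} {y : R.weylGroup}, D.mulK (y • x) * g y = g y * D.mulK x := by
    intro x y
    induction y using weylGroup_induction_simple b generalizing x with
    | one => simp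
    | mul i hi w ih =>
      rw [map_mul, mul_smul, ← mul_assoc, hg ⟨i, hi⟩, ← (G.weylOp_semilinear i).mul_mulK, mul_assoc,
        ih, mul_assoc]
  refine ⟨SkewMonoidAlgebra.liftNCRingHom D.mulK g hcomm, fun f => ?_, fun i => ?_⟩
  · exact (SkewMonoidAlgebra.liftNC_single _ _ _ _).trans (by simp)
  · exact (SkewMonoidAlgebra.liftNC_single _ _ _ _).trans (by simp [hg i])

end Datum
end Metaplectic


/-! ### The Hecke algebra, the semidirect product and the localization isomorphism -/

namespace Metaplectic

variable {ι E N : Type*} [NormedAddCommGroup E] [InnerProductSpace ℝ E]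
  [AddCommGroup N] [Module ℝ N] {R : RootPairing ι ℝ E N}

theorem map_altProd {M M' : Type*} [Monoid M] [Monoid M'] (f : M →* M') (n : ℕ) (a b : M) :
    f (altProd n a b) = altProd n (f a) (f b) := by
  induction n generalizing a b with
  | zero => exact map_one f
  | succ n ih => rw [altProd, altProd, map_mul, ih]

theorem one_sub_single_dvd {L : Type*} [AddCommGroup L] (u : L) (z : ℤ) :
    (1 - AddMonoidAlgebra.single u 1 : AddMonoidAlgebra ℂ L) ∣
      1 - AddMonoidAlgebra.single (z • u) 1 := by
  have hdvd : ∀ n : ℕ, (1 - AddMonoidAlgebra.single u 1 : AddMonoidAlgebra ℂ L) ∣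
      1 - AddMonoidAlgebra.single (n • u) 1 := by
    intro n
    have := sub_dvd_pow_sub_pow 1 (AddMonoidAlgebra.single u 1 : AddMonoidAlgebra ℂ L) n
    rwa [one_pow, AddMonoidAlgebra.single_pow, one_pow] at this
  obtain ⟨n, hn | hn⟩ := Int.eq_nat_or_neg z
  · rw [hn, natCast_zsmul]
    exact hdvd n
  · have e : (1 - AddMonoidAlgebra.single (z • u) 1 : AddMonoidAlgebra ℂ L) =
        -(AddMonoidAlgebra.single (z • u) 1) * (1 - AddMonoidAlgebra.single (n • u) 1) := by
      rw [neg_mul, mul_sub, AddMonoidAlgebra.single_mul_single, hn, neg_smul, natCast_zsmul,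
        neg_add_cancel, mul_one, mul_one, AddMonoidAlgebra.one_def]
      ring
    rw [e]
    exact Dvd.dvd.mul_left (hdvd n) _

namespace Datum

variable [R.IsCrystallographic] (D : Datum R)

theorem ringHom_ext_K {Z : Type*} [Ring Z] {f g : D.K →+* Z}
    (h : ∀ a : D.A, f (algebraMap D.A D.K a) = g (algebraMap D.A D.K a)) : f = g := by
  refine RingHom.ext fun x => ?_
  obtain ⟨a, c, hc, rfl⟩ := IsFractionRing.div_surjective D.A x
  have hc' : algebraMap D.A D.K c ≠ 0 :=
    IsFractionRing.to_map_ne_zero_of_mem_nonZeroDivisors hc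
  have hu : IsUnit (f (algebraMap D.A D.K c)) := (IsUnit.mk0 _ hc').map f
  apply hu.mul_left_cancel
  rw [← map_mul, mul_div_cancel₀ _ hc', h, h, ← map_mul, mul_div_cancel₀ _ hc']

section SemidirectProduct

instance : SMulCommClass R.weylGroup ℂ D.K where
  smul_comm w c f := by
    rw [Algebra.smul_def, Algebra.smul_def, smul_mul', smul_algebraMap_complex]

/-- The inclusion of `ℂ(P^m)` in the semidirect product algebra, as a ring homomorphism. -/
def ofKHom : D.K →+* D.WK := SkewMonoidAlgebra.singleOneRingHom

theorem ofKHom_apply (f : D.K) : D.ofKHom f = D.ofK f := rfl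

/-- The inclusion of `W` in the semidirect product algebra, as a monoid homomorphism. -/
def ofWHom : R.weylGroup →* D.WK where
  toFun := D.ofW
  map_one' := rfl
  map_mul' w w' := by
    rw [ofW, ofW, ofW, SkewMonoidAlgebra.single_mul_single, smul_one, mul_one]

theorem ofWHom_apply (w : R.weylGroup) : D.ofWHom w = D.ofW w := rfl

theorem ofK_mul_ofW (f : D.K) (w : R.weylGroup) :
    D.ofK f * D.ofW w = SkewMonoidAlgebra.single w f := by
  rw [ofK, ofW, SkewMonoidAlgebra.single_mul_single, one_mul, one_smul, mul_one]

theorem ofW_mul_ofKHom (w : R.weylGroup) (f : D.K) :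
    D.ofW w * D.ofKHom f = D.ofKHom (w • f) * D.ofW w := by
  rw [ofKHom_apply, ofKHom_apply, ofK_mul_ofW, ofK, ofW, SkewMonoidAlgebra.single_mul_single,
    mul_one, one_mul]

theorem ofKHom_complex (c : ℂ) : D.ofKHom (algebraMap ℂ D.K c) = algebraMap ℂ D.WK c := rfl

theorem ringHom_ext_WK [Finite ι] [R.IsReduced] (b : R.Base) {Z : Type*} [Ring Z]
    {f g : D.WK →+* Z} (hK : ∀ x, f (D.ofK x) = g (D.ofK x))
    (hW : ∀ i : b.support, f (D.ofW (refl R (i : ι))) = g (D.ofW (refl R (i : ι)))) : f = g := by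
  have h : ∀ w, f (D.ofW w) = g (D.ofW w) := by
    intro w
    induction w using weylGroup_induction_simple b with
    | one =>
      have : D.ofW (1 : R.weylGroup) = 1 := rfl
      rw [this, map_one, map_one]
    | mul i hi w ih =>
      rw [← ofWHom_apply, map_mul, ofWHom_apply, ofWHom_apply, map_mul, map_mul, ih, hW ⟨i, hi⟩]
  refine RingHom.ext fun x => ?_
  induction x using SkewMonoidAlgebra.induction_on with
  | zero => rw [map_zero, map_zero]
  | single w x => rw [← ofK_mul_ofW, map_mul, map_mul, hK, h]
  | add x y hx hy => rw [map_add, map_add, hx, hy]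

end SemidirectProduct

section Hecke

variable (b : R.Base)

theorem ringHom_ext_H {Z : Type*} [Semiring Z] {f g : D.H b →+* Z}
    (hT : ∀ i, f (D.T b i) = g (D.T b i)) (hA : ∀ a, f (D.ofA b a) = g (D.ofA b a)) : f = g := by
  refine RingHom.ext fun h => ?_
  obtain ⟨x, rfl⟩ := RingQuot.mkAlgHom_surjective ℂ (D.HeckeRel b) h
  induction x using FreeAlgebra.induction with
  | grade0 r =>
    have : RingQuot.mkAlgHom ℂ (D.HeckeRel b) (algebraMap ℂ _ r) =
        D.ofA b (algebraMap ℂ D.A r) := by rw [AlgHom.commutes, AlgHom.commutes]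
    rw [this, hA]
  | grade1 x =>
    rcases x with i | a
    · exact hT i
    · exact hA a
  | mul x y hx hy => rw [map_mul, map_mul, map_mul, hx, hy]
  | add x y hx hy => rw [map_add, map_add, map_add, hx, hy]

theorem T_quadratic (i : b.support) :
    D.T b i * D.T b i = D.ofA b (algebraMap ℂ D.A (D.k i - (D.k i)⁻¹)) * D.T b i + 1 := by
  have h := D.mk_rel b (.quadratic i)
  rw [map_zero, map_mul, map_sub, map_add, AlgHom.commutes, AlgHom.commutes] at h
  change (D.T b i - _) * (D.T b i + _) = 0 at h
  have hc : ∀ c : ℂ, D.T b i * algebraMap ℂ (D.H b) c = algebraMap ℂ (D.H b) c * D.T b i :=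
    fun c => (Algebra.commutes c _).symm
  rw [AlgHom.commutes, map_sub]
  rw [sub_mul, mul_add, mul_add, hc, ← map_mul, mul_inv_cancel₀ (D.k_ne_zero i), map_one] at h
  rw [← sub_eq_zero, ← h, sub_mul]
  abel

theorem T_braid (i j : b.support) (hij : i ≠ j) :
    altProd (orderOf (refl R (i : ι) * refl R (j : ι))) (D.T b i) (D.T b j) =
      altProd (orderOf (refl R (i : ι) * refl R (j : ι))) (D.T b j) (D.T b i) := by
  have h := D.mk_rel b (.braid i j hij)
  have h1 := map_altProd (RingQuot.mkAlgHom ℂ (D.HeckeRel b) : D.FreeH b →* D.H b)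
  exact (h1 _ _ _).symm.trans (h.trans (h1 _ _ _))

theorem T_cross (i : b.support) {f d : D.A}
    (hd : (1 - D.xA (D.rootm i)) * d = f - refl R (i : ι) • f) :
    D.T b i * D.ofA b f - D.ofA b (refl R (i : ι) • f) * D.T b i =
      D.ofA b (algebraMap ℂ D.A (D.k i - (D.k i)⁻¹) * d) := by
  have h := D.mk_rel b (.cross i f d hd)
  rw [map_sub, map_mul, map_mul, map_smul] at h
  have e : D.ofA b (algebraMap ℂ D.A (D.k i - (D.k i)⁻¹) * d) =
      (D.k i - (D.k i)⁻¹) • D.ofA b d := by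
    rw [← Algebra.smul_def]
    exact map_smul (D.ofA b) _ d
  rw [e]
  exact h

/-- For u in P^m, s_i u differs from u by an integer multiple of α_i^m, so the quotient is a
geometric sum up to a monomial. The divided difference required by the cross relation therefore
exists in ℂ[P^m]. -/
theorem one_sub_dvd_sub_smul (i : ι) (f : D.A) :
    1 - D.xA (D.rootm i) ∣ f - refl R i • f := by
  induction f using AddMonoidAlgebra.induction_linear with
  | zero => simp
  | add f g hf hg =>
    rw [smul_add, add_sub_add_comm]
    exact dvd_add hf hg
  | single u c =>
    obtain ⟨z, hz⟩ := D.dvd_wt_inclP u i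
    have hu : refl R i • u = u + (-z) • D.rootm i := by
      apply AddSubgroup.inclusion_injective D.Pm_le
      change D.inclP (refl R i • u) = D.inclP (u + (-z) • D.rootm i)
      rw [inclP_smul, refl_smul_eq_of_wt hz, map_add, map_zsmul, inclP_rootm, neg_smul,
        sub_eq_add_neg]
    have e2 : (AddMonoidAlgebra.single u c : D.A) - refl R i • AddMonoidAlgebra.single u c =
        AddMonoidAlgebra.single u c * (1 - D.xA ((-z) • D.rootm i)) := by
      rw [smul_single, hu, mul_sub, mul_one, xA, AddMonoidAlgebra.single_mul_single, mul_one]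
    rw [e2]
    exact Dvd.dvd.mul_left (one_sub_single_dvd _ _) _

variable [Finite ι]

/-- The generator T_i goes to a_i s_i + b_i. The quadratic and braid relations come from those of W.
In the cross relation the a_i terms cancel, leaving b_i (f - s_i f). -/
theorem exists_heckeHom : ∃ ψ : D.H b →ₐ[ℂ] D.WK,
    (∀ i : b.support, ψ (D.T b i) = D.dlT D.ofKHom i (D.ofW (refl R (i : ι)))) ∧
      ∀ f : D.A, ψ (D.ofA b f) = D.ofK (algebraMap D.A D.K f) := by
  set F : D.FreeH b →ₐ[ℂ] D.WK := FreeAlgebra.lift ℂ (Sum.elim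
    (fun i : b.support => D.dlT D.ofKHom i (D.ofW (refl R (i : ι))))
    (fun f : D.A => D.ofKHom (algebraMap D.A D.K f))) with hF
  have hT : ∀ i, F (D.preT b i) = D.dlT D.ofKHom i (D.ofW (refl R (i : ι))) := fun i => by
    rw [hF, preT, FreeAlgebra.lift_ι_apply, Sum.elim_inl]
  have hA : ∀ f, F (D.preA b f) = D.ofKHom (algebraMap D.A D.K f) := fun f => by
    rw [hF, preA, FreeAlgebra.lift_ι_apply, Sum.elim_inr]
  have hWW : ∀ i, D.ofW (refl R i) * D.ofW (refl R i) = 1 := fun i => by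
    rw [← ofWHom_apply, ← map_mul, refl_mul_self, map_one]
  have hk : ∀ i, D.ofKHom (D.kK i - (D.kK i)⁻¹) =
      algebraMap ℂ D.WK (D.k i) - algebraMap ℂ D.WK (D.k i)⁻¹ := fun i => by
    rw [kK, ← map_inv₀, ← map_sub, ofKHom_complex, map_sub]
  have hrel : ∀ ⦃x y : D.FreeH b⦄, D.HeckeRel b x y → F x = F y := by
    intro x y h
    induction h with
    | add f g => rw [map_add, hA, hA, hA, map_add, map_add]
    | mul f g => rw [map_mul, hA, hA, hA, map_mul, map_mul]
    | scalar c => rw [hA, AlgHom.commutes, ← algebraMap_complex, ofKHom_complex]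
    | quadratic i =>
      have h := (D.dlT_quadratic_iff D.ofKHom (D.ofW_mul_ofKHom (refl R (i : ι)))).2 (hWW i)
      rw [map_zero, map_mul, map_sub, map_add, AlgHom.commutes, AlgHom.commutes, hT, sub_mul,
        mul_add, mul_add, h, hk, ← Algebra.commutes (D.k i)⁻¹, ← map_mul,
        mul_inv_cancel₀ (D.k_ne_zero i), map_one, sub_mul]
      abel
    | braid i j hij =>
      have h1 := map_altProd (F : D.FreeH b →* D.WK) (orderOf (refl R (i : ι) * refl R (j : ι)))
      have h2 : ∀ x y, F (altProd (orderOf (refl R (i : ι) * refl R (j : ι))) x y) = _ := h1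
      rw [h2, h2]
      simp only [MonoidHom.coe_coe]
      rw [hT, hT]
      obtain ⟨C, -, hC⟩ := D.dlT_braid b hij D.ofKHom (D.ofW_mul_ofKHom (refl R (i : ι)))
        (D.ofW_mul_ofKHom (refl R (j : ι))) (hWW i) (hWW j)
      obtain ⟨p, q, hm, hp, hq⟩ := exists_isRankTwo b i.2 j.2 (fun h => hij (Subtype.ext h))
      have h3 := congrArg D.ofWHom (altProd_refl hm hp hq)
      rw [map_altProd, map_altProd, ofWHom_apply, ofWHom_apply] at h3
      rw [h3, sub_self, mul_zero] at hC
      exact sub_eq_zero.1 hC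
    | cross i f d hd =>
      have h1 := congrArg (algebraMap D.A D.K) hd
      rw [map_mul, map_sub, map_sub, map_one, ← smul_algebraMap] at h1
      have h2 := D.one_sub_xK_ne i
      rw [map_sub, map_mul, map_mul, map_smul, hT, hA, hA, hA, ← smul_algebraMap, dlT, add_mul,
        mul_add, mul_assoc, ofW_mul_ofKHom, ← mul_assoc, ← mul_assoc, ← map_mul, ← map_mul,
        ← map_mul, ← map_mul, mul_comm (D.dlA i), add_sub_add_left_eq_sub, ← map_sub,
        Algebra.smul_def, ← ofKHom_complex, ← map_mul]
      congr 1
      rw [mul_comm (D.dlB i), ← sub_mul, ← h1, dlB, map_sub, map_inv₀]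
      rw [xK] at h2 ⊢
      rw [kK]
      field_simp
  refine ⟨RingQuot.liftAlgHom ℂ ⟨F, hrel⟩, fun i => ?_, fun f => ?_⟩
  · exact (RingQuot.liftAlgHom_mkAlgHom_apply ℂ F hrel _).trans (hT i)
  · exact (RingQuot.liftAlgHom_mkAlgHom_apply ℂ F hrel _).trans (hA f)

end Hecke

section Localization

variable (b : R.Base)

/-- The image of a simple reflection in a ring over `H̃^m(k)` which contains `ℂ(P^m)`. -/
def heckeRefl {Z : Type*} [Ring Z] (h : D.H b →+* Z) (e : D.K →+* Z) (i : b.support) : Z :=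
  e (D.dlA i)⁻¹ * (h (D.T b i) - e (D.dlB i))

section

variable {Z : Type*} [Ring Z] (h : D.H b →+* Z) (e : D.K →+* Z)

theorem dlT_heckeRefl (i : b.support) : D.dlT e i (D.heckeRefl b h e i) = h (D.T b i) := by
  rw [dlT, heckeRefl, ← mul_assoc, ← map_mul, mul_inv_cancel₀ (D.dlA_ne_zero i), map_one, one_mul,
    sub_add_cancel]

theorem heckeRefl_eq (i : b.support) : D.heckeRefl b h e i =
    e (algebraMap ℂ D.K (D.k i) / D.cFun i) * h (D.T b i) + 1 -
      e (algebraMap ℂ D.K (D.k i ^ 2) / D.cFun i) := by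
  have hc : D.cFun i = D.kK i * D.dlA i := by
    rw [dlA, mul_div_cancel₀ _ (D.kK_ne_zero i), cFun, map_pow, kK]
  have h1 := D.kK_ne_zero i
  have h2 := D.dlA_ne_zero i
  have e1 : algebraMap ℂ D.K (D.k i) / D.cFun i = (D.dlA i)⁻¹ := by
    rw [hc, ← kK]; field_simp
  have e2 : algebraMap ℂ D.K (D.k i ^ 2) / D.cFun i = 1 + (D.dlA i)⁻¹ * D.dlB i := by
    have h3 := D.one_sub_xK_ne i
    have h4 : D.dlB i = D.kK i - D.dlA i := by
      rw [dlB, dlA]; field_simp; ring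
    rw [hc, h4, map_pow, ← kK]
    field_simp
    ring
  rw [heckeRefl, mul_sub, ← map_mul, e1, e2, map_add, map_one]
  abel

variable {h e} (he : ∀ f : D.A, e (algebraMap D.A D.K f) = h (D.ofA b f))
include he

/-- The cross relation says (T_i - b_i) f = (s_i f)(T_i - b_i) for f in ℂ[P^m]. Fractions follow by
cancelling the image of the denominator, which is a unit. -/
theorem heckeRefl_mul (i : b.support) (f : D.K) :
    D.heckeRefl b h e i * e f = e (refl R (i : ι) • f) * D.heckeRefl b h e i := by
  set U := h (D.T b i) - e (D.dlB i) with hU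
  have hA : ∀ f : D.A, U * e (algebraMap D.A D.K f) =
      e (refl R (i : ι) • algebraMap D.A D.K f) * U := by
    intro f
    obtain ⟨d, hd⟩ := D.one_sub_dvd_sub_smul i f
    have h1 := congrArg h (D.T_cross b i hd.symm)
    have h2 := congrArg (algebraMap D.A D.K) hd
    rw [map_mul, map_sub, map_sub, map_one] at h2
    rw [map_sub, map_mul, map_mul, ← he, ← he, ← he, map_mul, ← algebraMap_complex] at h1
    have h3 : algebraMap ℂ D.K (D.k i - (D.k i)⁻¹) * algebraMap D.A D.K d =
        D.dlB i * algebraMap D.A D.K f -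
          algebraMap D.A D.K (refl R (i : ι) • f) * D.dlB i := by
      have h4 := D.one_sub_xK_ne i
      rw [mul_comm (D.dlB i), ← sub_mul, h2, dlB, map_sub, map_inv₀]
      rw [xK] at h4 ⊢
      rw [kK]
      field_simp
    rw [h3, map_sub, map_mul, map_mul, sub_eq_sub_iff_sub_eq_sub] at h1
    rw [smul_algebraMap, hU, sub_mul, mul_sub, h1]
  have hK : U * e f = e (refl R (i : ι) • f) * U := by
    obtain ⟨a, c, hc, rfl⟩ := IsFractionRing.div_surjective D.A f
    have hc' : algebraMap D.A D.K c ≠ 0 :=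
      IsFractionRing.to_map_ne_zero_of_mem_nonZeroDivisors hc
    have hu : IsUnit (e (algebraMap D.A D.K c)) := (IsUnit.mk0 _ hc').map e
    apply hu.mul_right_cancel
    rw [mul_assoc, ← map_mul, div_mul_cancel₀ _ hc', hA, mul_assoc, hA, ← mul_assoc,
      ← map_mul, ← smul_mul', div_mul_cancel₀ _ hc']
  rw [heckeRefl, mul_assoc, hK, ← mul_assoc, ← mul_assoc, ← map_mul, ← map_mul, mul_comm]

theorem heckeRefl_mul_self (i : b.support) : D.heckeRefl b h e i * D.heckeRefl b h e i = 1 := by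
  rw [← D.dlT_quadratic_iff e (D.heckeRefl_mul b he i), dlT_heckeRefl, ← map_mul,
    T_quadratic, map_add, map_mul, map_one, ← he, ← algebraMap_complex, map_sub, map_inv₀]
  rfl

/-- Here `dlT_braid` is read backwards: the Hecke braid relation is given, and the unit e(C) is
cancelled. -/
theorem braidRel_heckeRefl [Finite ι] [R.IsRootSystem] : BraidRel b (D.heckeRefl b h e) := by
  intro i j hij
  obtain ⟨C, hC, hCe⟩ := D.dlT_braid b hij e (D.heckeRefl_mul b he i)
    (D.heckeRefl_mul b he j) (D.heckeRefl_mul_self b he i) (D.heckeRefl_mul_self b he j)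
  have h0 := congrArg h (D.T_braid b i j hij)
  have h1 := map_altProd (h : D.H b →* Z) (orderOf (refl R (i : ι) * refl R (j : ι)))
  have h2 : ∀ x y, h (altProd (orderOf (refl R (i : ι) * refl R (j : ι))) x y) = _ := h1
  rw [h2, h2] at h0
  simp only [MonoidHom.coe_coe] at h0
  rw [dlT_heckeRefl, dlT_heckeRefl, h0, sub_self] at hCe
  exact sub_eq_zero.1 (((IsUnit.mk0 C hC).map e).mul_right_eq_zero.1 hCe.symm)

end

variable [Finite ι] [R.IsRootSystem]

theorem ofKLoc_algebraMap (f : D.A) :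
    D.ofKLoc b (algebraMap D.A D.K f) = D.toLoc b (D.ofA b f) :=
  OreLocalization.universalHom_commutes _ _ _

/-- One direction comes from ℂ(P^m) and the reflections `heckeRefl`, lifted to W. The other comes
from the universal property of the localization. They are mutually inverse because the substitutions
T_i = a_i s_i + b_i and s_i = a_i⁻¹ (T_i - b_i) are. -/
theorem exists_locIso [R.IsReduced] : ∃ (ψ : D.H b →ₐ[ℂ] D.WK) (φ : D.WK ≃+* D.Hloc b),
    IsLocIso b φ ∧ (∀ h, φ (ψ h) = D.toLoc b h) ∧
      (∀ i : b.support, ψ (D.T b i) = D.dlT D.ofKHom i (D.ofW (refl R (i : ι)))) ∧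
      ∀ f : D.A, ψ (D.ofA b f) = D.ofK (algebraMap D.A D.K f) := by
  obtain ⟨ψ, hψT, hψA⟩ := D.exists_heckeHom b
  have he := D.ofKLoc_algebraMap b
  have hsq : ∀ i, D.heckeRefl b (Z := D.Hloc b) (D.toLoc b) (D.ofKLoc b) i *
      D.heckeRefl b (Z := D.Hloc b) (D.toLoc b) (D.ofKLoc b) i = 1 := D.heckeRefl_mul_self b he
  have hmul : ∀ (i : b.support) (f : D.K),
      D.heckeRefl b (Z := D.Hloc b) (D.toLoc b) (D.ofKLoc b) i * D.ofKLoc b f =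
        D.ofKLoc b (refl R (i : ι) • f) * D.heckeRefl b (Z := D.Hloc b) (D.toLoc b) (D.ofKLoc b) i :=
    D.heckeRefl_mul b he
  have hbr : BraidRel b (D.heckeRefl b (Z := D.Hloc b) (D.toLoc b) (D.ofKLoc b)) := D.braidRel_heckeRefl b he
  obtain ⟨g, hg⟩ := exists_weylGroup_lift b hsq hbr
  have hcomm : ∀ {x : D.K} {y : R.weylGroup},
      D.ofKLoc b (y • x) * g y = g y * D.ofKLoc b x := by
    intro x y
    induction y using weylGroup_induction_simple b generalizing x with
    | one => simp
    | mul i hi w ih =>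
      rw [map_mul, mul_smul, ← mul_assoc, hg ⟨i, hi⟩, ← hmul ⟨i, hi⟩, mul_assoc,
        ih, mul_assoc]
  set φ : D.WK →+* D.Hloc b := SkewMonoidAlgebra.liftNCRingHom (D.ofKLoc b) g hcomm with hφ
  have hφK : ∀ f, φ (D.ofK f) = D.ofKLoc b f := fun f =>
    (SkewMonoidAlgebra.liftNC_single _ _ _ _).trans (by simp)
  have hφW : ∀ i : b.support, φ (D.ofW (refl R (i : ι))) = D.heckeRefl b (Z := D.Hloc b) (D.toLoc b) (D.ofKLoc b) i := fun i =>
    (SkewMonoidAlgebra.liftNC_single _ _ _ _).trans (by simp [hg i])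
  -- Nonzero elements of ℂ[P^m] become invertible in the semidirect product, so `ψ` extends to the
  -- localization.
  have hunit : ∀ s : D.S b, IsUnit ((ψ : D.H b →* D.WK).comp (D.S b).subtype s) := by
    rintro ⟨_, f, hf, rfl⟩
    change IsUnit (ψ (D.ofA b f))
    rw [hψA]
    exact (IsUnit.mk0 _ (IsFractionRing.to_map_ne_zero_of_mem_nonZeroDivisors hf)).map D.ofKHom
  set θ : D.Hloc b →+* D.WK := OreLocalization.universalHom (ψ : D.H b →+* D.WK)
    (IsUnit.liftRight ((ψ : D.H b →* D.WK).comp (D.S b).subtype) hunit) (fun s => rfl) with hθ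
  have hθl : ∀ h, θ (D.toLoc b h) = ψ h := fun h => OreLocalization.universalHom_commutes _ _ _
  have hθK : ∀ f, θ (D.ofKLoc b f) = D.ofK f := by
    have : θ.comp (D.ofKLoc b) = D.ofKHom := D.ringHom_ext_K fun a => by
      rw [RingHom.comp_apply, ofKLoc_algebraMap, hθl, hψA, ofKHom_apply]
    exact fun f => congrArg (fun r : D.K →+* D.WK => r f) this
  have hφψ : ∀ h, φ (ψ h) = D.toLoc b h := by
    have : φ.comp (ψ : D.H b →+* D.WK) = D.toLoc b := by
      apply D.ringHom_ext_H b
      · intro i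
        change φ (ψ (D.T b i)) = _
        rw [hψT, dlT, map_add, map_mul, ofKHom_apply, ofKHom_apply, hφK, hφK, hφW]
        exact D.dlT_heckeRefl b (Z := D.Hloc b) _ _ i
      · intro a
        change φ (ψ (D.ofA b a)) = _
        rw [hψA, hφK, ofKLoc_algebraMap]
    exact fun h => congrArg (fun r : D.H b →+* D.Hloc b => r h) this
  have hθφ : θ.comp φ = RingHom.id _ := by
    apply D.ringHom_ext_WK b
    · intro f
      rw [RingHom.comp_apply, hφK, hθK, RingHom.id_apply]
    · intro i
      have h2 := D.dlA_ne_zero i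
      rw [RingHom.comp_apply, hφW, RingHom.id_apply, heckeRefl, map_mul, map_sub, hθK, hθK, hθl, hψT,
        dlT, ofKHom_apply, ofKHom_apply, add_sub_cancel_right, ← mul_assoc, ← ofKHom_apply,
        ← ofKHom_apply, ← map_mul, inv_mul_cancel₀ h2, map_one, one_mul]
  have hφθ : φ.comp θ = RingHom.id _ := by
    refine RingHom.ext fun z => ?_
    induction z using OreLocalization.ind with
    | _ r s =>
    have hs : IsUnit (D.toLoc b s) := (OreLocalization.numeratorUnit s).isUnit
    apply hs.mul_left_cancel
    have e : D.toLoc b s * (r /ₒ s) = D.toLoc b r := OreLocalization.mul_cancel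
    rw [RingHom.id_apply, e, RingHom.comp_apply, ← hφψ s, ← hθl s, ← map_mul, ← map_mul, e, hθl,
      hφψ]
  refine ⟨ψ, RingEquiv.ofRingHom φ θ hφθ hθφ, ⟨hφK, fun i => ?_⟩, hφψ, hψT, hψA⟩
  exact (hφW i).trans (D.heckeRefl_eq b (Z := D.Hloc b) _ _ i)

end Localization
end Datum
end Metaplectic


/-! ### The Hecke representation on ℂ[P] -/

namespace Metaplectic

variable {ι E N : Type*} [NormedAddCommGroup E] [InnerProductSpace ℝ E]
  [AddCommGroup N] [Module ℝ N] {R : RootPairing ι ℝ E N}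

/-- A representation restricts to an invariant subspace. -/
theorem exists_restrict_algHom {k H B F : Type*} [CommRing k] [Ring H] [Algebra k H]
    [AddCommGroup B] [Module k B] [AddCommGroup F] [Module k F] (ρ : H →+* Module.End k F)
    (hρ : ∀ (c : k) (y : F), ρ (algebraMap k H c) y = c • y) (j : B →ₗ[k] F)
    (hj : Function.Injective j) (h : ∀ x p, ∃ q, j q = ρ x (j p)) :
    ∃ π : H →ₐ[k] Module.End k B, ∀ x p, j (π x p) = ρ x (j p) := by
  choose q hq using h
  set L : H → Module.End k B := fun x =>
    { toFun := q x
      map_add' := fun p p' => hj (by rw [hq, map_add, map_add, map_add, hq, hq])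
      map_smul' := fun c p => hj (by
        rw [hq, map_smul, map_smul, RingHom.id_apply, map_smul, hq]) }
  have hL : ∀ x p, j (L x p) = ρ x (j p) := hq
  have hext : ∀ {L₁ L₂ : Module.End k B}, (∀ p, j (L₁ p) = j (L₂ p)) → L₁ = L₂ :=
    fun h => LinearMap.ext fun p => hj (h p)
  refine ⟨
    { toFun := L
      map_one' := hext fun p => by rw [hL, map_one]; rfl
      map_mul' := fun x y => hext fun p => by
        rw [hL, map_mul, Module.End.mul_apply, Module.End.mul_apply, hL, hL]
      map_zero' := hext fun p => by rw [hL, map_zero]; exact (map_zero j).symm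
      map_add' := fun x y => hext fun p => by
        rw [hL, map_add, LinearMap.add_apply, LinearMap.add_apply, map_add, hL, hL]
      commutes' := fun c => hext fun p => by
        rw [hL, hρ, ← map_smul]; rfl }, hL⟩

namespace Datum

section HeckeRepresentation

theorem algebraMap_groupAlgP_injective :
    Function.Injective (algebraMap (GroupAlgP R) (FieldP R)) :=
  IsFractionRing.injective _ _

variable [R.IsCrystallographic] {D : Datum R} {b : R.Base} {G : D.RepParams} {r : D.WK →+* Module.End ℂ (FieldP R)}
  {ψ : D.H b →ₐ[ℂ] D.WK}

theorem rep_heckeHom_algebraMap (hrK : ∀ f, r (D.ofK f) = D.mulK f) (c : ℂ) (y : FieldP R) :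
    r (ψ (algebraMap ℂ (D.H b) c)) y = c • y := by
  rw [AlgHom.commutes, ← ofKHom_complex, ofKHom_apply, hrK, mulK_apply, inclK_complex,
    Algebra.smul_def]

theorem rep_heckeHom_ofA (hrK : ∀ f, r (D.ofK f) = D.mulK f)
    (hψA : ∀ f : D.A, ψ (D.ofA b f) = D.ofK (algebraMap D.A D.K f)) (f : D.A) (y : FieldP R) :
    r (ψ (D.ofA b f)) y = algebraMap (GroupAlgP R) (FieldP R) (D.inclA f) * y := by
  rw [hψA, hrK, mulK_apply, inclK_algebraMap]

theorem one_sub_xP_rootmP_ne (i : ι) : 1 - xP R (D.rootmP i) ≠ 0 := by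
  have e : (1 : FieldP R) - xP R (D.rootmP i) = D.inclK (1 - D.xK (D.rootm i)) := by
    rw [map_sub, map_one, inclK_xK, inclP_rootm]
  rw [e]
  exact (map_ne_zero _).2 (D.one_sub_xK_ne i)

variable [Finite ι]

theorem rep_heckeHom_T (hrK : ∀ f, r (D.ofK f) = D.mulK f)
    (hrW : ∀ i : b.support, r (D.ofW (refl R (i : ι))) = G.weylOp i)
    (hψT : ∀ i : b.support, ψ (D.T b i) = D.dlT D.ofKHom i (D.ofW (refl R (i : ι))))
    (i : b.support) : r (ψ (D.T b i)) = G.dlOp i := by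
  rw [hψT, dlT, map_add, map_mul, ofKHom_apply, ofKHom_apply, hrK, hrK, hrW]
  rfl

/-- The denominator of b_i divides 1 - x^{zα_i^m} for every integer z, so T_i preserves ℂ[P]
although the involution itself does not have polynomial coefficients. -/
theorem RepParams.exists_dlOp_xP (i : ι) (v : weightLattice R) :
    ∃ q : GroupAlgP R, algebraMap (GroupAlgP R) (FieldP R) q = G.dlOp i (xP R v) := by
  obtain ⟨d, hd⟩ := one_sub_single_dvd (D.rootmP i) (-(wt R v i / (D.m i : ℤ)))
  have h := congrArg (algebraMap (GroupAlgP R) (FieldP R)) hd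
  rw [map_sub, map_mul, map_sub, map_one] at h
  refine ⟨AddMonoidAlgebra.single v (D.k i - (D.k i)⁻¹) * d -
    AddMonoidAlgebra.single (refl R i • v) (G.coeff v i), ?_⟩
  rw [G.dlOp_xP, map_sub, map_mul, algebraMap_single, algebraMap_single, sub_eq_add_neg v,
    ← neg_smul, xP_add]
  have h2 : D.inclK (D.dlB i) * (1 - xP R (D.rootmP i)) = _ := inclK_dlB_mul i
  rw [← xP, ← xP] at h
  rw [Algebra.smul_def (D.k i - (D.k i)⁻¹), ← h2, mul_right_comm, mul_assoc (D.inclK _), ← h]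
  ring

theorem exists_rep_heckeHom_eq (hrK : ∀ f, r (D.ofK f) = D.mulK f)
    (hrW : ∀ i : b.support, r (D.ofW (refl R (i : ι))) = G.weylOp i)
    (hψT : ∀ i : b.support, ψ (D.T b i) = D.dlT D.ofKHom i (D.ofW (refl R (i : ι))))
    (hψA : ∀ f : D.A, ψ (D.ofA b f) = D.ofK (algebraMap D.A D.K f)) (h : D.H b)
    (p : GroupAlgP R) : ∃ q : GroupAlgP R, algebraMap (GroupAlgP R) (FieldP R) q =
      r (ψ h) (algebraMap (GroupAlgP R) (FieldP R) p) := by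
  obtain ⟨x, rfl⟩ := RingQuot.mkAlgHom_surjective ℂ (D.HeckeRel b) h
  induction x using FreeAlgebra.induction generalizing p with
  | grade0 c =>
    refine ⟨c • p, ?_⟩
    rw [AlgHom.commutes, rep_heckeHom_algebraMap hrK, Algebra.smul_def c p, map_mul,
      ← IsScalarTower.algebraMap_apply, Algebra.smul_def]
  | grade1 x =>
    rcases x with i | a
    · change ∃ q, algebraMap (GroupAlgP R) (FieldP R) q = r (ψ (D.T b i)) _
      rw [rep_heckeHom_T hrK hrW hψT]
      induction p using AddMonoidAlgebra.induction_linear with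
      | zero => exact ⟨0, by simp⟩
      | add p p' hp hp' =>
        obtain ⟨q, hq⟩ := hp
        obtain ⟨q', hq'⟩ := hp'
        exact ⟨q + q', by rw [map_add, map_add, map_add, hq, hq']⟩
      | single v c =>
        obtain ⟨q, hq⟩ := RepParams.exists_dlOp_xP (G := G) (i : ι) v
        refine ⟨c • q, ?_⟩
        rw [algebraMap_single, LinearMap.map_smul, ← hq, Algebra.smul_def c q, map_mul,
          ← IsScalarTower.algebraMap_apply, Algebra.smul_def]
    · change ∃ q, algebraMap (GroupAlgP R) (FieldP R) q = r (ψ (D.ofA b a)) _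
      exact ⟨D.inclA a * p, by rw [rep_heckeHom_ofA hrK hψA, map_mul]⟩
  | mul x y hx hy =>
    obtain ⟨q, hq⟩ := hy p
    obtain ⟨q', hq'⟩ := hx q
    exact ⟨q', by rw [map_mul, map_mul, map_mul, Module.End.mul_apply, hq', hq]⟩
  | add x y hx hy =>
    obtain ⟨q, hq⟩ := hx p
    obtain ⟨q', hq'⟩ := hy p
    exact ⟨q + q', by rw [map_add, map_add, map_add, map_add, LinearMap.add_apply, hq, hq']⟩

theorem exists_restrict_heckeHom (hrK : ∀ f, r (D.ofK f) = D.mulK f)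
    (hrW : ∀ i : b.support, r (D.ofW (refl R (i : ι))) = G.weylOp i)
    (hψT : ∀ i : b.support, ψ (D.T b i) = D.dlT D.ofKHom i (D.ofW (refl R (i : ι))))
    (hψA : ∀ f : D.A, ψ (D.ofA b f) = D.ofK (algebraMap D.A D.K f)) :
    ∃ π : D.H b →ₐ[ℂ] Module.End ℂ (GroupAlgP R), ∀ h p,
      algebraMap (GroupAlgP R) (FieldP R) (π h p) =
        r (ψ h) (algebraMap (GroupAlgP R) (FieldP R) p) := by
  have hsmul : ∀ (c : ℂ) p, algebraMap (GroupAlgP R) (FieldP R) (c • p) =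
      c • algebraMap (GroupAlgP R) (FieldP R) p := fun c p => by
    rw [Algebra.smul_def c p, map_mul, ← IsScalarTower.algebraMap_apply, Algebra.smul_def]
  exact exists_restrict_algHom (r.comp (ψ : D.H b →+* D.WK)) (rep_heckeHom_algebraMap hrK)
    { toFun := algebraMap (GroupAlgP R) (FieldP R)
      map_add' := map_add _
      map_smul' := hsmul } algebraMap_groupAlgP_injective
    (exists_rep_heckeHom_eq hrK hrW hψT hψA)

end HeckeRepresentation

section Values

variable [R.IsCrystallographic] [R.IsRootSystem] {D : Datum R} {b : R.Base} {G : D.RepParams}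

theorem qwt_eq (v : weightLattice R) (i : b.support) : D.qwt b v i = wt R v i / (D.m i : ℤ) := by
  rw [qwt, qwt_aux, Int.floor_intCast]

theorem RepParams.isHeckeRep_of_eq [Finite ι] {r : D.WK →+* Module.End ℂ (FieldP R)}
    {ψ : D.H b →ₐ[ℂ] D.WK} (hrK : ∀ f, r (D.ofK f) = D.mulK f)
    (hrW : ∀ i : b.support, r (D.ofW (refl R (i : ι))) = G.weylOp i)
    (hψT : ∀ i : b.support, ψ (D.T b i) = D.dlT D.ofKHom i (D.ofW (refl R (i : ι))))
    (hψA : ∀ f : D.A, ψ (D.ofA b f) = D.ofK (algebraMap D.A D.K f))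
    {π : D.H b →ₐ[ℂ] Module.End ℂ (GroupAlgP R)}
    (hπ : ∀ h p, algebraMap (GroupAlgP R) (FieldP R) (π h p) =
        r (ψ h) (algebraMap (GroupAlgP R) (FieldP R) p)) : IsHeckeRep b G π where
  apply_T i v := by
    have h2 : D.inclK (D.dlB i) * (1 - xP R (D.rootmP i)) = _ := inclK_dlB_mul (i : ι)
    have h3 := one_sub_xP_rootmP_ne (D := D) (i : ι)
    rw [hπ, rep_heckeHom_T hrK hrW hψT, ← xP, G.dlOp_xP, qwt_eq, ← h2, RepParams.coeff,
      Algebra.smul_def, sub_eq_add_neg v, xP_add]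
    field_simp
  apply_x u v := algebraMap_groupAlgP_injective (R := R) (by
    rw [hπ, rep_heckeHom_ofA hrK hψA, ← map_mul, xA, inclA_single,
      AddMonoidAlgebra.single_mul_single, mul_one, add_comm]
    rfl)

theorem IsHeckeRep.eq {π π' : D.H b →ₐ[ℂ] Module.End ℂ (GroupAlgP R)}
    (h : IsHeckeRep b G π) (h' : IsHeckeRep b G π') : π = π' := by
  have hext : ∀ L L' : Module.End ℂ (GroupAlgP R), (∀ v, L (AddMonoidAlgebra.single v 1) =
      L' (AddMonoidAlgebra.single v 1)) → L = L' := by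
    intro L L' hL
    refine LinearMap.ext fun p => ?_
    induction p using AddMonoidAlgebra.induction_linear with
    | zero => rw [map_zero, map_zero]
    | add p q hp hq => rw [map_add, map_add, hp, hq]
    | single v c =>
      have e : (AddMonoidAlgebra.single v c : GroupAlgP R) = c • AddMonoidAlgebra.single v 1 := by
        rw [AddMonoidAlgebra.smul_single, smul_eq_mul, mul_one]
      rw [e, map_smul, map_smul, hL]
  have : (π : D.H b →+* Module.End ℂ (GroupAlgP R)) = π' := by
    apply D.ringHom_ext_H b
    · intro i
      refine hext _ _ fun v => algebraMap_groupAlgP_injective ?_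
      exact (h.apply_T i v).trans (h'.apply_T i v).symm
    · intro a
      change π (D.ofA b a) = π' (D.ofA b a)
      induction a using AddMonoidAlgebra.induction_linear with
      | zero => simp only [map_zero]
      | add p q hp hq => simp only [map_add, hp, hq]
      | single u c =>
        have e : (AddMonoidAlgebra.single u c : D.A) = c • D.xA u := by
          rw [xA, AddMonoidAlgebra.smul_single, smul_eq_mul, mul_one]
        rw [e, map_smul, map_smul, map_smul]
        congr 1
        exact hext _ _ fun v => (h.apply_x u v).trans (h'.apply_x u v).symm
  exact AlgHom.ext fun x => congrArg (fun f : D.H b →+* Module.End ℂ (GroupAlgP R) => f x) this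

end Values

end Datum
end Metaplectic


/-! ### The localized module and conjugation by x^{ρ - ρ^m} -/

namespace Metaplectic

variable {ι E N : Type*} [NormedAddCommGroup E] [InnerProductSpace ℝ E]
  [AddCommGroup N] [Module ℝ N] {R : RootPairing ι ℝ E N}

namespace Datum

section LocalizedModule

variable [R.IsCrystallographic] [Finite ι] {D : Datum R} {b : R.Base} {r : D.WK →+* Module.End ℂ (FieldP R)} {ψ : D.H b →ₐ[ℂ] D.WK}

-- An element of S acts as multiplication by its nonzero value at 1. This expresses division by it
-- on ℂ(P) without choosing a preimage in ℂ[P^m].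
omit [Finite ι] in
theorem rep_heckeHom_of_mem_S (hrK : ∀ f, r (D.ofK f) = D.mulK f)
    (hψA : ∀ f : D.A, ψ (D.ofA b f) = D.ofK (algebraMap D.A D.K f)) {s : D.H b} (hs : s ∈ D.S b) :
    r (ψ s) 1 ≠ 0 ∧ ∀ y, r (ψ s) y = r (ψ s) 1 * y := by
  obtain ⟨f, hf, rfl⟩ := hs
  change r (ψ (D.ofA b f)) 1 ≠ 0 ∧ ∀ y, r (ψ (D.ofA b f)) y = r (ψ (D.ofA b f)) 1 * y
  constructor
  · rw [rep_heckeHom_ofA hrK hψA, mul_one, ← inclK_algebraMap]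
    exact D.inclK_algebraMap_ne_zero (nonZeroDivisors.ne_zero hf)
  · intro y
    rw [rep_heckeHom_ofA hrK hψA, rep_heckeHom_ofA hrK hψA, mul_one]

variable [R.IsRootSystem]

/-- The localization of the module `ℂ[P]` is `ℂ(P)`. -/
theorem exists_locIdent (hrK : ∀ f, r (D.ofK f) = D.mulK f)
    (hψA : ∀ f : D.A, ψ (D.ofA b f) = D.ofK (algebraMap D.A D.K f))
    {π : D.H b →ₐ[ℂ] Module.End ℂ (GroupAlgP R)}
    (hπ : ∀ h p, algebraMap (GroupAlgP R) (FieldP R) (π h p) =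
        r (ψ h) (algebraMap (GroupAlgP R) (FieldP R) p)) :
    ∃ Θ : D.RepLoc b π ≃+ FieldP R, ∀ (v : D.RepModule b π) (s : D.S b),
      r (ψ s) (Θ (v /ₒ s)) = algebraMap (GroupAlgP R) (FieldP R) v := by
  have hS := fun s : D.S b => rep_heckeHom_of_mem_S hrK hψA s.2
  have hsmul : ∀ (h : D.H b) (v : D.RepModule b π),
      algebraMap (GroupAlgP R) (FieldP R) (h • v : D.RepModule b π) =
        r (ψ h) (algebraMap (GroupAlgP R) (FieldP R) v) := fun h v => hπ h v
  have hmul : ∀ (x y : D.H b) (z : FieldP R), r (ψ (x * y)) z = r (ψ x) (r (ψ y) z) :=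
    fun x y z => by rw [map_mul, map_mul, Module.End.mul_apply]
  -- A fraction with numerator v and denominator s goes to s⁻¹ v; the proof obligation is invariance
  -- under expanding the fraction by t.
  set F : D.RepLoc b π → FieldP R := OreLocalization.liftExpand
    (fun v s => (r (ψ s) 1)⁻¹ * algebraMap (GroupAlgP R) (FieldP R) v) (by
      intro v t s ht
      have h1 := (hS ⟨t * s, ht⟩).1
      have h2 := (hS ⟨t * s, ht⟩).2 ((r (ψ s) 1)⁻¹ * algebraMap (GroupAlgP R) (FieldP R) v)
      have h3 := (hS s).2 ((r (ψ s) 1)⁻¹ * algebraMap (GroupAlgP R) (FieldP R) v)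
      rw [mul_inv_cancel_left₀ (hS s).1] at h3
      rw [eq_inv_mul_iff_mul_eq₀ h1, ← h2, hsmul]
      exact (hmul t s _).trans (congrArg _ h3))
  have hFd : ∀ (v : D.RepModule b π) (s : D.S b),
      r (ψ s) (F (v /ₒ s)) = algebraMap (GroupAlgP R) (FieldP R) v := by
    intro v s
    rw [(hS s).2]
    exact mul_inv_cancel_left₀ (hS s).1 _
  have hinj : ∀ (s : D.S b) {x y : FieldP R}, r (ψ s) x = r (ψ s) y → x = y := by
    intro s x y h
    rw [(hS s).2 x, (hS s).2 y] at h
    exact mul_left_cancel₀ (hS s).1 h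
  have hadd : ∀ x y, F (x + y) = F x + F y := by
    intro x y
    induction x using OreLocalization.ind with
    | _ v s =>
    induction y using OreLocalization.ind with
    | _ w t =>
    -- Denominators come from a commutative ring, so two fractions have a common denominator.
    have hst : s * t = t * s := by
      obtain ⟨s, f, -, rfl⟩ := s
      obtain ⟨t, g, -, rfl⟩ := t
      apply Subtype.ext
      change D.ofA b f * D.ofA b g = D.ofA b g * D.ofA b f
      rw [← map_mul, ← map_mul, mul_comm]
    rw [OreLocalization.expand' v s t, OreLocalization.expand' w t s, hst,
      OreLocalization.add_oreDiv]
    apply hinj (t * s)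
    rw [map_add, hFd, hFd, hFd]
    exact map_add _ _ _
  set Θ : D.RepLoc b π →+ FieldP R :=
    { toFun := F
      map_zero' := by
        have := hadd 0 0
        rwa [add_zero, left_eq_add] at this
      map_add' := hadd }
  refine ⟨AddEquiv.ofBijective Θ ⟨?_, ?_⟩, hFd⟩
  · rw [injective_iff_map_eq_zero]
    intro x hx
    induction x using OreLocalization.ind with
    | _ v s =>
    have h1 := hFd v s
    have h2 : F (v /ₒ s) = 0 := hx
    rw [h2, map_zero] at h1
    have h3 : v = 0 := algebraMap_groupAlgP_injective (h1.symm.trans (map_zero _).symm)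
    rw [h3, OreLocalization.zero_oreDiv]
  · intro y
    obtain ⟨p, d, hd, h⟩ := D.exists_fraction y
    set s : D.S b := ⟨D.ofA b d, d, mem_nonZeroDivisors_of_ne_zero hd, rfl⟩
    refine ⟨D.toRepModule b π p /ₒ s, hinj s ?_⟩
    refine (hFd _ s).trans ?_
    change _ = r (ψ (D.ofA b d)) y
    rw [rep_heckeHom_ofA hrK hψA, ← inclK_algebraMap, h]
    rfl

/-- The identification of the localized module with `ℂ(P)` is equivariant. -/
theorem locIdent_smul (hrK : ∀ f, r (D.ofK f) = D.mulK f)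
    (hψA : ∀ f : D.A, ψ (D.ofA b f) = D.ofK (algebraMap D.A D.K f))
    {π : D.H b →ₐ[ℂ] Module.End ℂ (GroupAlgP R)}
    (hπ : ∀ h p, algebraMap (GroupAlgP R) (FieldP R) (π h p) =
        r (ψ h) (algebraMap (GroupAlgP R) (FieldP R) p))
    {φ : D.WK ≃+* D.Hloc b} (hφ : ∀ h, φ (ψ h) = D.toLoc b h) {Θ : D.RepLoc b π ≃+ FieldP R}
    (hΘ : ∀ (v : D.RepModule b π) (s : D.S b),
      r (ψ s) (Θ (v /ₒ s)) = algebraMap (GroupAlgP R) (FieldP R) v)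
    (X : D.WK) (y : D.RepLoc b π) : Θ (φ X • y) = r X (Θ y) := by
  obtain ⟨z, rfl⟩ := φ.symm.surjective X
  rw [RingEquiv.apply_symm_apply]
  induction z using OreLocalization.ind with
  | _ h s =>
  induction y using OreLocalization.ind with
  | _ v t =>
  rw [OreLocalization.oreDiv_smul_oreDiv]
  -- By the Ore condition q h = p t, the product of h / s and v / t is (p v) / (q s). It is compared
  -- with the action after applying q s.
  set p := OreLocalization.oreNum h t
  set q := OreLocalization.oreDenom h t
  have hpq : (q : D.H b) * h = p * t := OreLocalization.ore_eq h t
  have hS := rep_heckeHom_of_mem_S hrK hψA (q * s).2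
  apply mul_left_cancel₀ hS.1
  rw [← hS.2, ← hS.2, hΘ, ← Module.End.mul_apply, ← map_mul]
  have e : ψ (q * s : D.S b) * φ.symm (h /ₒ s) = ψ (p * t) := by
    apply φ.injective
    rw [map_mul, hφ, hφ, RingEquiv.apply_symm_apply, ← hpq, map_mul]
    change D.toLoc b (q * s) * _ = _
    rw [map_mul, mul_assoc]
    congr 1
    exact OreLocalization.mul_cancel
  rw [e, map_mul, map_mul, Module.End.mul_apply, hΘ]
  exact hπ _ _

theorem isLocIdent_of_eq (hrK : ∀ f, r (D.ofK f) = D.mulK f)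
    (hψA : ∀ f : D.A, ψ (D.ofA b f) = D.ofK (algebraMap D.A D.K f))
    {π : D.H b →ₐ[ℂ] Module.End ℂ (GroupAlgP R)}
    (hπ : ∀ h p, algebraMap (GroupAlgP R) (FieldP R) (π h p) =
        r (ψ h) (algebraMap (GroupAlgP R) (FieldP R) p))
    {φ : D.WK ≃+* D.Hloc b} (hφ : ∀ h, φ (ψ h) = D.toLoc b h)
    (hφK : ∀ f : D.K, φ (D.ofK f) = D.ofKLoc b f) {Θ : D.RepLoc b π ≃+ FieldP R}
    (hΘ : ∀ (v : D.RepModule b π) (s : D.S b),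
      r (ψ s) (Θ (v /ₒ s)) = algebraMap (GroupAlgP R) (FieldP R) v) : IsLocIdent b π Θ := by
  intro f h v
  rw [tmul, ← hφ, ← hφK, ← map_mul, locIdent_smul hrK hψA hπ hφ hΘ, map_mul,
    Module.End.mul_apply, hrK, mulK_apply, hπ]
  congr 2
  have := hΘ (D.toRepModule b π v) 1
  rwa [OneMemClass.coe_one, map_one, map_one] at this

theorem IsLocIso.eq [R.IsReduced] {φ φ' : D.WK ≃+* D.Hloc b} (h : IsLocIso b φ)
    (h' : IsLocIso b φ') : φ = φ' := by
  have := D.ringHom_ext_WK b (Z := D.Hloc b) (f := φ.toRingHom) (g := φ'.toRingHom)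
    (fun x => (h.apply_K x).trans (h'.apply_K x).symm)
    (fun i => (h.apply_s i).trans (h'.apply_s i).symm)
  exact RingEquiv.toRingHom_injective this

end LocalizedModule

section WeylRepresentation

variable [R.IsCrystallographic] {D : Datum R} {b : R.Base} {G : D.RepParams}

/-- The conjugate of an action on `ℂ(P)` by a monomial. -/
def conjRep (r : D.WK →+* Module.End ℂ (FieldP R)) (δ : weightLattice R) :
    D.WK →+* Module.End ℂ (FieldP R) where
  toFun X := LinearMap.mulLeft ℂ (xP R δ) * r X * LinearMap.mulLeft ℂ (xP R (-δ))
  map_one' := LinearMap.ext fun y => by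
    rw [map_one, mul_one, Module.End.mul_apply, LinearMap.mulLeft_apply, LinearMap.mulLeft_apply,
      ← mul_assoc, ← xP_add, add_neg_cancel, xP_zero, one_mul, Module.End.one_apply]
  map_mul' X Y := LinearMap.ext fun y => by
    simp only [map_mul, Module.End.mul_apply, LinearMap.mulLeft_apply]
    rw [← mul_assoc (xP R (-δ)), ← xP_add, neg_add_cancel, xP_zero, one_mul]
  map_zero' := by rw [map_zero, mul_zero, zero_mul]
  map_add' X Y := by rw [map_add, mul_add, add_mul]

theorem conjRep_apply (r : D.WK →+* Module.End ℂ (FieldP R)) (δ : weightLattice R) (X : D.WK)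
    (y : FieldP R) : conjRep r δ X y = xP R δ * r X (xP R (-δ) * y) := rfl

/-- The shift by 1 - m, the pairing of ρ - ρ^m with a simple coroot, turns the floor of t / m into
its ceiling. This is why σ involves q(-λ) where π involves q(λ). -/
theorem sub_ediv_eq_neg_ediv {m : ℤ} (hm : 0 < m) (t : ℤ) : (t - (1 - m)) / m = -(-t / m) := by
  have h1 := Int.emod_add_mul_ediv (-t) m
  have h2 := Int.emod_nonneg (-t) hm.ne'
  have h3 := Int.emod_lt_of_pos (-t) hm
  have e : t - (1 - m) = (m - 1 - -t % m) + m * -(-t / m) := by linarith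
  rw [e, Int.add_mul_ediv_left _ _ hm.ne', Int.ediv_eq_zero_of_lt (by linarith) (by linarith),
    zero_add]

theorem one_sub_sq_xP_rootmP_ne (i : ι) :
    1 - algebraMap ℂ (FieldP R) (D.k i ^ 2) * xP R (D.rootmP i) ≠ 0 := by
  have e : (1 : FieldP R) - algebraMap ℂ (FieldP R) (D.k i ^ 2) * xP R (D.rootmP i) =
      D.inclK (1 - D.kK i ^ 2 * D.xK (D.rootm i)) := by
    rw [map_sub, map_one, map_mul, inclK_xK, inclP_rootm, map_pow D.inclK, inclK_kK, map_pow]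
  rw [e]
  exact (map_ne_zero _).2 (D.one_sub_kK_ne i)

theorem IsWeylRep.eq [Finite ι] [R.IsRootSystem] [R.IsReduced]
    {σ σ' : D.WK →+* Module.End ℂ (FieldP R)}
    (h : IsWeylRep b G σ) (h' : IsWeylRep b G σ') : σ = σ' := by
  apply D.ringHom_ext_WK b
  · refine fun g => LinearMap.ext fun y => ?_
    induction y using D.fieldP_induction with
    | add x y hx hy => rw [map_add, map_add, hx, hy]
    | mul f v => rw [h.apply_K, h'.apply_K]
  · refine fun i => LinearMap.ext fun y => ?_
    induction y using D.fieldP_induction with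
    | add x y hx hy => rw [map_add, map_add, hx, hy]
    | mul f v => rw [h.apply_s, h'.apply_s]

/-- Replacing v by v - δ has three effects: floors become ceilings, the index of g changes by
Q(α_i)(1 - m(α_i)), which is Q(α_i) modulo n, and s_i (v - δ) = s_i v - δ + (1 - m(α_i)) α_i. -/
theorem isWeylRep_conjRep [Finite ι] [R.IsRootSystem] {r : D.WK →+* Module.End ℂ (FieldP R)}
    (hrK : ∀ f, r (D.ofK f) = D.mulK f)
    (hrW : ∀ i : b.support, r (D.ofW (refl R (i : ι))) = G.weylOp i) {δ : weightLattice R}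
    (hδ : ∀ i ∈ b.support, wt R δ i = 1 - D.m i) : IsWeylRep b G (conjRep r δ) where
  apply_K g f v := by
    rw [conjRep_apply, hrK, mulK_apply, xP_neg]
    have := xP_ne_zero δ
    field_simp
  apply_s i f v := by
    have hm : (0 : ℤ) < D.m i := by exact_mod_cast D.m_pos i
    have hn : (D.n : ℤ) ∣ D.QZ i * D.m i := (D.dvd_QZ_mul_iff i _).2 dvd_rfl
    have hw : wt R (v - δ) i = wt R v i - (1 - D.m i) := by rw [wt_sub, hδ i i.2]
    have hg : G.g (-D.BZ (v - δ) i) (D.size i) = G.g (D.QZ i - D.BZ v i) (D.size i) := by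
      apply G.g_congr
      rw [BZ_eq, BZ_eq, hw]
      have e : -(D.QZ i * (wt R v i - (1 - D.m i))) - (D.QZ i - D.QZ i * wt R v i) =
          -(D.QZ i * (D.m i : ℤ)) := by ring
      rw [e]
      exact hn.neg_right
    have e1 : xP R (-δ) * (D.inclK f * xP R v) = D.inclK f * xP R (v - δ) := by
      rw [sub_eq_add_neg, xP_add]; ring
    have e2 : v - δ - -(-wt R v i / (D.m i : ℤ)) • D.rootmP i =
        -δ + ((-wt R v i / (D.m i : ℤ)) • D.rootmP i + v) := by
      module
    have e3 : refl R (i : ι) • (v - δ) = -δ + (-D.rootmP i + (rootP R i + refl R (i : ι) • v)) := by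
      rw [smul_sub, refl_smul_weight (i : ι) δ, hδ i i.2, rootmP_eq]
      generalize refl R (i : ι) • v = u
      module
    have h1 := xP_ne_zero δ
    have h2 := xP_ne_zero (D.rootmP i)
    have h3 := one_sub_xP_rootmP_ne (D := D) (i : ι)
    have h4 := one_sub_sq_xP_rootmP_ne (D := D) (i : ι)
    have hk : algebraMap ℂ (FieldP R) (D.k i) ≠ 0 := (map_ne_zero _).2 (D.k_ne_zero i)
    have hA : D.inclK (D.dlA i) =
        (1 - algebraMap ℂ (FieldP R) (D.k i ^ 2) * xP R (D.rootmP i)) /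
          (1 - xP R (D.rootmP i)) / algebraMap ℂ (FieldP R) (D.k i) := by
      rw [dlA, map_div₀, map_div₀, map_sub, map_sub, map_one, map_mul, map_pow, inclK_kK, inclK_xK,
        inclP_rootm, map_pow]
    have hB : D.inclK (D.dlB i) = (algebraMap ℂ (FieldP R) (D.k i) -
        (algebraMap ℂ (FieldP R) (D.k i))⁻¹) / (1 - xP R (D.rootmP i)) := by
      rw [dlB, map_div₀, map_sub, map_sub, map_one, map_inv₀, inclK_kK, inclK_xK, inclP_rootm]
    rw [conjRep_apply, hrW, e1, G.weylOp_semilinear, G.weylOp_xP, RepParams.coeff, hg, hw,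
      sub_ediv_eq_neg_ediv hm, e2, e3, xP_add (-δ), xP_add (-δ), xP_add _ v, xP_add (-D.rootmP i),
      hA, hB, qwt_eq, wt_neg, xP_neg, xP_neg, map_sub, map_one, map_mul, map_mul]
    simp only [map_pow] at h4 ⊢
    field_simp
    ring

/-- For equal parameters, the action is the Chinta-Gunnells action. -/
theorem IsWeylRep.apply_s_eq [R.IsRootSystem] {σ : D.WK →+* Module.End ℂ (FieldP R)}
    (h : IsWeylRep b G σ) {t : ℂ} {g : ℤ → ℂ} (ht : ∀ i, D.k i ^ 2 = t)
    (hg : ∀ j y, G.g j y = g j) (i : b.support) (f : D.K) (v : weightLattice R) :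
    σ (D.ofW (refl R (i : ι))) (D.inclK f * xP R v) =
      D.inclK (refl R (i : ι) • f) * xP R (refl R (i : ι) • v) /
          (1 - algebraMap ℂ (FieldP R) t * xP R (D.rootmP i)) *
        (algebraMap ℂ (FieldP R) (1 - t) * xP R (-((-wt R v i % (D.m i : ℤ)) • rootP R i)) -
          algebraMap ℂ (FieldP R) (t * g (D.QZ i - D.BZ v i)) *
            xP R ((1 - (D.m i : ℤ)) • rootP R i) * (1 - xP R (D.rootmP i))) := by
  -- Division of -(λ, α_i^∨) by m(α_i): the quotient gives the exponent in σ, the remainder the one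
  -- in the Chinta-Gunnells formula.
  have h1 : (-wt R v i / (D.m i : ℤ)) • D.rootmP i + v =
      refl R (i : ι) • v + -((-wt R v i % (D.m i : ℤ)) • rootP R i) := by
    have h3 : wt R v i = -(-wt R v i % (D.m i : ℤ) + (D.m i : ℤ) * (-wt R v i / (D.m i : ℤ))) := by
      rw [Int.emod_add_mul_ediv, neg_neg]
    rw [refl_smul_weight]
    nth_rw 2 [h3]
    rw [rootmP_eq]
    module
  have h2 : (1 - (D.m i : ℤ)) • rootP R i = rootP R i + -D.rootmP i := by
    rw [rootmP_eq]; module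
  have h3 := congrArg (xP R) h1
  rw [xP_add, xP_add] at h3
  have h4 := xP_ne_zero (D.rootmP i)
  have h5 := one_sub_sq_xP_rootmP_ne (D := D) (i : ι)
  rw [ht] at h5
  rw [h.apply_s, ht, hg, qwt_eq, wt_neg, h2, xP_add, xP_add, xP_neg (D.rootmP i)]
  generalize xP R ((-wt R v i / (D.m i : ℤ)) • D.rootmP i) = a at *
  generalize xP R (-((-wt R v i % (D.m i : ℤ)) • rootP R i)) = c at *
  have h6 := inv_mul_cancel₀ h4
  generalize (xP R (D.rootmP i))⁻¹ = y at *
  linear_combination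
    (algebraMap ℂ (FieldP R) (1 - t) / (1 - algebraMap ℂ (FieldP R) t * xP R (D.rootmP i)) *
      D.inclK (refl R (i : ι) • f)) * h3 -
    (algebraMap ℂ (FieldP R) (t * g (D.QZ i - D.BZ v i)) /
      (1 - algebraMap ℂ (FieldP R) t * xP R (D.rootmP i)) * D.inclK (refl R (i : ι) • f) *
      xP R (rootP R i) * xP R (refl R (i : ι) • v)) * h6

end WeylRepresentation
end Datum
end Metaplectic

end

theorem mainTheorem2 {ι E N : Type*} [Fintype ι] [NormedAddCommGroup E] [InnerProductSpace ℝ E]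
    [AddCommGroup N] [Module ℝ N] (R : RootPairing ι ℝ E N)
    [R.IsRootSystem] [R.IsCrystallographic] [R.IsReduced] [R.IsIrreducible]
    (hR : ∀ (i : ι) (v : E), R.coroot' i v = 2 * inner ℝ v (R.root i) / ‖R.root i‖ ^ 2)
    (b : R.Base) (D : Metaplectic.Datum R) (G : D.RepParams) :
    -- the formulas define a unique module structure over the semidirect product
    (∃! σ : D.WK →+* Module.End ℂ (Metaplectic.FieldP R), Metaplectic.Datum.IsWeylRep b G σ) ∧
    -- the representation of the extended affine Hecke algebra
    (∃! π : D.H b →ₐ[ℂ] Module.End ℂ (Metaplectic.GroupAlgP R),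
      Metaplectic.Datum.IsHeckeRep b G π) ∧
    -- the localization isomorphism
    (∃! φ : D.WK ≃+* D.Hloc b, Metaplectic.Datum.IsLocIso b φ) ∧
    -- the action is the localized action of the Hecke algebra, conjugated by a monomial
    (∀ (σ : D.WK →+* Module.End ℂ (Metaplectic.FieldP R))
      (π : D.H b →ₐ[ℂ] Module.End ℂ (Metaplectic.GroupAlgP R)) (φ : D.WK ≃+* D.Hloc b),
      Metaplectic.Datum.IsWeylRep b G σ → Metaplectic.Datum.IsHeckeRep b G π →
      Metaplectic.Datum.IsLocIso b φ →
      ∃ Θ : D.RepLoc b π ≃+ Metaplectic.FieldP R, Metaplectic.Datum.IsLocIdent b π Θ ∧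
      ∃ δ : Metaplectic.weightLattice R,
        (δ : E) = Metaplectic.halfSum b (fun _ => 1) - Metaplectic.halfSum b (fun i => D.m i) ∧
        ∀ (X : D.WK) (F : Metaplectic.FieldP R),
          σ X F = Metaplectic.xP R δ * Θ (φ X • Θ.symm (Metaplectic.xP R (-δ) * F))) ∧
    -- for equal parameters it is the Chinta-Gunnells action
    (∀ (σ : D.WK →+* Module.End ℂ (Metaplectic.FieldP R)) (t : ℂ) (g : ℤ → ℂ),
      Metaplectic.Datum.IsWeylRep b G σ → (∀ i, D.k i ^ 2 = t) → (∀ j y, G.g j y = g j) →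
      ∀ (i : b.support) (f : D.K) (v : Metaplectic.weightLattice R),
        σ (D.ofW (Metaplectic.refl R (i : ι))) (D.inclK f * Metaplectic.xP R v) =
          D.inclK (Metaplectic.refl R (i : ι) • f) *
              Metaplectic.xP R (Metaplectic.refl R (i : ι) • v) /
            (1 - algebraMap ℂ (Metaplectic.FieldP R) t * Metaplectic.xP R (D.rootmP i)) *
          (algebraMap ℂ (Metaplectic.FieldP R) (1 - t) *
              Metaplectic.xP R
                (-((-Metaplectic.wt R v i % (D.m i : ℤ)) • Metaplectic.rootP R i)) -
            algebraMap ℂ (Metaplectic.FieldP R) (t * g (D.QZ i - D.BZ v i)) *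
              Metaplectic.xP R ((1 - (D.m i : ℤ)) • Metaplectic.rootP R i) *
              (1 - Metaplectic.xP R (D.rootmP i)))) := by
  -- The single action `r` on ℂ(P) provides everything: π is its restriction to ℂ[P] along `ψ`, and
  -- σ is its conjugate by x^δ.
  obtain ⟨r, hrK, hrW⟩ := G.exists_rep b hR
  obtain ⟨ψ, φ₀, hφ₀, hφψ, hψT, hψA⟩ := D.exists_locIso b
  obtain ⟨π₀, hπ₀⟩ := Metaplectic.Datum.exists_restrict_heckeHom hrK hrW hψT hψA
  have hrep := Metaplectic.Datum.RepParams.isHeckeRep_of_eq hrK hrW hψT hψA hπ₀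
  obtain ⟨δ, hδ, hδw⟩ := D.exists_rho_sub b
  have hweyl := Metaplectic.Datum.isWeylRep_conjRep hrK hrW hδw
  have hφ : ∀ φ : D.WK ≃+* D.Hloc b, Metaplectic.Datum.IsLocIso b φ → φ = φ₀ := fun φ h =>
    h.eq hφ₀
  refine ⟨⟨_, hweyl, fun σ h => h.eq hweyl⟩, ⟨π₀, hrep, fun π h => h.eq hrep⟩,
    ⟨φ₀, hφ₀, hφ⟩, ?_, fun σ t g h ht hg => h.apply_s_eq ht hg⟩
  intro σ π φ hσ hπ hφ'
  -- By uniqueness the given σ, π and φ are the constructed ones.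
  obtain rfl := hσ.eq hweyl
  obtain rfl := hπ.eq hrep
  obtain rfl := hφ φ hφ'
  obtain ⟨Θ, hΘ⟩ := Metaplectic.Datum.exists_locIdent hrK hψA hπ₀
  refine ⟨Θ, Metaplectic.Datum.isLocIdent_of_eq hrK hψA hπ₀ hφψ hφ'.apply_K hΘ, δ, hδ,
    fun X F => ?_⟩
  rw [Metaplectic.Datum.locIdent_smul hrK hψA hπ₀ hφψ hΘ, AddEquiv.apply_symm_apply]
  rfl
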